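/- **Setting.** Let $\mathfrak g$ be a finite-dimensional Lie algebra of compact type with basis $\xi_a$ of (linearly independent) hermitean matrices, $i[\xi_a,\xi_b]=\sum_e f_{abe}\xi_e$ with real, completely antisymmetric $f_{abe}$, and $\langle\xi_a|\xi_b\rangle=\delta_{ab}$. Let $c^\mu$ be a real vector-valued distribution on $\mathbb R^{1,3}$ with $\partial_\mu c^\mu=\delta$, supported in a closed convex cone $C$ containing no line, and let $(I_c^\mu f)(x)=\int d^4y\,c^\mu(y)f(x+y)$; then $I_c^\mu\partial_\mu=-\mathrm{id}$. Fields are functionals $X[A](x)$ of the $\mathfrak g$-valued potential $A_\mu$, whose components are real smooth functions with support meeting $K+C$ in a compact set for every compact $K$; the (commutative) Wick product is the pointwise product, and $\mathrm{ad}_{iX}(Y)=i[X,Y]$. Field identities are understood configuration by configuration, hence in particular on solutions of the wave equation. Put $F_{\mu\nu}=\partial_\mu A_\nu-\partial_\nu A_\mu$ and $A_\mu(c)=I_c^\nu F_{\mu\nu}$. Let $\mathcal S^{\mathfrak g}$ be the smallest real space of $\mathfrak g$-valued fields that contains $I_c^\nu(\mathrm{ad}_{is_k}\cdots\mathrm{ad}_{is_1}A_\nu)$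 ($k\ge0$) and $I_c^\nu(\mathrm{ad}_{is_k}\cdots\mathrm{ad}_{is_1}\partial_\nu s_0)$ ($k\ge1$) for all $s_0,\dots,s_k\in\mathcal S^{\mathfrak g}$, and let $\mathcal V^{\mathfrak g}$ be the real span of the vector fields $\mathrm{ad}_{is_k}\cdots\mathrm{ad}_{is_1}A_\nu$ and $\mathrm{ad}_{is_k}\cdots\mathrm{ad}_{is_1}\partial_\nu s_0$ ($k\ge0$, $s_i\in\mathcal S^{\mathfrak g}$). The coupling constant $g$ is a formal variable. For $\alpha\in g\mathcal V^{\mathfrak g}[[g]]$ and $U^\mu=\langle F^{\mu\nu}|\alpha_\nu\rangle$ let $\omega_U(X)(x)=i\int dx'\,\langle\alpha_\nu(x')|O_\mu(F^{\mu\nu}(x'),X(x))\rangle$ be the tree-level obstruction map (with $\alpha$ inert): it is the derivation which replaces, one at a time, each factor $A_{\kappa}(x)$ of $X$ by $i\int dx'\,\langle\alpha_\nu(x')|O_\mu(F^{\mu\nu}(x'),A_{\kappa}(x))\rangle$ with $$O_\mu(F_a^{\mu\nu}(x'),A_{\kappa,b}(x))=-\partial'^\nu\langle T N_a(x')A_{\kappa,b}(x)\rangle-\partial'_\mu\langle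 T F_a^{\mu\nu}(x')A_{\kappa,b}(x)\rangle,\qquad N=\partial^\mu A_\mu ,$$ computed from $\langle TA_{\nu,a}(x')A_{\kappa,b}(x)\rangle=-\delta_{ab}\eta_{\nu\kappa}T_0(x'-x)$, where $T_0$ is a complex distribution with $\square T_0=-i\delta$, and $\eta=\mathrm{diag}(1,-1,-1,-1)$. Let $F(\omega)=\sum_{k\ge0}\omega^k/(k+1)!$. For $\gamma\in g\mathcal S^{\mathfrak g}[[g]]$ let $W=e^{i\gamma}$ and $$\Sigma_\mu(\gamma)=\sum_{n\ge1}\tfrac1{n!}\,\mathrm{ad}_{i\gamma}^n\big(A_\mu+\tfrac{g^{-1}}{n+1}\partial_\mu\gamma\big).$$ **Proposition.** (i) If $\gamma\in g\mathcal S^{\mathfrak g}[[g]]$ and $\alpha\in g\mathcal V^{\mathfrak g}[[g]]$ satisfy the dressing ansatz $$e^{\omega_U}(A_\mu(c))=W\big(A_\mu+ig^{-1}\partial_\mu\big)W^{-1},\tag{1}$$ then $$I_c^\mu\big(W(gA_\mu+i\partial_\mu)W^{-1}\big)=0.\tag{2}$$ This holds configuration by configuration: if (1) holds at $A$, then so does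 (2). (ii) Equation (2) has exactly one solution $\gamma\in g\mathcal S^{\mathfrak g}[[g]]$, and any $\gamma'\in g\mathcal S^{\mathfrak g}[[g]]$ that satisfies (2) at a configuration $A$ coincides with $\gamma$ at $A$. The solution is given recursively: for every $n$, the coefficient of $g^n$ in $\gamma$ is the coefficient of $g^n$ in $I_c^\mu\big(gA_\mu+g\Sigma_\mu(\gamma^{<n})\big)$, where $\gamma^{<n}$ is the part of $\gamma$ of order less than $n$ in $g$. (iii) Let $\gamma$ be the solution from (ii). There is exactly one $\alpha\in g\mathcal V^{\mathfrak g}[[g]]$ with $F(\omega_U)(\alpha_\mu)=\Sigma_\mu(\gamma)$, $U^\mu=\langle F^{\mu\nu}|\alpha_\nu\rangle$. It satisfies (1), and it is given recursively: the coefficient of $g^n$ in $\alpha_\mu$ is the coefficient of $g^n$ in $\Sigma_\mu(\gamma)+\alpha^{<n}_\mu-F(\omega_{U^{<n}})(\alpha^{<n}_\mu)$, where $\alpha^{<n}$ is the part of order less than $n$ and $U^{<n}$ is formed with $\alpha^{<n}$. If $\mathfrak g\ne0$, then (1) alone does not determine $\alpha\in g\mathcal V^{\mathfrak g}[[g]]$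 uniquely. -/

import Mathlib

open scoped Distributions LineDeriv PowerSeries Pointwise ContDiff Topology

noncomputable section

namespace StringYM

/-! ### Minkowski space and string functions -/

/-- Minkowski space with coordinates `x⁰, …, x³` (the Euclidean norm only serves for topology). -/
abbrev Spacetime : Type := EuclideanSpace ℝ (Fin 4)

/-- The coordinate vector `e_μ`. -/
def dir (μ : Fin 4) : Spacetime := EuclideanSpace.single μ 1

/-- The diagonal entries of the metric, `η = diag(1, -1, -1, -1)`. -/
def eta (μ : Fin 4) : ℝ := if μ = 0 then 1 else -1

/-- The value `T(f)` of a distribution `T` supported in the closed set `S` on a function `f` that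
need not have compact support: `T(f) = T(ψ)` for any test function `ψ` that agrees with `f` in a
neighbourhood of `S`. -/
def evalNear {F : Type*} [AddCommGroup F] [Module ℝ F] [TopologicalSpace F]
    (T : 𝓓'((⊤ : TopologicalSpace.Opens Spacetime), F)) (S : Set Spacetime)
    (f : Spacetime → ℝ) : F := by
  classical
  exact if h : ∃ ψ : 𝓓((⊤ : TopologicalSpace.Opens Spacetime), ℝ), ψ =ᶠ[𝓝ˢ S] f
    then T h.choose else 0

/-- A string function: a real vector-valued distribution `c^μ` with `∂_μ c^μ = δ`, supported in a
closed convex cone that contains no line. -/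
structure StringFunction where
  cone : ProperCone ℝ Spacetime
  salient : ∀ y ∈ cone, -y ∈ cone → y = 0
  c : Fin 4 → 𝓓'((⊤ : TopologicalSpace.Opens Spacetime), ℝ)
  support : ∀ μ, Distribution.IsVanishingOn (c μ) (cone : Set Spacetime)ᶜ
  divergence : ∑ μ, ∂_{dir μ} (c μ) = Distribution.delta 0

/-! ### The gauge Lie algebra -/

/-- A Lie algebra `𝔤` of compact type, given by a basis `ξ_a` of hermitean matrices with
`i[ξ_a, ξ_b] = ∑_c f_{abc} ξ_c`, where the real structure constants are completely antisymmetric.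
The invariant form is `⟨ξ_a | ξ_b⟩ = δ_{ab}`. -/
structure GaugeAlgebra (ι d : Type*) [Fintype ι] [Fintype d] where
  ξ : ι → Matrix d d ℂ
  f : ι → ι → ι → ℝ
  hermitian : ∀ a, (ξ a).IsHermitian
  linearIndependent : LinearIndependent ℝ ξ
  commutator : ∀ a b, Complex.I • (ξ a * ξ b - ξ b * ξ a) = ∑ e, (f a b e : ℂ) • ξ e
  antisymm : ∀ a b e, f b a e = -f a b e
  cyclic : ∀ a b e, f b e a = f a b e

/-! ### Field configurations and the Wick algebra -/

/-- Functions whose support meets every `K + cone` (`K` compact) in a compact set; these are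
the functions that can be integrated along all strings `x + cone`. -/
def StringCompact (C : ProperCone ℝ Spacetime) (u : Spacetime → ℝ) : Prop :=
  ∀ K : Set Spacetime, IsCompact K → IsCompact (tsupport u ∩ (K + (C : Set Spacetime)))

theorem StringCompact.of_tsupport_subset {C : ProperCone ℝ Spacetime} {u : Spacetime → ℝ}
    {B : Set Spacetime} (h : tsupport u ⊆ B)
    (hB : ∀ K : Set Spacetime, IsCompact K → IsCompact (B ∩ (K + (C : Set Spacetime)))) :
    StringCompact C u := by
  intro K hK
  have hcl : IsClosed (K + (C : Set Spacetime)) :=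
    C.isClosed.add_left_of_isCompact hK
  refine (hB K hK).of_isClosed_subset ((isClosed_tsupport u).inter hcl) ?_
  exact Set.inter_subset_inter_left _ h

/-- Configurations `A_{μ,a}(x)` of the `𝔤`-valued vector potential (`μ` is a lower index). -/
def Config (C : ProperCone ℝ Spacetime) (ι : Type*) :
    Submodule ℝ (Fin 4 → ι → Spacetime → ℝ) where
  carrier := {A | ∀ μ a, ContDiff ℝ ∞ (A μ a) ∧ StringCompact C (A μ a)}
  zero_mem' := by
    intro μ a
    refine ⟨contDiff_const, StringCompact.of_tsupport_subset (B := ∅) ?_ (by simp)⟩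
    simp [tsupport]
  add_mem' := by
    intro A B hA hB μ a
    refine ⟨(hA μ a).1.add (hB μ a).1,
      StringCompact.of_tsupport_subset (tsupport_add (A μ a) (B μ a)) ?_⟩
    intro K hK
    rw [Set.union_inter_distrib_right]
    exact ((hA μ a).2 K hK).union ((hB μ a).2 K hK)
  smul_mem' := by
    intro r A hA μ a
    exact ⟨(hA μ a).1.const_smul r,
      StringCompact.of_tsupport_subset
        (tsupport_smul_subset_right (fun _ => r) (A μ a)) (hA μ a).2⟩

/-- Fields, as functionals `X[A](x)` of the field configuration; the Wick product is the
pointwise product. -/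
abbrev WickField (C : ProperCone ℝ Spacetime) (ι : Type*) : Type _ :=
  Config C ι → Spacetime → ℂ

variable {ι d : Type*} {C : ProperCone ℝ Spacetime}

/-- The field `A_μ = ∑_a A_{μ,a} ξ_a`, in components. -/
def potential (μ : Fin 4) (a : ι) : WickField C ι := fun A x => ((A.1 μ a x : ℝ) : ℂ)

/-- The derivative `∂_μ` of fields. -/
def pd (μ : Fin 4) (X : WickField C ι) : WickField C ι :=
  fun A x => fderiv ℝ (X A) x (dir μ)

/-- The string integration `(I_c^μ X)(x) = ∫ d⁴y c^μ(y) X(x + y)`. -/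
def stringInt (s : StringFunction) (μ : Fin 4) (X : WickField s.cone ι) : WickField s.cone ι :=
  fun A x =>
    ((evalNear (s.c μ) (s.cone : Set Spacetime) (fun y => (X A (x + y)).re) : ℝ) : ℂ)
      + Complex.I *
        ((evalNear (s.c μ) (s.cone : Set Spacetime) (fun y => (X A (x + y)).im) : ℝ) : ℂ)

/-- `I_c^ν v_ν` for a `𝔤`-valued vector field `v`. -/
def stringIntVec (s : StringFunction) (v : Fin 4 → ι → WickField s.cone ι) :
    ι → WickField s.cone ι :=
  fun a => ∑ ν, stringInt s ν (v ν a)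

/-- The free field strength `F_{μν} = ∂_μ A_ν - ∂_ν A_μ`. -/
def fieldStrength (μ ν : Fin 4) (a : ι) : WickField C ι :=
  pd μ (potential ν a) - pd ν (potential μ a)

/-- The string-localized potential `A_μ(c) = I_c^ν F_{μν}`. -/
def stringPotential (s : StringFunction) (μ : Fin 4) (a : ι) : WickField s.cone ι :=
  ∑ ν, stringInt s ν (fieldStrength μ ν a)

/-! ### The Lie bracket and the spaces `𝒮` and `𝒱` -/

/-- `ad_{iX}(Y) = i[X, Y] = ∑ f_{abe} X_a Y_b ξ_e` for `𝔤`-valued fields (or power series of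
fields), in components. -/
def ad {R : Type*} [CommRing R] [Algebra ℂ R] [Fintype ι] (f : ι → ι → ι → ℝ) (X Y : ι → R) :
    ι → R :=
  fun e => ∑ a, ∑ b, (f a b e : ℂ) • (X a * Y b)

/-- `ad_{is_k} ⋯ ad_{is_1}(v)` for the list `[s_k, …, s_1]`. -/
def adList [Fintype ι] (f : ι → ι → ι → ℝ) (l : List (ι → WickField C ι))
    (v : Fin 4 → ι → WickField C ι) : Fin 4 → ι → WickField C ι :=
  l.foldr (fun s w μ => ad f s (w μ)) v

/-- The gradient `∂_ν s` of a `𝔤`-valued scalar field. -/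
def grad (s : ι → WickField C ι) : Fin 4 → ι → WickField C ι := fun ν a => pd ν (s a)

/-- Membership in the smallest real subspace `𝒮` that contains
`I_c^ν(ad_{is_k} ⋯ ad_{is_1}(A_ν))` (`k ≥ 0`) and `I_c^ν(ad_{is_k} ⋯ ad_{is_1}(∂_ν s_0))`
(`k ≥ 1`) for `s_0, …, s_k` in `𝒮`. -/
inductive MemS [Fintype ι] (s : StringFunction) (f : ι → ι → ι → ℝ) :
    (ι → WickField s.cone ι) → Prop
  | zero : MemS s f 0
  | add {X Y} : MemS s f X → MemS s f Y → MemS s f (X + Y)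
  | smul (r : ℝ) {X} : MemS s f X → MemS s f (r • X)
  | ofPotential (l : List (ι → WickField s.cone ι)) (hl : ∀ X, X ∈ l → MemS s f X) :
      MemS s f (stringIntVec s (adList f l potential))
  | ofGrad (l : List (ι → WickField s.cone ι)) (hne : l ≠ []) (hl : ∀ X, X ∈ l → MemS s f X)
      {X₀} (h₀ : MemS s f X₀) : MemS s f (stringIntVec s (adList f l (grad X₀)))

/-- The space `𝒮^𝔤` of scalar fields. -/
def spaceS [Fintype ι] (s : StringFunction) (f : ι → ι → ι → ℝ) :
    Submodule ℝ (ι → WickField s.cone ι) where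
  carrier := {X | MemS s f X}
  zero_mem' := MemS.zero
  add_mem' := MemS.add
  smul_mem' := fun r _ h => MemS.smul r h

/-- The space `𝒱^𝔤` of vector fields: the smallest real subspace that contains `A_ν` and `∂_ν s`
(`s ∈ 𝒮`) and is closed under `ad_{is}` (`s ∈ 𝒮`). -/
def spaceV [Fintype ι] (s : StringFunction) (f : ι → ι → ι → ℝ) :
    Submodule ℝ (Fin 4 → ι → WickField s.cone ι) :=
  Submodule.span ℝ
    ({v | ∃ l : List (ι → WickField s.cone ι),
        (∀ X ∈ l, X ∈ spaceS s f) ∧ v = adList f l potential} ∪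
     {v | ∃ l : List (ι → WickField s.cone ι), (∀ X ∈ l, X ∈ spaceS s f) ∧
        ∃ X₀ ∈ spaceS s f, v = adList f l (grad X₀)})

/-- `γ ∈ g 𝒮^𝔤[[g]]`; the power series variable is the coupling constant `g`. -/
def InGS [Fintype ι] (s : StringFunction) (f : ι → ι → ι → ℝ)
    (γ : ι → (WickField s.cone ι)⟦X⟧) : Prop :=
  (∀ a, PowerSeries.coeff 0 (γ a) = 0) ∧
    ∀ n, (fun a => PowerSeries.coeff n (γ a)) ∈ spaceS s f

/-- `α ∈ g 𝒱^𝔤[[g]]`. -/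
def InGV [Fintype ι] (s : StringFunction) (f : ι → ι → ι → ℝ)
    (α : Fin 4 → ι → (WickField s.cone ι)⟦X⟧) : Prop :=
  (∀ μ a, PowerSeries.coeff 0 (α μ a) = 0) ∧
    ∀ n, (fun μ a => PowerSeries.coeff n (α μ a)) ∈ spaceV s f

/-- The coefficientwise extension of an operation on fields to power series in `g`. -/
def mapCoeff {R : Type*} [CommRing R] (φ : R → R) (u : R⟦X⟧) : R⟦X⟧ :=
  PowerSeries.mk fun n => φ (PowerSeries.coeff n u)

/-! ### Propagators, two-point obstructions and the obstruction map

All distributions depend on `z = x' - x`, so that `∂'_μ = ∂_{dir μ}`. -/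

/-- Complex distributions on Minkowski space. -/
abbrev CDist : Type := 𝓓'((⊤ : TopologicalSpace.Opens Spacetime), ℂ)

/-- `T₀` is a time-ordered function of the massless scalar field: `□ T₀ = -i δ`. -/
def IsPropagator (T₀ : CDist) : Prop :=
  ∀ ψ : 𝓓((⊤ : TopologicalSpace.Opens Spacetime), ℝ),
    (∑ μ, eta μ • ∂_{dir μ} (∂_{dir μ} T₀)) ψ = -Complex.I * (ψ 0 : ℂ)

/-- `⟨T A_{ν,a}(x') A_{κ,b}(x)⟩ = -δ_{ab} η_{νκ} T₀(x' - x)`. -/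
def propAA [DecidableEq ι] (T₀ : CDist) (ν : Fin 4) (a : ι) (κ : Fin 4) (b : ι) : CDist :=
  if ν = κ ∧ a = b then -(eta ν • T₀) else 0

/-- `⟨T N_a(x') A_{κ,b}(x)⟩` for the null field `N = ∂^μ A_μ`. -/
def propNA [DecidableEq ι] (T₀ : CDist) (a : ι) (κ : Fin 4) (b : ι) : CDist :=
  ∑ μ, eta μ • ∂_{dir μ} (propAA T₀ μ a κ b)

/-- `⟨T F_a^{μν}(x') A_{κ,b}(x)⟩` for `F^{μν} = ∂^μ A^ν - ∂^ν A^μ`. -/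
def propFA [DecidableEq ι] (T₀ : CDist) (μ ν : Fin 4) (a : ι) (κ : Fin 4) (b : ι) : CDist :=
  (eta μ * eta ν) • (∂_{dir μ} (propAA T₀ ν a κ b) - ∂_{dir ν} (propAA T₀ μ a κ b))

/-- The two-point obstruction `O_μ(F_a^{μν}(x'), A_{κ,b}(x))
= ⟨T ∂'_μ F_a^{μν}(x') A_{κ,b}(x)⟩ - ∂'_μ ⟨T F_a^{μν}(x') A_{κ,b}(x)⟩`, where the equation of motion
`∂_μ F^{μν} = -∂^ν N` is used in the first term. -/
def obstrFA [DecidableEq ι] (T₀ : CDist) (ν : Fin 4) (a : ι) (κ : Fin 4) (b : ι) : CDist :=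
  -(eta ν • ∂_{dir ν} (propNA T₀ a κ b)) - ∑ μ, ∂_{dir μ} (propFA T₀ μ ν a κ b)

/-- `i ∫ dx' ⟨α_ν(x') | O_μ(F^{μν}(x'), A_{κ,b}(x))⟩` at the configuration `A`. The two-point
obstructions are supported at `x' = x`. -/
def contraction [Fintype ι] [DecidableEq ι] (T₀ : CDist) (α : Fin 4 → ι → WickField C ι)
    (A : Config C ι) (κ : Fin 4) (b : ι) (x : Spacetime) : ℂ :=
  Complex.I * ∑ ν, ∑ a,
    (evalNear (obstrFA T₀ ν a κ b) {0} (fun z => (α ν a A (x + z)).re)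
      + Complex.I * evalNear (obstrFA T₀ ν a κ b) {0} (fun z => (α ν a A (x + z)).im))

/-- The contraction as a configuration (it is hermitean and has admissible support; otherwise
the value is `0`). -/
def contractionConfig [Fintype ι] [DecidableEq ι] (T₀ : CDist) (α : Fin 4 → ι → WickField C ι)
    (A : Config C ι) : Config C ι := by
  classical
  exact if h : ∃ B : Config C ι, ∀ κ b x, ((B.1 κ b x : ℝ) : ℂ) = contraction T₀ α A κ b x
    then h.choose else 0

/-- The obstruction map `ω_U(X)(x) = i ∫ dx' O_μ(U^μ(x'), X(x))` of the field
`U^μ = ⟨F^{μν} | α_ν⟩` with `α ∈ 𝒱^𝔤`. By Wick's theorem at tree level, exactly one factor of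
`U^μ` is contracted with one factor of `X`. The factor `α` is inert (it consists of `A_ν` with
`O_{[μ}(A_{ν]}, X) = 0`, and of the inert fields `𝒮^𝔤`), so `F^{μν}` is contracted with the
factors `A` of `X` in turn, that is, `X` is differentiated as a functional of `A` in the direction
in which `A_κ` is replaced by its contraction. -/
def obstruction [Fintype ι] [DecidableEq ι] (T₀ : CDist) (α : Fin 4 → ι → WickField C ι)
    (X : WickField C ι) : WickField C ι :=
  fun A x => deriv (fun t : ℝ => X (A + t • contractionConfig T₀ α A) x) 0

/-- The bilinear extension of `ω_U` to power series in `g`. -/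
def omega [Fintype ι] [DecidableEq ι] (T₀ : CDist) (α : Fin 4 → ι → (WickField C ι)⟦X⟧)
    (u : (WickField C ι)⟦X⟧) : (WickField C ι)⟦X⟧ :=
  PowerSeries.mk fun n => ∑ p ∈ Finset.HasAntidiagonal.antidiagonal n,
    obstruction T₀ (fun μ a => PowerSeries.coeff p.1 (α μ a)) (PowerSeries.coeff p.2 u)

/-- `e^{ω_U} = ∑_k ω_U^k / k!` for `α` without term of order `g⁰`; `ω_U^k` then raises the order
by at least `k`, so only `k ≤ n` contributes at order `gⁿ`. -/
def expOmega [Fintype ι] [DecidableEq ι] (T₀ : CDist) (α : Fin 4 → ι → (WickField C ι)⟦X⟧)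
    (u : (WickField C ι)⟦X⟧) : (WickField C ι)⟦X⟧ :=
  PowerSeries.mk fun n => ∑ k ∈ Finset.range (n + 1),
    ((k.factorial : ℂ)⁻¹) • PowerSeries.coeff n ((omega T₀ α)^[k] u)

/-- `F(ω_U) = (e^{ω_U} - 1) / ω_U = ∑_k ω_U^k / (k + 1)!`. -/
def FOmega [Fintype ι] [DecidableEq ι] (T₀ : CDist) (α : Fin 4 → ι → (WickField C ι)⟦X⟧)
    (u : (WickField C ι)⟦X⟧) : (WickField C ι)⟦X⟧ :=
  PowerSeries.mk fun n => ∑ k ∈ Finset.range (n + 1),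
    (((k + 1).factorial : ℂ)⁻¹) • PowerSeries.coeff n ((omega T₀ α)^[k] u)

/-! ### The dressing factor -/

/-- The matrix-valued field `∑_a X_a ξ_a`. -/
def toMatrix {R : Type*} [CommRing R] [Algebra ℂ R] [Fintype ι] (ξ : ι → Matrix d d ℂ)
    (X : ι → R) : Matrix d d R :=
  Matrix.of fun i j => ∑ a, (ξ a i j) • X a

/-- The exponential of a matrix-valued power series without term of order `g⁰`. -/
def matExp {R : Type*} [CommRing R] [Algebra ℂ R] [Fintype d] [DecidableEq d]
    (Y : Matrix d d R⟦X⟧) : Matrix d d R⟦X⟧ :=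
  Matrix.of fun i j => PowerSeries.mk fun n => ∑ k ∈ Finset.range (n + 1),
    ((k.factorial : ℂ)⁻¹) • PowerSeries.coeff n ((Y ^ k) i j)

/-- `W (g A_μ + i ∂_μ) W⁻¹` with `W = e^{iγ}`, `W⁻¹ = e^{-iγ}`. -/
def gaugeTransform [Fintype ι] [Fintype d] [DecidableEq d] (ξ : ι → Matrix d d ℂ)
    (γ : ι → (WickField C ι)⟦X⟧) (μ : Fin 4) : Matrix d d (WickField C ι)⟦X⟧ :=
  let W := matExp (Complex.I • toMatrix ξ γ)
  let Winv := matExp (-(Complex.I • toMatrix ξ γ))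
  (PowerSeries.X : (WickField C ι)⟦X⟧) •
      (W * toMatrix ξ (fun a => PowerSeries.C (potential μ a)) * Winv)
    + Complex.I • (W * Winv.map (mapCoeff (pd μ)))

/-- Equality of two power series of fields at the configuration `A`. -/
def EqAt (A : Config C ι) (u v : (WickField C ι)⟦X⟧) : Prop :=
  ∀ n x, PowerSeries.coeff n u A x = PowerSeries.coeff n v A x

/-- The dressing ansatz `e^{ω_U}(A_μ(c)) = W (A_μ + i g⁻¹ ∂_μ) W⁻¹` (multiplied by `g`), at the
configuration `A`, with `U^μ = ⟨F^{μν} | α_ν⟩` and `W = e^{iγ}`. -/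
def DressingAt [Fintype ι] [DecidableEq ι] [Fintype d] [DecidableEq d] (s : StringFunction)
    (T₀ : CDist) (ξ : ι → Matrix d d ℂ) (γ : ι → (WickField s.cone ι)⟦X⟧)
    (α : Fin 4 → ι → (WickField s.cone ι)⟦X⟧) (A : Config s.cone ι) : Prop :=
  ∀ μ i j, EqAt A
    (PowerSeries.X *
      toMatrix ξ (fun a => expOmega T₀ α (PowerSeries.C (stringPotential s μ a))) i j)
    (gaugeTransform ξ γ μ i j)

/-- The equation `I_c^μ (W (g A_μ + i ∂_μ) W⁻¹) = 0`, at the configuration `A`. -/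
def AxialAt [Fintype ι] [Fintype d] [DecidableEq d] (s : StringFunction)
    (ξ : ι → Matrix d d ℂ) (γ : ι → (WickField s.cone ι)⟦X⟧) (A : Config s.cone ι) : Prop :=
  ∀ i j, EqAt A (∑ μ, mapCoeff (stringInt s μ) (gaugeTransform ξ γ μ i j)) 0

/-- `Σ_μ(γ) = ∑_{n ≥ 1} (1/n!) ad_{iγ}^n (A_μ + g⁻¹/(n+1) ∂_μ γ)` for `γ` without term of order
`g⁰`; only `n ≤ m` contributes at order `g^m`. -/
def Sig [Fintype ι] (f : ι → ι → ι → ℝ) (γ : ι → (WickField C ι)⟦X⟧) (μ : Fin 4) (a : ι) :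
    (WickField C ι)⟦X⟧ :=
  PowerSeries.mk fun m => ∑ n ∈ Finset.Icc 1 m, ((n.factorial : ℂ)⁻¹) • PowerSeries.coeff m
    ((ad f γ)^[n] (fun b => PowerSeries.C (potential μ b) + (((n : ℂ) + 1)⁻¹) •
      PowerSeries.mk fun k => pd μ (PowerSeries.coeff (k + 1) (γ b))) a)

/-- The part of a power series of order less than `n`. -/
def below {R : Type*} [CommRing R] (n : ℕ) (u : R⟦X⟧) : R⟦X⟧ :=
  (PowerSeries.trunc n u : Polynomial R)

end StringYM

end

/-!
Write `W (g A_μ + i ∂_μ) W⁻¹ = g A_μ + ∂_μ γ + g Σ_μ(γ)` by expanding both conjugations into powers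
of `ad_{iγ}`. Since `I_c^μ ∂_μ = -id`, the axial equation says that `γ` is a fixed point of
`γ ↦ I_c^μ (g A_μ + g Σ_μ(γ))`. The coefficient of `gⁿ` on the right only involves lower orders
of `γ`, and only its values at the same configuration, so there is exactly one solution, order by
order and configuration by configuration.

The obstruction map `ω_U` commutes with `∂_μ` and `I_c` and sends `A_μ` to `α_μ`. As
`A_μ(c) = A_μ + ∂_μ I_c^ν A_ν` is the projection `P` of `A` along gradients onto the fields
annihilated by `I_c`, this gives `e^{ω_U}(A(c)) = P(A + F(ω_U)(α))`, which `I_c` annihilates.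
If `γ` solves the axial equation, the right-hand side of the dressing ansatz is `P(A + Σ(γ))`, so
the ansatz amounts to `P(F(ω_U)(α)) = P(Σ(γ))`. It thus follows from `F(ω_U)(α) = Σ(γ)`, and adding
a gradient to `Σ(γ)` yields another solution.
-/

open scoped Distributions LineDeriv PowerSeries Pointwise ContDiff Topology

noncomputable section

namespace StringYM

/-! ### Translates of test functions -/

section Translation

open TopologicalSpace

variable {E F G : Type*} [NormedAddCommGroup E] [NormedSpace ℝ E] [NormedAddCommGroup F]
  [NormedSpace ℝ F] [NormedAddCommGroup G] [NormedSpace ℝ G]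

theorem isSymmSndFDerivAt_of_contDiff {w : E → G} (hw : ContDiff ℝ ∞ w) (x : E) :
    IsSymmSndFDerivAt ℝ w x :=
  hw.contDiffAt.isSymmSndFDerivAt (by
    rw [minSmoothness_of_isRCLikeNormedField]
    exact WithTop.coe_le_coe.2 le_top)

theorem iteratedFDeriv_fderiv_apply {w : E → G} (hw : ContDiff ℝ ∞ w) (h : E) (i : ℕ) (x : E) :
    iteratedFDeriv ℝ i (fun y => fderiv ℝ w y h) x = fderiv ℝ (iteratedFDeriv ℝ i w) x h := by
  induction i generalizing x with
  | zero =>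
    ext m
    rw [← fderiv_continuousMultilinear_apply_const_apply
      ((hw.iteratedFDeriv_right (m := ∞) (i := 0)
        (by exact_mod_cast le_top)).differentiable (by simp) x)]
    simp
  | succ i ih =>
    have hwi : ContDiff ℝ ∞ (iteratedFDeriv ℝ i w) :=
      hw.iteratedFDeriv_right (by exact_mod_cast le_top)
    have hdiff : DifferentiableAt ℝ (fderiv ℝ (iteratedFDeriv ℝ i w)) x :=
      (hwi.fderiv_right (m := ∞) (by simp)).differentiable (by simp) x
    have hsymm := isSymmSndFDerivAt_of_contDiff hwi x
    ext m
    rw [← fderiv_continuousMultilinear_apply_const_apply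
      ((hw.iteratedFDeriv_right (m := ∞) (i := i + 1)
        (by exact_mod_cast le_top)).differentiable (by simp) x)]
    simp only [iteratedFDeriv_succ_apply_left, funext ih]
    rw [fderiv_continuousMultilinear_apply_const_apply
        (hdiff.clm_apply (differentiableAt_const (m 0))),
      fderiv_clm_apply hdiff (differentiableAt_const h),
      fderiv_clm_apply hdiff (differentiableAt_const (m 0))]
    simp [hsymm.eq h (m 0)]

theorem exists_forall_norm_taylor_le {w : E → G} (hw : ContDiff ℝ 1 w)
    (hc : HasCompactSupport w) {ε : ℝ} (hε : 0 < ε) :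
    ∃ δ > 0, ∀ h, ‖h‖ < δ → ∀ z, ‖w (z + h) - w z - fderiv ℝ w z h‖ ≤ ε * ‖h‖ := by
  have huc : UniformContinuous (fderiv ℝ w) :=
    (hc.fderiv ℝ).uniformContinuous_of_continuous (hw.continuous_fderiv (by simp))
  obtain ⟨δ, hδ, hclose⟩ := Metric.uniformContinuous_iff.1 huc ε hε
  refine ⟨δ, hδ, fun h hh z => ?_⟩
  have hbound : ∀ x ∈ Metric.ball z δ, ‖fderiv ℝ w x - fderiv ℝ w z‖ ≤ ε := fun x hx => by
    simpa [dist_eq_norm] using (hclose (Metric.mem_ball.1 hx)).le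
  simpa using (convex_ball z δ).norm_image_sub_le_of_norm_fderiv_le'
    (fun x _ => hw.differentiable (by simp) x) hbound (Metric.mem_ball_self hδ)
    (y := z + h) (by simpa using hh)

/-- Real test functions on `E`. -/
abbrev TestFun (E : Type*) [NormedAddCommGroup E] [NormedSpace ℝ E] : Type _ :=
  𝓓((⊤ : Opens E), ℝ)

theorem testFun_lineDeriv_apply (v : TestFun E) (h x : E) :
    (∂_{h} v : TestFun E) x = fderiv ℝ v x h := by
  rw [TestFunction.lineDerivOp_eq_lineDerivCLM ℝ, TestFunction.lineDerivCLM_eq_fderivCLM,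
    TestFunction.fderivCLM_apply]
  simp

/-- A smooth compactly supported function, as a test function. -/
def testFunOfSmooth (u : E → ℝ) (h : ContDiff ℝ ∞ u) (hc : HasCompactSupport u) : TestFun E :=
  ⟨u, h, hc, by simp⟩

/-- The translate `y ↦ v (x + y)` of a test function. -/
def translate (x : E) (v : TestFun E) : TestFun E :=
  testFunOfSmooth (fun y => v (x + y)) (v.contDiff.comp (contDiff_const.add contDiff_id))
    (v.hasCompactSupport.comp_homeomorph (Homeomorph.addLeft x))

@[simp]
theorem translate_apply (x : E) (v : TestFun E) (y : E) : translate x v y = v (x + y) := rfl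

theorem translate_lineDeriv (x h : E) (v : TestFun E) :
    translate x (∂_{h} v) = ∂_{h} (translate x v) := by
  ext y
  have hcoe : (translate x v : E → ℝ) = fun z => v (x + z) := rfl
  rw [translate_apply, testFun_lineDeriv_apply, testFun_lineDeriv_apply, hcoe,
    fderiv_comp_add_left]

theorem exists_norm_apply_le (T : 𝓓'((⊤ : Opens E), F)) (K : Compacts E) :
    ∃ (N : ℕ) (M : ℝ), 0 ≤ M ∧ ∀ (ψ : TestFun E) (ε : ℝ), 0 ≤ ε → Function.support ψ ⊆ K →
      (∀ i ≤ N, ∀ x, ‖iteratedFDeriv ℝ i ψ x‖ ≤ ε) → ‖T ψ‖ ≤ M * ε := by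
  have hK : (K : Set E) ⊆ (⊤ : Opens E) := by simp
  let L := (T : TestFun E →L[ℝ] F).comp (TestFunction.ofSupportedInCLM (n := ⊤) (F := ℝ) ℝ hK)
  have hcont : Continuous ((normSeminorm ℝ F).comp L.toLinearMap) := L.continuous.norm
  obtain ⟨s, M, -, hs⟩ := Seminorm.bound_of_continuous
    (ContDiffMapSupportedIn.withSeminorms ℝ E ℝ ⊤ K) _ hcont
  refine ⟨s.sup id, M, M.2, fun ψ ε hε hψ hle => ?_⟩
  let f : 𝓓^{⊤}_{K}(E, ℝ) := ContDiffMapSupportedIn.of_support_subset (f := ψ) ψ.contDiff hψ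
  refine (hs f).trans (mul_le_mul_of_nonneg_left ?_ M.2)
  refine Seminorm.finset_sup_apply_le hε fun i hi => ?_
  rw [ContDiffMapSupportedIn.seminorm_top_le_iff ℝ hε]
  exact fun x _ => hle i (Finset.le_sup (f := id) hi) x

/-- The first order Taylor remainder of `x ↦ v (x + ·)` for the increment `h`. -/
def translateRemainder (x : E) (v : TestFun E) (h : E) : TestFun E :=
  translate (x + h) v - translate x v - translate x (∂_{h} v)

theorem coe_translateRemainder (x : E) (v : TestFun E) (h : E) :
    (translateRemainder x v h : E → ℝ) =
      ((fun y => v (x + h + y)) - fun y => v (x + y)) - fun y => fderiv ℝ v (x + y) h := by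
  funext y
  change v (x + h + y) - v (x + y) - (∂_{h} v : TestFun E) (x + y) = _
  rw [testFun_lineDeriv_apply]
  rfl

theorem iteratedFDeriv_translateRemainder (x : E) (v : TestFun E) (h : E) (i : ℕ) (y : E) :
    iteratedFDeriv ℝ i (translateRemainder x v h) y =
      iteratedFDeriv ℝ i v (x + y + h) - iteratedFDeriv ℝ i v (x + y)
        - fderiv ℝ (iteratedFDeriv ℝ i v) (x + y) h := by
  have htranslate : ∀ {w : E → ℝ} (z : E), ContDiff ℝ ∞ w → ContDiff ℝ i fun y => w (z + y) :=
    fun z hw => (hw.of_le (by exact_mod_cast le_top)).comp (contDiff_const.add contDiff_id)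
  have hv : ContDiff ℝ ∞ v := v.contDiff
  have hdv : ContDiff ℝ ∞ fun y => fderiv ℝ v y h :=
    (hv.fderiv_right (m := ∞) (by simp)).clm_apply contDiff_const
  rw [coe_translateRemainder,
    iteratedFDeriv_sub (f := (fun y => v (x + h + y)) - fun y => v (x + y))
      ((htranslate _ hv).sub (htranslate _ hv)) (htranslate _ hdv),
    iteratedFDeriv_sub (htranslate _ hv) (htranslate _ hv)]
  simp only [Pi.sub_apply]
  rw [iteratedFDeriv_comp_add_left, iteratedFDeriv_comp_add_left,
    iteratedFDeriv_comp_add_left (f := fun y => fderiv ℝ v y h), iteratedFDeriv_fderiv_apply hv,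
    add_right_comm]

section FiniteDimensional

variable [FiniteDimensional ℝ E]

theorem exists_compacts_support_translateRemainder_subset (x : E) (v : TestFun E) :
    ∃ K : Compacts E, ∀ h, ‖h‖ ≤ 1 → Function.support (translateRemainder x v h) ⊆ K := by
  have := FiniteDimensional.proper_real E
  let K : Compacts E := ⟨tsupport v + Metric.closedBall (-x) 1,
    v.hasCompactSupport.isCompact.add (isCompact_closedBall _ _)⟩
  refine ⟨K, fun h hh y hy => ?_⟩
  by_contra hyK
  have hnotMem : ∀ k : E, ‖k‖ ≤ 1 → x + k + y ∉ tsupport v := fun k hk hmem =>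
    hyK (Set.mem_add.2 ⟨_, hmem, -x - k, by simpa using hk, by abel⟩)
  have hfar : x + h + y ∉ tsupport v := hnotMem h hh
  have hnear : x + y ∉ tsupport v := by simpa using hnotMem 0 (by simp)
  refine hy ?_
  rw [coe_translateRemainder]
  simp [image_eq_zero_of_notMem_tsupport hfar, image_eq_zero_of_notMem_tsupport hnear,
    fderiv_of_notMem_tsupport (𝕜 := ℝ) hnear]

theorem isLittleO_apply_translateRemainder (T : 𝓓'((⊤ : Opens E), F)) (x : E) (v : TestFun E) :
    (fun h => T (translateRemainder x v h)) =o[𝓝 0] fun h => h := by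
  obtain ⟨K, hK⟩ := exists_compacts_support_translateRemainder_subset x v
  obtain ⟨N, M, hM, hT⟩ := exists_norm_apply_le T K
  rw [Asymptotics.isLittleO_iff]
  intro c hc
  have htaylor : ∀ i : ℕ, ∃ δ > 0, ∀ h, ‖h‖ < δ → ∀ z,
      ‖iteratedFDeriv ℝ i v (z + h) - iteratedFDeriv ℝ i v z
        - fderiv ℝ (iteratedFDeriv ℝ i v) z h‖ ≤ c / (M + 1) * ‖h‖ := fun i =>
    exists_forall_norm_taylor_le
      (v.contDiff.iteratedFDeriv_right (m := 1) (by exact_mod_cast le_top))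
      (v.hasCompactSupport.iteratedFDeriv i) (by positivity)
  choose δ hδ0 hδ using htaylor
  have hball : ∀ {r : ℝ}, 0 < r → ∀ᶠ h : E in 𝓝 0, ‖h‖ < r := fun hr => by
    filter_upwards [Metric.ball_mem_nhds (0 : E) hr] with h hh using by simpa using hh
  filter_upwards [hball one_pos,
    (Finset.eventually_all (Finset.range (N + 1))).2 fun i _ => hball (hδ0 i)] with h h1 hhδ
  calc ‖T (translateRemainder x v h)‖
      ≤ M * (c / (M + 1) * ‖h‖) := by
        refine hT _ _ (by positivity) (hK h h1.le) fun i hi y => ?_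
        rw [iteratedFDeriv_translateRemainder]
        exact hδ i h (hhδ i (by simpa [Nat.lt_succ_iff] using hi)) _
    _ = M / (M + 1) * (c * ‖h‖) := by ring
    _ ≤ c * ‖h‖ := mul_le_of_le_one_left (by positivity)
        (div_le_one_of_le₀ (by linarith) (by linarith))

/-- The derivative of `x ↦ T (v (x + ·))`. -/
def applyTranslateDeriv (T : 𝓓'((⊤ : Opens E), F)) (v : TestFun E) (x : E) : E →L[ℝ] F :=
  LinearMap.toContinuousLinearMap
    { toFun := fun h => T (translate x (∂_{h} v))
      map_add' := fun h k => by
        rw [← map_add]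
        congr 1
        ext y
        exact DFunLike.congr_fun (LineDeriv.lineDerivOp_left_add h k v) (x + y)
      map_smul' := fun r h => by
        rw [RingHom.id_apply, ← map_smul]
        congr 1
        ext y
        exact DFunLike.congr_fun (LineDeriv.lineDerivOp_left_smul r h v) (x + y) }

@[simp]
theorem applyTranslateDeriv_apply (T : 𝓓'((⊤ : Opens E), F)) (v : TestFun E) (x h : E) :
    applyTranslateDeriv T v x h = T (translate x (∂_{h} v)) := rfl

theorem hasFDerivAt_apply_translate (T : 𝓓'((⊤ : Opens E), F)) (v : TestFun E) (x : E) :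
    HasFDerivAt (fun x => T (translate x v)) (applyTranslateDeriv T v x) x := by
  rw [hasFDerivAt_iff_isLittleO_nhds_zero]
  simpa only [translateRemainder, map_sub, applyTranslateDeriv_apply] using
    isLittleO_apply_translateRemainder T x v

theorem contDiff_apply_translate (T : 𝓓'((⊤ : Opens E), F)) (v : TestFun E) :
    ContDiff ℝ ∞ fun x => T (translate x v) := by
  refine contDiff_infty.2 fun n => ?_
  induction n generalizing v with
  | zero =>
    exact contDiff_zero.2 (continuous_iff_continuousAt.2 fun x =>
      (hasFDerivAt_apply_translate T v x).continuousAt)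
  | succ n ih =>
    rw [Nat.cast_succ, contDiff_succ_iff_hasFDerivAt]
    exact ⟨applyTranslateDeriv T v, contDiff_clm_apply_iff.2 fun h => ih (∂_{h} v),
      hasFDerivAt_apply_translate T v⟩

end FiniteDimensional

end Translation

/-! ### Tame functions -/

section Tame

variable {C : ProperCone ℝ Spacetime} {F G : Type*} [NormedAddCommGroup F] [NormedSpace ℝ F]
  [NormedAddCommGroup G] [NormedSpace ℝ G]

/-- Smooth functions whose support meets every `K + C` (`K` compact) in a compact set: those that
can be integrated against distributions supported in the cone `C`. -/
def Tame (C : ProperCone ℝ Spacetime) (u : Spacetime → F) : Prop :=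
  ContDiff ℝ ∞ u ∧
    ∀ K : Set Spacetime, IsCompact K → IsCompact (tsupport u ∩ (K + (C : Set Spacetime)))

namespace Tame

theorem of_tsupport_subset {u : Spacetime → F} {v : Spacetime → G} (hv : Tame C v)
    (hu : ContDiff ℝ ∞ u) (h : tsupport u ⊆ tsupport v) : Tame C u :=
  ⟨hu, fun K hK => (hv.2 K hK).of_isClosed_subset
    ((isClosed_tsupport u).inter (C.isClosed.add_left_of_isCompact hK))
    (Set.inter_subset_inter_left _ h)⟩

theorem of_hasCompactSupport {u : Spacetime → F} (hu : ContDiff ℝ ∞ u)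
    (h : HasCompactSupport u) : Tame C u :=
  ⟨hu, fun _ hK => h.isCompact.inter_right (C.isClosed.add_left_of_isCompact hK)⟩

theorem zero : Tame C (0 : Spacetime → F) :=
  of_hasCompactSupport contDiff_const HasCompactSupport.zero

theorem add {u v : Spacetime → F} (hu : Tame C u) (hv : Tame C v) : Tame C (u + v) := by
  refine ⟨hu.1.add hv.1, fun K hK => ?_⟩
  refine ((hu.2 K hK).union (hv.2 K hK)).of_isClosed_subset
    ((isClosed_tsupport _).inter (C.isClosed.add_left_of_isCompact hK)) ?_
  rw [← Set.union_inter_distrib_right]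
  exact Set.inter_subset_inter_left _ (tsupport_add u v)

theorem sum {κ : Type*} (t : Finset κ) {u : κ → Spacetime → F} (h : ∀ k ∈ t, Tame C (u k)) :
    Tame C (∑ k ∈ t, u k) :=
  Finset.sum_induction _ (Tame C) (fun _ _ => add) zero h

theorem clm_comp {u : Spacetime → F} (hu : Tame C u) (L : F →L[ℝ] G) : Tame C fun x => L (u x) :=
  hu.of_tsupport_subset (L.contDiff.comp hu.1) (tsupport_comp_subset (map_zero L) u)

theorem const_smul {R : Type*} [Monoid R] [DistribMulAction R F] [SMulCommClass ℝ R F]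
    [ContinuousConstSMul R F] {u : Spacetime → F} (hu : Tame C u) (r : R) : Tame C (r • u) :=
  hu.of_tsupport_subset (hu.1.const_smul r)
    (closure_mono (Function.support_const_smul_subset r u))

theorem mul {𝔸 : Type*} [NormedRing 𝔸] [NormedAlgebra ℝ 𝔸] {u v : Spacetime → 𝔸}
    (hu : Tame C u) (hv : Tame C v) : Tame C (u * v) :=
  hu.of_tsupport_subset (hu.1.mul hv.1) (closure_mono (Function.support_mul_subset_left u v))

theorem re {u : Spacetime → ℂ} (hu : Tame C u) : Tame C fun x => (u x).re :=
  hu.clm_comp Complex.reCLM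

theorem im {u : Spacetime → ℂ} (hu : Tame C u) : Tame C fun x => (u x).im :=
  hu.clm_comp Complex.imCLM

theorem ofReal {u : Spacetime → ℝ} (hu : Tame C u) : Tame C fun x => (u x : ℂ) :=
  hu.clm_comp Complex.ofRealCLM

theorem differentiable {u : Spacetime → F} (hu : Tame C u) : Differentiable ℝ u :=
  hu.1.differentiable (by simp)

end Tame

/-- The partial derivative `∂_μ` of functions on Minkowski space. -/
def partialDeriv (μ : Fin 4) (u : Spacetime → F) : Spacetime → F := fun x => fderiv ℝ u x (dir μ)

theorem Tame.partialDeriv {u : Spacetime → F} (hu : Tame C u) (μ : Fin 4) :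
    Tame C (partialDeriv μ u) := by
  refine hu.of_tsupport_subset
    ((hu.1.fderiv_right (m := ∞) (by simp)).clm_apply contDiff_const)
    (closure_minimal (fun x hx => ?_) (isClosed_tsupport u))
  by_contra h
  exact hx (by simp [StringYM.partialDeriv, fderiv_of_notMem_tsupport (𝕜 := ℝ) h])

theorem partialDeriv_zero (μ : Fin 4) : partialDeriv μ (0 : Spacetime → F) = 0 := by
  funext x
  simp [partialDeriv]

theorem partialDeriv_clm_comp {u : Spacetime → F} (hu : Differentiable ℝ u) (L : F →L[ℝ] G)
    (μ : Fin 4) : partialDeriv μ (fun y => L (u y)) = fun x => L (partialDeriv μ u x) := by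
  funext x
  have h : HasFDerivAt (fun y => L (u y)) (L.comp (fderiv ℝ u x)) x :=
    L.hasFDerivAt.comp x (hu x).hasFDerivAt
  simp only [partialDeriv, h.fderiv, ContinuousLinearMap.comp_apply]

theorem partialDeriv_mul {u v : Spacetime → ℂ} (hu : Differentiable ℝ u) (hv : Differentiable ℝ v)
    (μ : Fin 4) : partialDeriv μ (u * v) = partialDeriv μ u * v + u * partialDeriv μ v := by
  funext x
  simp only [partialDeriv, Pi.add_apply, Pi.mul_apply, fderiv_mul (hu x) (hv x), add_apply,
    smul_apply, smul_eq_mul]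
  ring

end Tame

section TameLinear

variable {C : ProperCone ℝ Spacetime} {𝕜 : Type*} [RCLike 𝕜]

/-- Operations on functions which are linear on the space of tame functions and preserve it. -/
structure IsTameLinear (C : ProperCone ℝ Spacetime) (L : (Spacetime → 𝕜) → Spacetime → 𝕜) :
    Prop where
  tame : ∀ {u}, Tame C u → Tame C (L u)
  map_add : ∀ {u v}, Tame C u → Tame C v → L (u + v) = L u + L v
  map_smul : ∀ (z : 𝕜) {u}, Tame C u → L (z • u) = z • L u

namespace IsTameLinear

variable {L L' : (Spacetime → 𝕜) → Spacetime → 𝕜}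

theorem map_zero (hL : IsTameLinear C L) : L 0 = 0 := by
  simpa using hL.map_smul 0 (u := 0) Tame.zero

theorem map_sum (hL : IsTameLinear C L) {κ : Type*} (t : Finset κ) {u : κ → Spacetime → 𝕜}
    (h : ∀ k ∈ t, Tame C (u k)) : L (∑ k ∈ t, u k) = ∑ k ∈ t, L (u k) := by
  classical
  induction t using Finset.induction_on with
  | empty => simp [hL.map_zero]
  | insert a t ha ih =>
    rw [Finset.sum_insert ha, Finset.sum_insert ha,
      hL.map_add (h a (by simp)) (Tame.sum t fun k hk => h k (by simp [hk])),
      ih fun k hk => h k (by simp [hk])]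

end IsTameLinear

theorem isTameLinear_partialDeriv (μ : Fin 4) :
    IsTameLinear C (partialDeriv μ : (Spacetime → 𝕜) → Spacetime → 𝕜) where
  tame h := h.partialDeriv μ
  map_add hu hv := by
    funext x
    simp [partialDeriv, fderiv_add (hu.differentiable x) (hv.differentiable x)]
  map_smul z u hu := by
    funext x
    simp [partialDeriv, fderiv_const_smul (hu.differentiable x)]

theorem isTameLinear_const_smul (z : 𝕜) :
    IsTameLinear C fun u : Spacetime → 𝕜 => z • u where
  tame h := h.const_smul z
  map_add _ _ := smul_add _ _ _
  map_smul _ _ _ := smul_comm _ _ _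

/-- The extension of an operation on real functions to complex functions. -/
def complexify (L : (Spacetime → ℝ) → Spacetime → ℝ) (u : Spacetime → ℂ) : Spacetime → ℂ :=
  fun x => (L (fun y => (u y).re) x : ℂ) + Complex.I * (L (fun y => (u y).im) x : ℂ)

variable {L : (Spacetime → ℝ) → Spacetime → ℝ}

@[simp]
theorem re_complexify (u : Spacetime → ℂ) (x : Spacetime) :
    (complexify L u x).re = L (fun y => (u y).re) x := by
  simp [complexify]

@[simp]
theorem im_complexify (u : Spacetime → ℂ) (x : Spacetime) :
    (complexify L u x).im = L (fun y => (u y).im) x := by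
  simp [complexify]

theorem complexify_partialDeriv (μ : Fin 4) {u : Spacetime → ℂ} (hu : Differentiable ℝ u) :
    complexify (partialDeriv μ) u = partialDeriv μ u := by
  funext x
  have hre := congrFun (partialDeriv_clm_comp hu Complex.reCLM μ) x
  have him := congrFun (partialDeriv_clm_comp hu Complex.imCLM μ) x
  exact Complex.ext ((re_complexify u x).trans hre) ((im_complexify u x).trans him)

theorem IsTameLinear.complexify (hL : IsTameLinear C L) : IsTameLinear C (complexify L) where
  tame hu := (hL.tame hu.re).ofReal.add ((hL.tame hu.im).ofReal.const_smul Complex.I)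
  map_add {u v} hu hv := by
    funext x
    refine Complex.ext ?_ ?_
    · exact (re_complexify _ x).trans ((congrFun (hL.map_add hu.re hv.re) x).trans (by simp))
    · exact (im_complexify _ x).trans ((congrFun (hL.map_add hu.im hv.im) x).trans (by simp))
  map_smul z u hu := by
    have hcomb : ∀ a b : ℝ, L (a • (fun y => (u y).re) + b • fun y => (u y).im)
        = a • L (fun y => (u y).re) + b • L fun y => (u y).im := fun a b => by
      rw [hL.map_add (hu.re.const_smul a) (hu.im.const_smul b), hL.map_smul a hu.re,
        hL.map_smul b hu.im]
    have hre : (fun y => ((z • u) y).re)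
        = z.re • (fun y => (u y).re) + (-z.im) • fun y => (u y).im := by
      funext y
      simp [sub_eq_add_neg]
    have him : (fun y => ((z • u) y).im)
        = z.im • (fun y => (u y).re) + z.re • fun y => (u y).im := by
      funext y
      simp [add_comm]
    funext x
    refine Complex.ext ?_ ?_
    · rw [re_complexify, hre, hcomb]
      simp [sub_eq_add_neg]
    · rw [im_complexify, him, hcomb]
      simp [add_comm]

end TameLinear

/-! ### Distributions supported in a cone -/

section ConeInt

variable {C : ProperCone ℝ Spacetime} {F : Type*} [NormedAddCommGroup F] [NormedSpace ℝ F]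
  {T : 𝓓'((⊤ : TopologicalSpace.Opens Spacetime), F)}

theorem evalNear_eq {S : Set Spacetime} (hT : Distribution.IsVanishingOn T Sᶜ) {f : Spacetime → ℝ}
    (ψ : TestFun Spacetime) (h : ψ =ᶠ[𝓝ˢ S] f) : evalNear T S f = T ψ := by
  have hex : ∃ ψ : TestFun Spacetime, ψ =ᶠ[𝓝ˢ S] f := ⟨ψ, h⟩
  rw [evalNear, dif_pos hex, ← sub_eq_zero, ← map_sub]
  refine hT _ fun x hx hxS => ?_
  have hzero : (hex.choose - ψ : TestFun Spacetime) =ᶠ[𝓝ˢ S] 0 := by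
    filter_upwards [hex.choose_spec, h] with y h1 h2
    exact sub_eq_zero.2 (h1.trans h2.symm)
  exact notMem_tsupport_iff_eventuallyEq.2 (hzero.filter_mono (nhds_le_nhdsSet hxS)) hx

/-- Multiplying by a bump function which is `1` on a large ball does not change `u` near `x + C`,
because `u` has compact support there. -/
theorem Tame.exists_translate_eventuallyEq {u : Spacetime → ℝ} (hu : Tame C u) (x₀ : Spacetime) :
    ∃ v : TestFun Spacetime,
      ∀ᶠ x in 𝓝 x₀, translate x v =ᶠ[𝓝ˢ (C : Set Spacetime)] fun y => u (x + y) := by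
  obtain ⟨R, hR⟩ := (hu.2 _ (isCompact_closedBall x₀ 2)).isBounded.subset_closedBall
    (0 : Spacetime)
  let χ : ContDiffBump (0 : Spacetime) := ⟨max R 1, max R 1 + 1, by positivity, by simp⟩
  refine ⟨testFunOfSmooth (fun x => χ x * u x) (χ.contDiff.mul hu.1)
    χ.hasCompactSupport.mul_right, ?_⟩
  filter_upwards [Metric.ball_mem_nhds x₀ one_pos] with x hx
  filter_upwards [Metric.thickening_mem_nhdsSet (C : Set Spacetime) one_pos] with y hy
  obtain ⟨c, hc, hyc⟩ := Metric.mem_thickening_iff.1 hy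
  change χ (x + y) * u (x + y) = u (x + y)
  by_cases h0 : u (x + y) = 0
  · simp [h0]
  have hnear : x + (y - c) ∈ Metric.closedBall x₀ 2 := by
    rw [Metric.mem_closedBall, dist_eq_norm, add_sub_right_comm]
    rw [Metric.mem_ball, dist_eq_norm] at hx
    rw [dist_eq_norm] at hyc
    exact (norm_add_le _ _).trans (by linarith)
  have hmem : x + y ∈ Metric.closedBall (0 : Spacetime) R :=
    hR ⟨subset_tsupport _ h0, Set.mem_add.2 ⟨_, hnear, c, hc, by abel⟩⟩
  rw [χ.one_of_mem_closedBall (Metric.closedBall_subset_closedBall (le_max_left R 1) hmem),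
    one_mul]

theorem translate_lineDeriv_eventuallyEq {S : Set Spacetime} {u : Spacetime → ℝ}
    {v : TestFun Spacetime} {x : Spacetime} (ν : Fin 4)
    (h : translate x v =ᶠ[𝓝ˢ S] fun y => u (x + y)) :
    translate x (∂_{dir ν} v) =ᶠ[𝓝ˢ S] fun y => partialDeriv ν u (x + y) := by
  filter_upwards [h.eventually_nhdsSet] with y hy
  have hy' : translate x v =ᶠ[𝓝 y] fun z => u (x + z) := hy
  rw [translate_lineDeriv, testFun_lineDeriv_apply, hy'.fderiv_eq, partialDeriv,
    fderiv_comp_add_left]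

/-- The integral `∫ d⁴y T(y) u(x + y)` over the cone `C`, for a distribution `T` supported
in `C`. -/
def coneInt (T : 𝓓'((⊤ : TopologicalSpace.Opens Spacetime), F)) (C : ProperCone ℝ Spacetime)
    (u : Spacetime → ℝ) : Spacetime → F :=
  fun x => evalNear T (C : Set Spacetime) fun y => u (x + y)

variable (hT : Distribution.IsVanishingOn T (C : Set Spacetime)ᶜ)

include hT

theorem coneInt_apply {u : Spacetime → ℝ} {v : TestFun Spacetime} {x : Spacetime}
    (h : translate x v =ᶠ[𝓝ˢ (C : Set Spacetime)] fun y => u (x + y)) :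
    coneInt T C u x = T (translate x v) :=
  evalNear_eq hT _ h

theorem coneInt_add {u v : Spacetime → ℝ} (hu : Tame C u) (hv : Tame C v) :
    coneInt T C (u + v) = coneInt T C u + coneInt T C v := by
  funext x
  obtain ⟨u', hu'⟩ := hu.exists_translate_eventuallyEq x
  obtain ⟨v', hv'⟩ := hv.exists_translate_eventuallyEq x
  rw [Pi.add_apply, coneInt_apply hT hu'.self_of_nhds, coneInt_apply hT hv'.self_of_nhds,
    ← map_add]
  exact evalNear_eq hT (translate x u' + translate x v') (hu'.self_of_nhds.add hv'.self_of_nhds)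

theorem coneInt_smul (r : ℝ) {u : Spacetime → ℝ} (hu : Tame C u) :
    coneInt T C (r • u) = r • coneInt T C u := by
  funext x
  obtain ⟨u', hu'⟩ := hu.exists_translate_eventuallyEq x
  rw [Pi.smul_apply, coneInt_apply hT hu'.self_of_nhds, ← map_smul]
  exact evalNear_eq hT (r • translate x u') (hu'.self_of_nhds.const_smul r)

theorem Tame.exists_coneInt_eventuallyEq {u : Spacetime → ℝ} (hu : Tame C u) (x : Spacetime) :
    ∃ v : TestFun Spacetime, coneInt T C u =ᶠ[𝓝 x] (fun x => T (translate x v)) ∧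
      ∀ ν, coneInt T C (StringYM.partialDeriv ν u) x = T (translate x (∂_{dir ν} v)) := by
  obtain ⟨v, hv⟩ := hu.exists_translate_eventuallyEq x
  exact ⟨v, hv.mono fun y hy => coneInt_apply hT hy, fun ν =>
    coneInt_apply hT (translate_lineDeriv_eventuallyEq ν hv.self_of_nhds)⟩

theorem contDiff_coneInt {u : Spacetime → ℝ} (hu : Tame C u) : ContDiff ℝ ∞ (coneInt T C u) := by
  refine contDiff_iff_contDiffAt.2 fun x => ?_
  obtain ⟨v, hv, -⟩ := hu.exists_coneInt_eventuallyEq hT x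
  exact (contDiff_apply_translate T v).contDiffAt.congr_of_eventuallyEq hv

theorem partialDeriv_coneInt (ν : Fin 4) {u : Spacetime → ℝ} (hu : Tame C u) :
    partialDeriv ν (coneInt T C u) = coneInt T C (partialDeriv ν u) := by
  funext x
  obtain ⟨v, hv, hd⟩ := hu.exists_coneInt_eventuallyEq hT x
  rw [hd, partialDeriv, hv.fderiv_eq, (hasFDerivAt_apply_translate T v x).fderiv,
    applyTranslateDeriv_apply]

theorem exists_add_mem_tsupport_of_coneInt_ne_zero {u : Spacetime → ℝ} {x : Spacetime}
    (hx : coneInt T C u x ≠ 0) : ∃ c ∈ C, x + c ∈ tsupport u := by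
  by_contra! hno
  have hzero : (0 : TestFun Spacetime) =ᶠ[𝓝ˢ (C : Set Spacetime)] fun y => u (x + y) := by
    rw [Filter.EventuallyEq, Filter.Eventually, mem_nhdsSet_iff_forall]
    intro c hc
    have hlim : Filter.Tendsto (fun y => x + y) (𝓝 c) (𝓝 (x + c)) :=
      (continuous_const.add continuous_id).tendsto c
    filter_upwards [hlim.eventually (notMem_tsupport_iff_eventuallyEq.1 (hno c hc))] with y hy
    exact hy.symm
  exact hx ((evalNear_eq hT 0 hzero).trans (map_zero T))

end ConeInt

/-! ### Salient cones -/

section SalientCone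

variable {C : ProperCone ℝ Spacetime} (hC : ∀ y ∈ C, -y ∈ C → y = 0)

include hC

theorem exists_norm_le_norm_add : ∃ κ > 0, ∀ a ∈ C, ∀ b ∈ C, κ * ‖a‖ ≤ ‖a + b‖ := by
  have hS : IsCompact (Metric.sphere (0 : Spacetime) 1 ∩ C) :=
    (isCompact_sphere _ _).inter_right C.isClosed
  have h0 : (0 : Spacetime) ∉ (Metric.sphere (0 : Spacetime) 1 ∩ C) + (C : Set Spacetime) := by
    rintro ⟨a, ⟨ha1, ha⟩, b, hb, hab⟩
    have hneg : -a = b := neg_eq_of_add_eq_zero_right hab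
    have ha0 := hC a ha (hneg ▸ hb)
    simp [ha0] at ha1
  obtain ⟨κ, hκ, hball⟩ :=
    Metric.isOpen_iff.1 (C.isClosed.add_left_of_isCompact hS).isOpen_compl 0 h0
  refine ⟨κ, hκ, fun a ha b hb => ?_⟩
  by_contra! hlt
  have ha0 : 0 < ‖a‖ := by
    refine norm_pos_iff.2 fun ha0 => hlt.not_ge ?_
    simp [ha0]
  have hmem : ‖a‖⁻¹ • (a + b) ∈ Metric.ball (0 : Spacetime) κ := by
    rwa [mem_ball_zero_iff, norm_smul, norm_inv, norm_norm, inv_mul_lt_iff₀ ha0, mul_comm]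
  refine hball hmem ?_
  rw [smul_add]
  refine Set.add_mem_add ⟨?_, C.smul_mem ha (by positivity)⟩ (C.smul_mem hb (by positivity))
  simp [norm_smul, ha0.ne']

theorem isCompact_add_cone_inter_sub_cone {P Q : Set Spacetime} (hP : IsCompact P)
    (hQ : IsCompact Q) : IsCompact ((P + (C : Set Spacetime)) ∩ (Q - (C : Set Spacetime))) := by
  obtain ⟨κ, hκ, hle⟩ := exists_norm_le_norm_add hC
  obtain ⟨p, hp⟩ := hP.isBounded.exists_norm_le
  obtain ⟨q, hq⟩ := hQ.isBounded.exists_norm_le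
  have hclosed : IsClosed (Q - (C : Set Spacetime)) := by
    rw [sub_eq_add_neg]
    exact C.isClosed.neg.add_left_of_isCompact hQ
  refine (isCompact_closedBall (0 : Spacetime) (p + (q + p) / κ)).of_isClosed_subset
    ((C.isClosed.add_left_of_isCompact hP).inter hclosed) ?_
  rintro _ ⟨⟨a, ha, b, hb, rfl⟩, ⟨a', ha', b', hb', hab'⟩⟩
  have hbb' : b + b' = a' - a := by
    rw [sub_eq_iff_eq_add.1 hab']
    simp [add_comm, add_left_comm]
  have hb_le : ‖b‖ ≤ (q + p) / κ := by
    rw [le_div_iff₀' hκ]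
    calc κ * ‖b‖ ≤ ‖b + b'‖ := hle b hb b' hb'
      _ = ‖a' - a‖ := by rw [hbb']
      _ ≤ q + p := (norm_sub_le _ _).trans (add_le_add (hq _ ha') (hp _ ha))
  exact mem_closedBall_zero_iff.2 ((norm_add_le _ _).trans (add_le_add (hp _ ha) hb_le))

theorem isCompact_tsupport_inter_add_cone {F : Type*} [Zero F] {w : Spacetime → F}
    {S : Set Spacetime} (hS : ∀ K, IsCompact K → IsCompact (S ∩ (K + (C : Set Spacetime))))
    (hw : ∀ x, w x ≠ 0 → ∃ c ∈ C, x + c ∈ S) {K : Set Spacetime} (hK : IsCompact K) :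
    IsCompact (tsupport w ∩ (K + (C : Set Spacetime))) := by
  have hK' : IsCompact (K + Metric.closedBall (0 : Spacetime) 1) :=
    hK.add (isCompact_closedBall _ _)
  have hM := isCompact_add_cone_inter_sub_cone hC hK' (hS _ hK')
  let U : Set Spacetime := K + Metric.ball 0 1 + (C : Set Spacetime)
  have hU : IsOpen U := Metric.isOpen_ball.add_left.add_right
  have hKU : K + (C : Set Spacetime) ⊆ U :=
    Set.add_subset_add_right (Set.subset_add_left _ (by simp))
  refine hM.of_isClosed_subset
    ((isClosed_tsupport w).inter (C.isClosed.add_left_of_isCompact hK)) fun z hz => ?_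
  refine closure_minimal ?_ hM.isClosed (hU.inter_closure ⟨hKU hz.2, hz.1⟩)
  rintro x ⟨hxU, hx⟩
  obtain ⟨k, hk, b, hb, rfl⟩ :=
    Set.add_subset_add_right (Set.add_subset_add_left Metric.ball_subset_closedBall) hxU
  obtain ⟨c, hc, hxc⟩ := hw _ hx
  refine ⟨Set.add_mem_add hk hb, Set.mem_sub.2 ⟨k + b + c, ⟨hxc, ?_⟩, c, hc, by simp⟩⟩
  exact Set.mem_add.2 ⟨k, hk, b + c, C.add_mem hb hc, (add_assoc _ _ _).symm⟩

theorem Tame.coneInt {F : Type*} [NormedAddCommGroup F] [NormedSpace ℝ F]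
    {T : 𝓓'((⊤ : TopologicalSpace.Opens Spacetime), F)}
    (hT : Distribution.IsVanishingOn T (C : Set Spacetime)ᶜ) {u : Spacetime → ℝ} (hu : Tame C u) :
    Tame C (coneInt T C u) :=
  ⟨contDiff_coneInt hT hu, fun _ => isCompact_tsupport_inter_add_cone hC hu.2 fun _ =>
    exists_add_mem_tsupport_of_coneInt_ne_zero hT⟩

theorem isTameLinear_coneInt {T : 𝓓'((⊤ : TopologicalSpace.Opens Spacetime), ℝ)}
    (hT : Distribution.IsVanishingOn T (C : Set Spacetime)ᶜ) :
    IsTameLinear C (StringYM.coneInt T C) where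
  tame := Tame.coneInt hC hT
  map_add := coneInt_add hT
  map_smul := coneInt_smul hT

end SalientCone

/-! ### String integration of functions -/

section FunInt

variable {s : StringFunction}

/-- The string integral `I_c^μ` of complex functions. -/
def funInt (s : StringFunction) (μ : Fin 4) : (Spacetime → ℂ) → Spacetime → ℂ :=
  complexify (coneInt (s.c μ) s.cone)

theorem isTameLinear_funInt (s : StringFunction) (μ : Fin 4) :
    IsTameLinear s.cone (funInt s μ) :=
  (isTameLinear_coneInt s.salient (s.support μ)).complexify

theorem partialDeriv_funInt (μ ν : Fin 4) {u : Spacetime → ℂ} (hu : Tame s.cone u) :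
    partialDeriv ν (funInt s μ u) = funInt s μ (partialDeriv ν u) := by
  rw [← complexify_partialDeriv ν hu.differentiable,
    ← complexify_partialDeriv ν ((isTameLinear_funInt s μ).tame hu).differentiable]
  funext x
  refine Complex.ext ?_ ?_
  · simpa [funInt] using congrFun (partialDeriv_coneInt (s.support μ) ν hu.re) x
  · simpa [funInt] using congrFun (partialDeriv_coneInt (s.support μ) ν hu.im) x

/-- The real form of `I_c^μ ∂_μ = -id`: evaluate `∂_μ c^μ = δ` on translates. -/
theorem sum_coneInt_partialDeriv {u : Spacetime → ℝ} (hu : Tame s.cone u) :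
    ∑ μ, coneInt (s.c μ) s.cone (partialDeriv μ u) = -u := by
  funext x
  obtain ⟨v, hv⟩ := hu.exists_translate_eventuallyEq x
  have hvx : v x = u x := by
    simpa using (hv.self_of_nhds.filter_mono (nhds_le_nhdsSet s.cone.zero_mem)).self_of_nhds
  have hdiv := congrArg (fun T : 𝓓'((⊤ : TopologicalSpace.Opens Spacetime), ℝ) =>
    T (translate x v)) s.divergence
  simp only [sum_apply, Distribution.lineDerivOp_apply_apply, Distribution.delta_apply,
    translate_apply, add_zero, map_neg, Finset.sum_neg_distrib] at hdiv
  rw [Finset.sum_apply, Pi.neg_apply, ← hvx, ← hdiv, neg_neg]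
  refine Finset.sum_congr rfl fun μ _ => ?_
  rw [coneInt_apply (s.support μ) (translate_lineDeriv_eventuallyEq μ hv.self_of_nhds),
    translate_lineDeriv]

theorem sum_funInt_partialDeriv {u : Spacetime → ℂ} (hu : Tame s.cone u) :
    ∑ μ, funInt s μ (partialDeriv μ u) = -u := by
  have hcongr : ∀ μ, funInt s μ (partialDeriv μ u) = funInt s μ (complexify (partialDeriv μ) u) :=
    fun μ => by rw [complexify_partialDeriv μ hu.differentiable]
  simp only [hcongr]
  funext x
  refine Complex.ext ?_ ?_
  · simpa [funInt] using congrFun (sum_coneInt_partialDeriv hu.re) x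
  · simpa [funInt] using congrFun (sum_coneInt_partialDeriv hu.im) x

theorem im_funInt_eq_zero (μ : Fin 4) {u : Spacetime → ℂ} (hu : ∀ x, (u x).im = 0)
    (x : Spacetime) : (funInt s μ u x).im = 0 := by
  have him : (fun y => (u y).im) = 0 := funext hu
  rw [funInt, im_complexify, him, (isTameLinear_coneInt s.salient (s.support μ)).map_zero,
    Pi.zero_apply]

end FunInt

/-! ### Fields depending polynomially on the configuration -/

section RegularFields

variable {ι : Type*} {C : ProperCone ℝ Spacetime} {s : StringFunction}

/-- The polynomial `p` with tame coefficients describes the field `X` on the line `A + t B`. -/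
def IsLinePoly (X : WickField C ι) (A B : Config C ι) (p : Polynomial (Spacetime → ℂ)) : Prop :=
  (∀ k, Tame C (p.coeff k)) ∧ ∀ t : ℝ, X (A + t • B) = p.eval fun _ => (t : ℂ)

/-- Fields that are polynomial, with tame coefficients, on all lines in configuration space. These
are fields which can be integrated along strings and differentiated as functionals. -/
def Regular (X : WickField C ι) : Prop := ∀ A B, ∃ p, IsLinePoly X A B p

/-- The derivative of a field, as a functional, in the direction of a configuration. -/
def dirDeriv (X : WickField C ι) (A B : Config C ι) : Spacetime → ℂ :=
  fun x => deriv (fun t : ℝ => X (A + t • B) x) 0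

namespace IsLinePoly

variable {X Y : WickField C ι} {A B : Config C ι} {p q : Polynomial (Spacetime → ℂ)}

theorem apply_self (h : IsLinePoly X A B p) : X A = p.coeff 0 := by
  have h0 := h.2 0
  rw [zero_smul, add_zero] at h0
  rw [h0, Polynomial.coeff_zero_eq_eval_zero]
  congr 1

theorem dirDeriv_eq (h : IsLinePoly X A B p) : dirDeriv X A B = p.coeff 1 := by
  funext x
  let px : Polynomial ℂ := p.map (Pi.evalRingHom (fun _ => ℂ) x)
  have hX : (fun t : ℝ => X (A + t • B) x) = fun t : ℝ => px.eval (t : ℂ) := by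
    funext t
    rw [h.2 t]
    exact (Polynomial.eval_map_apply (Pi.evalRingHom (fun _ => ℂ) x) (fun _ => (t : ℂ))).symm
  rw [dirDeriv, hX, (px.hasDerivAt ((0 : ℝ) : ℂ)).comp_ofReal.deriv, Complex.ofReal_zero,
    ← Polynomial.coeff_zero_eq_eval_zero, Polynomial.coeff_derivative]
  simp [px]

theorem add (hp : IsLinePoly X A B p) (hq : IsLinePoly Y A B q) :
    IsLinePoly (X + Y) A B (p + q) :=
  ⟨fun k => by rw [Polynomial.coeff_add]; exact (hp.1 k).add (hq.1 k),
    fun t => by rw [Polynomial.eval_add, ← hp.2, ← hq.2]; rfl⟩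

theorem mul (hp : IsLinePoly X A B p) (hq : IsLinePoly Y A B q) :
    IsLinePoly (X * Y) A B (p * q) :=
  ⟨fun k => by
    rw [Polynomial.coeff_mul]
    exact Tame.sum _ fun x _ => (hp.1 x.1).mul (hq.1 x.2),
    fun t => by rw [Polynomial.eval_mul, ← hp.2, ← hq.2]; rfl⟩

theorem map (hp : IsLinePoly X A B p) {L : (Spacetime → ℂ) → Spacetime → ℂ}
    (hL : IsTameLinear C L) :
    ∃ q, IsLinePoly (fun A => L (X A)) A B q ∧ ∀ k, q.coeff k = L (p.coeff k) := by
  let q : Polynomial (Spacetime → ℂ) :=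
    ∑ k ∈ Finset.range (p.natDegree + 1), Polynomial.monomial k (L (p.coeff k))
  have hq : ∀ k, q.coeff k = L (p.coeff k) := by
    intro k
    simp only [q, Polynomial.finsetSum_coeff, Polynomial.coeff_monomial, Finset.sum_ite_eq',
      Finset.mem_range]
    split_ifs with hk
    · rfl
    · rw [Polynomial.coeff_eq_zero_of_natDegree_lt (by omega), hL.map_zero]
  refine ⟨q, ⟨fun k => hq k ▸ hL.tame (hp.1 k), fun t => ?_⟩, hq⟩
  have hpow : ∀ u : Spacetime → ℂ, ∀ k : ℕ, u * (fun _ => (t : ℂ)) ^ k = ((t : ℂ) ^ k) • u :=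
    fun u k => by
      funext x
      simp [mul_comm]
  calc L (X (A + t • B))
      = L (∑ k ∈ Finset.range (p.natDegree + 1), ((t : ℂ) ^ k) • p.coeff k) := by
        simp only [hp.2, Polynomial.eval_eq_sum_range, hpow]
    _ = ∑ k ∈ Finset.range (p.natDegree + 1), ((t : ℂ) ^ k) • L (p.coeff k) := by
        rw [hL.map_sum _ fun k _ => (hp.1 k).const_smul _]
        exact Finset.sum_congr rfl fun k _ => hL.map_smul _ (hp.1 k)
    _ = q.eval fun _ => (t : ℂ) := by
        simp only [q, Polynomial.eval_finsetSum, Polynomial.eval_monomial, hpow]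

end IsLinePoly

theorem isLinePoly_potential (μ : Fin 4) (a : ι) (A B : Config C ι) :
    IsLinePoly (potential μ a) A B (Polynomial.C (potential μ a A)
      + Polynomial.C (potential μ a B) * Polynomial.X) := by
  have hA : ∀ A : Config C ι, Tame C (potential μ a A) := fun A => Tame.ofReal (A.2 μ a)
  refine ⟨fun k => ?_, fun t => ?_⟩
  · match k with
    | 0 => simpa using hA A
    | 1 => simpa using hA B
    | k + 2 => simpa [Polynomial.coeff_C] using Tame.zero
  · funext x
    simp only [potential, Polynomial.eval_add, Polynomial.eval_mul, Polynomial.eval_C,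
      Polynomial.eval_X, Pi.add_apply, Pi.mul_apply, Submodule.coe_add, Submodule.coe_smul,
      Pi.smul_apply, smul_eq_mul]
    push_cast
    ring

namespace Regular

variable {X Y : WickField C ι}

theorem tame (h : Regular X) (A : Config C ι) : Tame C (X A) := by
  obtain ⟨p, hp⟩ := h A 0
  rw [hp.apply_self]
  exact hp.1 0

theorem zero : Regular (0 : WickField C ι) := fun _ _ =>
  ⟨0, fun k => by simpa using Tame.zero, fun t => by simp⟩

theorem add (hX : Regular X) (hY : Regular Y) : Regular (X + Y) := fun A B =>
  let ⟨_, hp⟩ := hX A B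
  let ⟨_, hq⟩ := hY A B
  ⟨_, hp.add hq⟩

theorem mul (hX : Regular X) (hY : Regular Y) : Regular (X * Y) := fun A B =>
  let ⟨_, hp⟩ := hX A B
  let ⟨_, hq⟩ := hY A B
  ⟨_, hp.mul hq⟩

theorem sum {κ : Type*} (t : Finset κ) {X : κ → WickField C ι} (h : ∀ k ∈ t, Regular (X k)) :
    Regular (∑ k ∈ t, X k) :=
  Finset.sum_induction _ Regular (fun _ _ => add) zero h

theorem map (hX : Regular X) {L : (Spacetime → ℂ) → Spacetime → ℂ} (hL : IsTameLinear C L) :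
    Regular (fun A => L (X A)) := fun A B =>
  let ⟨_, hp⟩ := hX A B
  let ⟨q, hq, _⟩ := hp.map hL
  ⟨q, hq⟩

theorem const_smul (hX : Regular X) (z : ℂ) : Regular (z • X) :=
  hX.map (isTameLinear_const_smul z)

theorem pd (hX : Regular X) (μ : Fin 4) : Regular (pd μ X) :=
  hX.map (isTameLinear_partialDeriv μ)

theorem stringInt {X : WickField s.cone ι} (hX : Regular X) (μ : Fin 4) :
    Regular (stringInt s μ X) :=
  hX.map (isTameLinear_funInt s μ)

theorem potential (μ : Fin 4) (a : ι) : Regular (potential μ a : WickField C ι) :=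
  fun A B => ⟨_, isLinePoly_potential μ a A B⟩

end Regular

section DirDeriv

variable {X Y : WickField C ι}

theorem dirDeriv_add (hX : Regular X) (hY : Regular Y) (A B : Config C ι) :
    dirDeriv (X + Y) A B = dirDeriv X A B + dirDeriv Y A B := by
  obtain ⟨p, hp⟩ := hX A B
  obtain ⟨q, hq⟩ := hY A B
  rw [hp.dirDeriv_eq, hq.dirDeriv_eq, (hp.add hq).dirDeriv_eq, Polynomial.coeff_add]

theorem dirDeriv_mul (hX : Regular X) (hY : Regular Y) (A B : Config C ι) :
    dirDeriv (X * Y) A B = dirDeriv X A B * Y A + X A * dirDeriv Y A B := by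
  obtain ⟨p, hp⟩ := hX A B
  obtain ⟨q, hq⟩ := hY A B
  rw [hp.dirDeriv_eq, hq.dirDeriv_eq, (hp.mul hq).dirDeriv_eq, Polynomial.mul_coeff_one,
    hp.apply_self, hq.apply_self, add_comm]

theorem dirDeriv_map (hX : Regular X) {L : (Spacetime → ℂ) → Spacetime → ℂ}
    (hL : IsTameLinear C L) (A B : Config C ι) :
    dirDeriv (fun A => L (X A)) A B = L (dirDeriv X A B) := by
  obtain ⟨p, hp⟩ := hX A B
  obtain ⟨q, hq, hc⟩ := hp.map hL
  rw [hp.dirDeriv_eq, hq.dirDeriv_eq, hc]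

theorem dirDeriv_potential (μ : Fin 4) (a : ι) (A B : Config C ι) :
    dirDeriv (potential μ a) A B = potential μ a B := by
  rw [(isLinePoly_potential μ a A B).dirDeriv_eq]
  simp

theorem dirDeriv_zero_right (X : WickField C ι) (A : Config C ι) : dirDeriv X A 0 = 0 := by
  funext x
  simp [dirDeriv]

end DirDeriv

/-- Real-valued regular fields. -/
structure RealRegular (X : WickField C ι) : Prop where
  regular : Regular X
  im_eq_zero : ∀ A x, (X A x).im = 0

theorem real_smul_eq_coe_smul (r : ℝ) (X : WickField C ι) : r • X = (r : ℂ) • X := by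
  funext A x
  simp

namespace RealRegular

variable {X Y : WickField C ι}

theorem zero : RealRegular (0 : WickField C ι) := ⟨Regular.zero, fun _ _ => by simp⟩

theorem add (hX : RealRegular X) (hY : RealRegular Y) : RealRegular (X + Y) :=
  ⟨hX.1.add hY.1, fun A x => by simp [hX.2 A x, hY.2 A x]⟩

theorem mul (hX : RealRegular X) (hY : RealRegular Y) : RealRegular (X * Y) :=
  ⟨hX.1.mul hY.1, fun A x => by simp [hX.2 A x, hY.2 A x]⟩

theorem const_smul (hX : RealRegular X) (r : ℝ) : RealRegular ((r : ℂ) • X) :=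
  ⟨hX.1.const_smul _, fun A x => by simp [hX.2 A x]⟩

theorem real_smul (hX : RealRegular X) (r : ℝ) : RealRegular (r • X) :=
  real_smul_eq_coe_smul r X ▸ hX.const_smul r

theorem sum {κ : Type*} (t : Finset κ) {X : κ → WickField C ι} (h : ∀ k ∈ t, RealRegular (X k)) :
    RealRegular (∑ k ∈ t, X k) :=
  Finset.sum_induction _ RealRegular (fun _ _ => add) zero h

theorem potential (μ : Fin 4) (a : ι) : RealRegular (potential μ a : WickField C ι) :=
  ⟨Regular.potential μ a, fun _ _ => by simp [StringYM.potential]⟩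

theorem pd (hX : RealRegular X) (μ : Fin 4) : RealRegular (pd μ X) := by
  refine ⟨hX.1.pd μ, fun A x => ?_⟩
  have him : (fun y => Complex.imCLM (X A y)) = 0 := funext (hX.2 A)
  have h := partialDeriv_clm_comp (hX.1.tame A).differentiable Complex.imCLM μ
  rw [him, partialDeriv_zero] at h
  exact (congrFun h x).symm

theorem stringInt {X : WickField s.cone ι} (hX : RealRegular X) (μ : Fin 4) :
    RealRegular (stringInt s μ X) :=
  ⟨hX.1.stringInt μ, fun A x => im_funInt_eq_zero μ (hX.2 A) x⟩

theorem ad [Fintype ι] (f : ι → ι → ι → ℝ) {X Y : ι → WickField C ι}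
    (hX : ∀ a, RealRegular (X a)) (hY : ∀ a, RealRegular (Y a)) (e : ι) :
    RealRegular (ad f X Y e) :=
  sum _ fun a _ => sum _ fun b _ => ((hX a).mul (hY b)).const_smul _

end RealRegular

end RegularFields

/-! ### The two-point obstruction and the contraction -/

theorem lineDeriv_comm {E F : Type*} [NormedAddCommGroup E] [NormedSpace ℝ E]
    [NormedAddCommGroup F] [NormedSpace ℝ F]
    (T : 𝓓'((⊤ : TopologicalSpace.Opens E), F)) (u v : E) :
    ∂_{u} (∂_{v} T) = ∂_{v} (∂_{u} T) := by
  ext ψ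
  simp only [Distribution.lineDerivOp_apply_apply, LineDeriv.lineDerivOp_neg, neg_neg]
  congr 1
  ext x
  have hd : DifferentiableAt ℝ (fderiv ℝ ψ) x :=
    (ψ.contDiff.fderiv_right (m := ∞) (by simp)).differentiable (by simp) x
  have hsecond : ∀ a b : E, (∂_{a} (∂_{b} ψ : TestFun E) : TestFun E) x
      = fderiv ℝ (fderiv ℝ ψ) x a b := by
    intro a b
    have hb : ((∂_{b} ψ : TestFun E) : E → ℝ) = fun y => fderiv ℝ ψ y b :=
      funext (testFun_lineDeriv_apply ψ b)
    rw [testFun_lineDeriv_apply, hb, fderiv_clm_apply hd (differentiableAt_const _)]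
    simp
  rw [hsecond, hsecond, (isSymmSndFDerivAt_of_contDiff ψ.contDiff x).eq]

theorem eta_mul_self (μ : Fin 4) : eta μ * eta μ = 1 := by
  unfold eta
  split_ifs <;> norm_num

section Contraction

variable {ι : Type*} [DecidableEq ι] {C : ProperCone ℝ Spacetime}

theorem propNA_self (T₀ : CDist) (a : ι) (κ : Fin 4) :
    propNA T₀ a κ a = -∂_{dir κ} T₀ := by
  unfold propNA propAA
  rw [Finset.sum_eq_single κ]
  · simp [LineDeriv.lineDerivOp_smul, smul_smul, eta_mul_self]
  · intro μ _ hμ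
    rw [if_neg fun h => hμ h.1, LineDeriv.lineDerivOp_zero]
    exact smul_zero (A := CDist) (eta μ)
  · simp

theorem lineDeriv_propFA_self (T₀ : CDist) (μ ν : Fin 4) (a : ι) (κ : Fin 4) :
    ∂_{dir μ} (propFA T₀ μ ν a κ a)
      = (if μ = κ then eta ν • ∂_{dir ν} (∂_{dir κ} T₀) else 0)
        - if ν = κ then eta μ • ∂_{dir μ} (∂_{dir μ} T₀) else 0 := by
  unfold propFA propAA
  rw [LineDeriv.lineDerivOp_smul, sub_eq_add_neg, LineDeriv.lineDerivOp_add,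
    LineDeriv.lineDerivOp_neg]
  by_cases hμ : μ = κ <;> by_cases hν : ν = κ
  · subst hμ hν
    simp
  · subst hμ
    simp [hν, LineDeriv.lineDerivOp_smul, smul_smul, mul_right_comm _ (eta ν), eta_mul_self,
      lineDeriv_comm T₀ (dir ν)]
  · subst hν
    simp [hμ, LineDeriv.lineDerivOp_smul, smul_smul, mul_assoc, eta_mul_self]
  · simp only [hμ, hν, false_and, if_false, LineDeriv.lineDerivOp_zero, neg_zero, add_zero,
      sub_zero]
    exact smul_zero (A := CDist) (eta μ * eta ν)

/-- The two terms in `∂_ν ∂_κ T₀` cancel, which leaves `□ T₀ = -i δ`. -/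
theorem obstrFA_apply {T₀ : CDist} (hT₀ : IsPropagator T₀) (ν : Fin 4) (a : ι)
    (κ : Fin 4) (b : ι) (ψ : TestFun Spacetime) :
    obstrFA T₀ ν a κ b ψ = if ν = κ ∧ a = b then -Complex.I * (ψ 0 : ℂ) else 0 := by
  by_cases hab : a = b
  · subst hab
    simp only [obstrFA, propNA_self, lineDeriv_propFA_self, Finset.sum_sub_distrib]
    by_cases hν : ν = κ
    · simp only [hν, if_true, and_true]
      rw [← hT₀ ψ]
      congr 1
      simp
    · simp [hν]
  · simp [obstrFA, propNA, propFA, propAA, hab]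

theorem evalNear_obstrFA {T₀ : CDist} (hT₀ : IsPropagator T₀) (ν : Fin 4) (a : ι)
    (κ : Fin 4) (b : ι) {f : Spacetime → ℝ} (hf : ContDiff ℝ ∞ f) :
    evalNear (obstrFA T₀ ν a κ b) {0} f
      = if ν = κ ∧ a = b then -Complex.I * (f 0 : ℂ) else 0 := by
  let χ : ContDiffBump (0 : Spacetime) := ⟨1, 2, by norm_num, by norm_num⟩
  let ψ : TestFun Spacetime := testFunOfSmooth (fun x => χ x * f x) (χ.contDiff.mul hf)
    χ.hasCompactSupport.mul_right
  have hψ : ψ =ᶠ[𝓝ˢ {0}] f := by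
    rw [nhdsSet_singleton]
    filter_upwards [Metric.closedBall_mem_nhds (0 : Spacetime) one_pos] with x hx
    change χ x * f x = f x
    rw [χ.one_of_mem_closedBall hx, one_mul]
  have hψ0 : ψ 0 = f 0 := by
    rw [nhdsSet_singleton] at hψ
    exact hψ.self_of_nhds
  have hvanish : Distribution.IsVanishingOn (obstrFA T₀ ν a κ b) {0}ᶜ := fun u hu => by
    have hu0 : u 0 = 0 := by
      by_contra hne
      exact hu (subset_tsupport _ hne) rfl
    simp [obstrFA_apply hT₀, hu0]
  rw [evalNear_eq hvanish ψ hψ, obstrFA_apply hT₀, hψ0]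

variable [Fintype ι] {T₀ : CDist} {α : Fin 4 → ι → WickField C ι} {A : Config C ι}

theorem contraction_eq (hT₀ : IsPropagator T₀) (hα : ∀ ν a, ContDiff ℝ ∞ (α ν a A))
    (κ : Fin 4) (b : ι) (x : Spacetime) : contraction T₀ α A κ b x = α κ b A x := by
  have hre : ∀ ν a, ContDiff ℝ ∞ fun z => (α ν a A (x + z)).re := fun ν a =>
    Complex.reCLM.contDiff.comp ((hα ν a).comp (contDiff_const.add contDiff_id))
  have him : ∀ ν a, ContDiff ℝ ∞ fun z => (α ν a A (x + z)).im := fun ν a =>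
    Complex.imCLM.contDiff.comp ((hα ν a).comp (contDiff_const.add contDiff_id))
  have hterm : ∀ ν a, evalNear (obstrFA T₀ ν a κ b) {0} (fun z => (α ν a A (x + z)).re)
      + Complex.I * evalNear (obstrFA T₀ ν a κ b) {0} (fun z => (α ν a A (x + z)).im)
      = if ν = κ then if a = b then -Complex.I * α ν a A x else 0 else 0 := by
    intro ν a
    rw [evalNear_obstrFA hT₀ _ _ _ _ (hre ν a), evalNear_obstrFA hT₀ _ _ _ _ (him ν a),
      ← ite_and]
    split_ifs
    · rw [add_zero]
      conv_rhs => rw [← Complex.re_add_im (α ν a A x)]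
      ring
    · simp
  simp [contraction, hterm, ← mul_assoc]

theorem contractionConfig_eq (hT₀ : IsPropagator T₀) (hα : ∀ ν a, RealRegular (α ν a))
    (A : Config C ι) (κ : Fin 4) (b : ι) :
    potential κ b (contractionConfig T₀ α A) = α κ b A := by
  have hcontr : ∀ κ b x, contraction T₀ α A κ b x = α κ b A x :=
    contraction_eq hT₀ fun ν a => ((hα ν a).1.tame A).1
  have hex : ∃ B : Config C ι, ∀ κ b x, ((B.1 κ b x : ℝ) : ℂ) = contraction T₀ α A κ b x := by
    refine ⟨⟨fun κ b x => (α κ b A x).re, fun κ b => ((hα κ b).1.tame A).re⟩, fun κ b x => ?_⟩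
    rw [hcontr]
    exact Complex.ext rfl (by simp [(hα κ b).2 A x])
  funext x
  rw [contractionConfig, dif_pos hex, potential, hex.choose_spec κ b x, hcontr]

end Contraction

/-! ### Operations that are linear on a subspace -/

/-- The map `Φ` is linear on the subspace `S`. Operations on fields are functions on all fields,
but they are linear only where no junk values occur. -/
structure IsLinearOn {k M N : Type*} [Semiring k] [AddCommMonoid M] [Module k M]
    [AddCommMonoid N] [Module k N] (S : Submodule k M) (Φ : M → N) : Prop where
  map_add {x y} : x ∈ S → y ∈ S → Φ (x + y) = Φ x + Φ y
  map_smul (c : k) {x} : x ∈ S → Φ (c • x) = c • Φ x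

namespace IsLinearOn

variable {k M N : Type*} [Semiring k] [AddCommMonoid M] [Module k M] [AddCommMonoid N]
  [Module k N] {S : Submodule k M} {Φ : M → N}

theorem map_zero (h : IsLinearOn S Φ) : Φ 0 = 0 := by
  simpa using h.map_smul 0 S.zero_mem

theorem map_sum (h : IsLinearOn S Φ) {κ : Type*} (t : Finset κ) {x : κ → M}
    (hx : ∀ i ∈ t, x i ∈ S) : Φ (∑ i ∈ t, x i) = ∑ i ∈ t, Φ (x i) := by
  classical
  induction t using Finset.induction_on with
  | empty => simp [h.map_zero]
  | insert i t hi ih =>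
    have ht : ∀ j ∈ t, x j ∈ S := fun j hj => hx j (Finset.mem_insert_of_mem hj)
    rw [Finset.sum_insert hi, Finset.sum_insert hi,
      h.map_add (hx i (Finset.mem_insert_self i t)) (S.sum_mem ht), ih ht]

theorem map_mem_of_mem_span (h : IsLinearOn S Φ) {G : Set M} (hGS : G ⊆ S) {V : Submodule k N}
    (hGV : ∀ x ∈ G, Φ x ∈ V) {x : M} (hx : x ∈ Submodule.span k G) : Φ x ∈ V := by
  have hS := Submodule.span_le.2 hGS
  induction hx using Submodule.span_induction with
  | mem x hx => exact hGV x hx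
  | zero => exact h.map_zero ▸ V.zero_mem
  | add x y hx hy ihx ihy => exact h.map_add (hS hx) (hS hy) ▸ V.add_mem ihx ihy
  | smul c x hx ih => exact h.map_smul c (hS hx) ▸ V.smul_mem c ih

theorem pi (h : IsLinearOn S Φ) (κ : Type*) :
    IsLinearOn (Submodule.pi Set.univ fun _ : κ => S) fun v i => Φ (v i) where
  map_add hv hw := funext fun i => h.map_add (hv i trivial) (hw i trivial)
  map_smul c _ hv := funext fun i => h.map_smul c (hv i trivial)

theorem iterate {Ψ : M → M} (h : IsLinearOn (⊤ : Submodule k M) Ψ) (n : ℕ) :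
    IsLinearOn (⊤ : Submodule k M) Ψ^[n] := by
  induction n with
  | zero => exact ⟨fun _ _ => rfl, fun _ _ _ => rfl⟩
  | succ n ih =>
    simp only [Function.iterate_succ']
    exact ⟨fun _ _ => by simp [ih.map_add, h.map_add],
      fun _ _ _ => by simp [ih.map_smul, h.map_smul]⟩

theorem restrictScalars (h : IsLinearOn S Φ) (k₀ : Type*) [Semiring k₀] [SMul k₀ k]
    [Module k₀ M] [IsScalarTower k₀ k M] [Module k₀ N] [IsScalarTower k₀ k N] :
    IsLinearOn (S.restrictScalars k₀) Φ where
  map_add hx hy := h.map_add hx hy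
  map_smul c x hx := by rw [← smul_one_smul k c x, h.map_smul _ hx, smul_one_smul]

theorem map_sub {k M N : Type*} [Ring k] [AddCommGroup M] [Module k M] [AddCommGroup N]
    [Module k N] {S : Submodule k M} {Φ : M → N} (h : IsLinearOn S Φ) {x y : M} (hx : x ∈ S)
    (hy : y ∈ S) : Φ (x - y) = Φ x - Φ y := by
  rw [sub_eq_add_neg, ← neg_one_smul k y, h.map_add hx (S.smul_mem _ hy), h.map_smul _ hy,
    neg_one_smul, ← sub_eq_add_neg]

end IsLinearOn

section FieldOperations

variable {ι : Type*} {C : ProperCone ℝ Spacetime} {s : StringFunction}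

/-- The complex space of regular fields. -/
def regularFields (C : ProperCone ℝ Spacetime) (ι : Type*) : Submodule ℂ (WickField C ι) where
  carrier := {X | Regular X}
  zero_mem' := Regular.zero
  add_mem' := Regular.add
  smul_mem' z _ hX := hX.const_smul z

theorem isLinearOn_of_isTameLinear {L : (Spacetime → ℂ) → Spacetime → ℂ}
    (hL : IsTameLinear C L) :
    IsLinearOn (regularFields C ι) fun (X : WickField C ι) A => L (X A) where
  map_add hX hY := funext fun A => hL.map_add (hX.tame A) (hY.tame A)
  map_smul z _ hX := funext fun A => hL.map_smul z (hX.tame A)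

theorem isLinearOn_pd (μ : Fin 4) : IsLinearOn (regularFields C ι) (pd μ) :=
  isLinearOn_of_isTameLinear (isTameLinear_partialDeriv μ)

theorem isLinearOn_stringInt (μ : Fin 4) :
    IsLinearOn (regularFields s.cone ι) (stringInt s μ) :=
  isLinearOn_of_isTameLinear (isTameLinear_funInt s μ)

theorem pd_stringInt {X : WickField s.cone ι} (hX : Regular X) (μ ν : Fin 4) :
    pd ν (stringInt s μ X) = stringInt s μ (pd ν X) :=
  funext fun A => partialDeriv_funInt μ ν (hX.tame A)

theorem sum_stringInt_pd {X : WickField s.cone ι} (hX : Regular X) :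
    ∑ μ, stringInt s μ (pd μ X) = -X := by
  funext A
  rw [Finset.sum_apply]
  exact sum_funInt_partialDeriv (hX.tame A)

theorem isLinearOn_stringIntVec :
    IsLinearOn (Submodule.pi Set.univ fun _ => Submodule.pi Set.univ fun _ =>
      regularFields s.cone ι) (stringIntVec s) where
  map_add hv hw := funext fun a => by
    simp only [stringIntVec, Pi.add_apply, ← Finset.sum_add_distrib]
    exact Finset.sum_congr rfl fun μ _ => (isLinearOn_stringInt μ).map_add
      (hv μ trivial a trivial) (hw μ trivial a trivial)
  map_smul z v hv := funext fun a => by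
    simp only [stringIntVec, Pi.smul_apply, Finset.smul_sum]
    exact Finset.sum_congr rfl fun μ _ => (isLinearOn_stringInt μ).map_smul z
      (hv μ trivial a trivial)

theorem stringIntVec_grad {X : ι → WickField s.cone ι} (hX : ∀ a, Regular (X a)) :
    stringIntVec s (grad X) = -X :=
  funext fun a => sum_stringInt_pd (hX a)

theorem stringIntVec_regular {v : Fin 4 → ι → WickField s.cone ι}
    (hv : ∀ μ a, Regular (v μ a)) (a : ι) : Regular (stringIntVec s v a) :=
  Regular.sum _ fun μ _ => (hv μ a).stringInt μ

theorem stringIntVec_realRegular {v : Fin 4 → ι → WickField s.cone ι}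
    (hv : ∀ μ a, RealRegular (v μ a)) (a : ι) : RealRegular (stringIntVec s v a) :=
  RealRegular.sum _ fun μ _ => (hv μ a).stringInt μ

theorem isLinearOn_ad [Fintype ι] {R : Type*} [CommRing R] [Algebra ℂ R] (f : ι → ι → ι → ℝ)
    (X : ι → R) : IsLinearOn (⊤ : Submodule R (ι → R)) (ad f X) where
  map_add _ _ := funext fun e => by simp [ad, mul_add, Finset.sum_add_distrib]
  map_smul r Y _ := funext fun e => by
    simp only [ad, Pi.smul_apply, mul_smul_comm, Finset.smul_sum]
    exact Finset.sum_congr rfl fun a _ => Finset.sum_congr rfl fun b _ => smul_comm _ _ _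

end FieldOperations

/-! ### The obstruction map on regular fields -/

section Obstruction

variable {ι : Type*} [Fintype ι] [DecidableEq ι] {C : ProperCone ℝ Spacetime}
  {s : StringFunction} {T₀ : CDist} {α : Fin 4 → ι → WickField C ι}

theorem obstruction_apply (T₀ : CDist) (α : Fin 4 → ι → WickField C ι) (X : WickField C ι)
    (A : Config C ι) : obstruction T₀ α X A = dirDeriv X A (contractionConfig T₀ α A) := rfl

theorem isLinearOn_obstruction (T₀ : CDist) (α : Fin 4 → ι → WickField C ι) :
    IsLinearOn (regularFields C ι) (obstruction T₀ α) where
  map_add hX hY := funext fun A => dirDeriv_add hX hY A _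
  map_smul z _ hX := funext fun A => dirDeriv_map hX (isTameLinear_const_smul z) A _

theorem obstruction_mul {X Y : WickField C ι} (hX : Regular X) (hY : Regular Y) :
    obstruction T₀ α (X * Y) = obstruction T₀ α X * Y + X * obstruction T₀ α Y :=
  funext fun A => dirDeriv_mul hX hY A _

theorem obstruction_pd {X : WickField C ι} (hX : Regular X) (μ : Fin 4) :
    obstruction T₀ α (pd μ X) = pd μ (obstruction T₀ α X) :=
  funext fun A => dirDeriv_map hX (isTameLinear_partialDeriv μ) A _

theorem obstruction_stringInt {α : Fin 4 → ι → WickField s.cone ι} {X : WickField s.cone ι}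
    (hX : Regular X) (μ : Fin 4) :
    obstruction T₀ α (stringInt s μ X) = stringInt s μ (obstruction T₀ α X) :=
  funext fun A => dirDeriv_map hX (isTameLinear_funInt s μ) A _

theorem obstruction_stringIntVec {α v : Fin 4 → ι → WickField s.cone ι}
    (hv : ∀ μ a, Regular (v μ a)) :
    (fun a => obstruction T₀ α (stringIntVec s v a))
      = stringIntVec s fun μ a => obstruction T₀ α (v μ a) := by
  funext a
  unfold stringIntVec
  rw [(isLinearOn_obstruction T₀ α).map_sum _ fun μ _ => (hv μ a).stringInt μ]
  exact Finset.sum_congr rfl fun μ _ => obstruction_stringInt (hv μ a) μ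

theorem obstruction_potential (hT₀ : IsPropagator T₀) (hα : ∀ ν a, RealRegular (α ν a))
    (μ : Fin 4) (a : ι) : obstruction T₀ α (potential μ a) = α μ a := by
  funext A
  rw [obstruction_apply, dirDeriv_potential, contractionConfig_eq hT₀ hα]

theorem obstruction_zero_left (hT₀ : IsPropagator T₀) (X : WickField C ι) :
    obstruction T₀ 0 X = 0 := by
  funext A
  have h0 : contractionConfig T₀ (0 : Fin 4 → ι → WickField C ι) A = 0 := by
    ext κ b x
    have h := contractionConfig_eq hT₀ (α := (0 : Fin 4 → ι → WickField C ι))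
      (fun _ _ => RealRegular.zero) A κ b
    exact Complex.ofReal_eq_zero.1 (congrFun h x)
  rw [obstruction_apply, h0, dirDeriv_zero_right]
  rfl

theorem obstruction_ad (f : ι → ι → ι → ℝ) {X Y : ι → WickField C ι} (hX : ∀ a, Regular (X a))
    (hY : ∀ a, Regular (Y a)) :
    (fun e => obstruction T₀ α (ad f X Y e)) = ad f (fun a => obstruction T₀ α (X a)) Y
      + ad f X fun a => obstruction T₀ α (Y a) := by
  have hXY : ∀ a b, Regular (X a * Y b) := fun a b => (hX a).mul (hY b)
  have hO := isLinearOn_obstruction T₀ α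
  funext e
  have hterm : ∀ a b, obstruction T₀ α ((f a b e : ℂ) • (X a * Y b))
      = (f a b e : ℂ) • (obstruction T₀ α (X a) * Y b)
        + (f a b e : ℂ) • (X a * obstruction T₀ α (Y b)) := fun a b => by
    rw [hO.map_smul _ (hXY a b), obstruction_mul (hX a) (hY b), smul_add]
  have hsum : ∀ a, obstruction T₀ α (∑ b, (f a b e : ℂ) • (X a * Y b))
      = ∑ b, obstruction T₀ α ((f a b e : ℂ) • (X a * Y b)) := fun a =>
    hO.map_sum _ fun b _ => (hXY a b).const_smul _
  simp only [ad, Pi.add_apply]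
  rw [hO.map_sum _ fun a _ => Regular.sum _ fun b _ => (hXY a b).const_smul _]
  simp only [hsum, hterm, Finset.sum_add_distrib]

end Obstruction

/-! ### The spaces `𝒮` and `𝒱` -/

section Spaces

variable {ι : Type*} [Fintype ι] {C : ProperCone ℝ Spacetime} {s : StringFunction}
  {f : ι → ι → ι → ℝ}

theorem adList_realRegular {l : List (ι → WickField C ι)}
    (hl : ∀ X ∈ l, ∀ a, RealRegular (X a)) {v : Fin 4 → ι → WickField C ι}
    (hv : ∀ μ a, RealRegular (v μ a)) : ∀ μ a, RealRegular (adList f l v μ a) := by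
  induction l with
  | nil => exact hv
  | cons X l ih =>
    rw [List.forall_mem_cons] at hl
    exact fun μ => RealRegular.ad f hl.1 (ih hl.2 μ)

theorem spaceS_realRegular {X : ι → WickField s.cone ι} (h : X ∈ spaceS s f) :
    ∀ a, RealRegular (X a) := by
  replace h : MemS s f X := h
  induction h with
  | zero => exact fun _ => RealRegular.zero
  | add _ _ ihX ihY => exact fun a => (ihX a).add (ihY a)
  | smul r _ ih => exact fun a => (ih a).real_smul r
  | ofPotential l _ ih =>
    exact stringIntVec_realRegular (adList_realRegular ih RealRegular.potential)
  | ofGrad l _ _ _ ih ih₀ =>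
    exact stringIntVec_realRegular (adList_realRegular ih fun μ a => (ih₀ a).pd μ)

variable (s f) in
/-- The vector fields `A_ν` and `∂_ν s` (`s ∈ 𝒮`), from which `𝒱` arises by means of the operations
`ad_{is}`. -/
inductive IsVectorSeed : (Fin 4 → ι → WickField s.cone ι) → Prop
  | potential : IsVectorSeed potential
  | grad {X} : X ∈ spaceS s f → IsVectorSeed (grad X)

theorem IsVectorSeed.realRegular {v : Fin 4 → ι → WickField s.cone ι} (hv : IsVectorSeed s f v)
    (μ : Fin 4) (a : ι) : RealRegular (v μ a) := by
  cases hv with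
  | potential => exact RealRegular.potential μ a
  | grad hX => exact (spaceS_realRegular hX a).pd μ

variable (s f) in
/-- The spanning set of `𝒱`. -/
def vectorGenerators : Set (Fin 4 → ι → WickField s.cone ι) :=
  {v | ∃ l v₀, (∀ X ∈ l, X ∈ spaceS s f) ∧ IsVectorSeed s f v₀ ∧ v = adList f l v₀}

theorem spaceV_eq_span : spaceV s f = Submodule.span ℝ (vectorGenerators s f) := by
  unfold spaceV
  congr 1
  ext v
  constructor
  · rintro (⟨l, hl, rfl⟩ | ⟨l, hl, X, hX, rfl⟩)
    exacts [⟨l, _, hl, .potential, rfl⟩, ⟨l, _, hl, .grad hX, rfl⟩]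
  · rintro ⟨l, _, hl, hv₀, rfl⟩
    cases hv₀ with
    | potential => exact Or.inl ⟨l, hl, rfl⟩
    | grad hX => exact Or.inr ⟨l, hl, _, hX, rfl⟩

theorem vectorGenerators_realRegular {v : Fin 4 → ι → WickField s.cone ι}
    (hv : v ∈ vectorGenerators s f) : ∀ μ a, RealRegular (v μ a) := by
  obtain ⟨l, v₀, hl, hv₀, rfl⟩ := hv
  exact adList_realRegular (fun X hX => spaceS_realRegular (hl X hX)) hv₀.realRegular

theorem spaceV_realRegular {v : Fin 4 → ι → WickField s.cone ι} (h : v ∈ spaceV s f) :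
    ∀ μ a, RealRegular (v μ a) := by
  rw [spaceV_eq_span] at h
  induction h using Submodule.span_induction with
  | mem v hv => exact vectorGenerators_realRegular hv
  | zero => exact fun _ _ => RealRegular.zero
  | add v w _ _ ihv ihw => exact fun μ a => (ihv μ a).add (ihw μ a)
  | smul r v _ ih => exact fun μ a => (ih μ a).real_smul r

theorem IsVectorSeed.mem_spaceV {v : Fin 4 → ι → WickField s.cone ι}
    (hv : IsVectorSeed s f v) : v ∈ spaceV s f := by
  rw [spaceV_eq_span]
  exact Submodule.subset_span ⟨[], v, List.forall_mem_nil _, hv, rfl⟩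

theorem ad_mem_spaceV {X : ι → WickField s.cone ι} (hX : X ∈ spaceS s f)
    {v : Fin 4 → ι → WickField s.cone ι} (hv : v ∈ spaceV s f) :
    (fun μ => ad f X (v μ)) ∈ spaceV s f := by
  rw [spaceV_eq_span] at hv ⊢
  refine (((isLinearOn_ad f X).restrictScalars ℝ).pi (Fin 4)).map_mem_of_mem_span
    (fun _ _ _ _ => trivial) ?_ hv
  rintro _ ⟨l, v₀, hl, hv₀, rfl⟩
  exact Submodule.subset_span ⟨X :: l, v₀, List.forall_mem_cons.2 ⟨hX, hl⟩, hv₀, rfl⟩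

theorem stringIntVec_mem_spaceS {v : Fin 4 → ι → WickField s.cone ι} (hv : v ∈ spaceV s f) :
    stringIntVec s v ∈ spaceS s f := by
  rw [spaceV_eq_span] at hv
  refine (isLinearOn_stringIntVec.restrictScalars ℝ).map_mem_of_mem_span
    (fun v hv μ _ a _ => (vectorGenerators_realRegular hv μ a).1) ?_ hv
  rintro _ ⟨l, _, hl, hv₀, rfl⟩
  cases hv₀ with
  | potential => exact MemS.ofPotential l hl
  | @grad X hX =>
    rcases eq_or_ne l [] with rfl | hne
    · have hgrad : stringIntVec s (adList f [] (grad X)) = -X :=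
        stringIntVec_grad fun a => (spaceS_realRegular hX a).1
      exact hgrad ▸ Submodule.neg_mem _ hX
    · exact MemS.ofGrad l hne hl hX

variable [DecidableEq ι] {T₀ : CDist} {α : Fin 4 → ι → WickField s.cone ι}

theorem obstruction_adList_mem {l : List (ι → WickField s.cone ι)}
    (hl : ∀ X ∈ l, X ∈ spaceS s f ∧ (fun a => obstruction T₀ α (X a)) ∈ spaceS s f)
    {v : Fin 4 → ι → WickField s.cone ι} (hv : v ∈ spaceV s f)
    (hωv : (fun μ a => obstruction T₀ α (v μ a)) ∈ spaceV s f) :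
    adList f l v ∈ spaceV s f ∧
      (fun μ a => obstruction T₀ α (adList f l v μ a)) ∈ spaceV s f := by
  induction l with
  | nil => exact ⟨hv, hωv⟩
  | cons X l ih =>
    rw [List.forall_mem_cons] at hl
    obtain ⟨⟨hX, hωX⟩, hl⟩ := hl
    obtain ⟨hw, hωw⟩ := ih hl
    have hleibniz : (fun μ a => obstruction T₀ α (adList f (X :: l) v μ a))
        = (fun μ => ad f (fun a => obstruction T₀ α (X a)) (adList f l v μ))
          + fun μ => ad f X fun a => obstruction T₀ α (adList f l v μ a) :=
      funext fun μ => obstruction_ad f (fun a => (spaceS_realRegular hX a).1)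
        fun a => (spaceV_realRegular hw μ a).1
    exact ⟨ad_mem_spaceV hX hw,
      hleibniz ▸ Submodule.add_mem _ (ad_mem_spaceV hωX hw) (ad_mem_spaceV hX hωw)⟩

theorem obstruction_potential_mem_spaceV (hT₀ : IsPropagator T₀) (hα : α ∈ spaceV s f) :
    (fun μ a => obstruction T₀ α (potential μ a)) ∈ spaceV s f := by
  simpa only [obstruction_potential hT₀ (spaceV_realRegular hα)] using hα

theorem obstruction_grad_mem_spaceV {X : ι → WickField s.cone ι} (hX : X ∈ spaceS s f)
    (hωX : (fun a => obstruction T₀ α (X a)) ∈ spaceS s f) :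
    (fun μ a => obstruction T₀ α (grad X μ a)) ∈ spaceV s f := by
  have hgrad : (fun μ a => obstruction T₀ α (grad X μ a)) = grad fun a => obstruction T₀ α (X a) :=
    funext fun μ => funext fun a => obstruction_pd (spaceS_realRegular hX a).1 μ
  exact hgrad ▸ (IsVectorSeed.grad hωX).mem_spaceV

theorem obstruction_mem_spaceS (hT₀ : IsPropagator T₀) (hα : α ∈ spaceV s f)
    {X : ι → WickField s.cone ι} (hX : X ∈ spaceS s f) :
    (fun a => obstruction T₀ α (X a)) ∈ spaceS s f := by
  have hlin := ((isLinearOn_obstruction T₀ α).pi ι).restrictScalars ℝ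
  have hreg {X} (hX : MemS s f X) (a : ι) : Regular (X a) :=
    (spaceS_realRegular hX a).1
  have hstring {v} (hv : v ∈ spaceV s f ∧ (fun μ a => obstruction T₀ α (v μ a)) ∈ spaceV s f) :
      (fun a => obstruction T₀ α (stringIntVec s v a)) ∈ spaceS s f := by
    rw [obstruction_stringIntVec fun μ a => (spaceV_realRegular hv.1 μ a).1]
    exact stringIntVec_mem_spaceS hv.2
  replace hX : MemS s f X := hX
  induction hX with
  | zero => exact (congrArg (· ∈ spaceS s f) hlin.map_zero).mpr (Submodule.zero_mem _)
  | add hX hY ihX ihY =>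
    exact hlin.map_add (fun a _ => hreg hX a) (fun a _ => hreg hY a) ▸ Submodule.add_mem _ ihX ihY
  | smul r hX ih =>
    exact hlin.map_smul r (fun a _ => hreg hX a) ▸ Submodule.smul_mem _ r ih
  | ofPotential l hl ih =>
    exact hstring (obstruction_adList_mem (fun X hX => ⟨hl X hX, ih X hX⟩)
      IsVectorSeed.potential.mem_spaceV (obstruction_potential_mem_spaceV hT₀ hα))
  | ofGrad l _ hl h₀ ih ih₀ =>
    exact hstring (obstruction_adList_mem (fun X hX => ⟨hl X hX, ih X hX⟩)
      (IsVectorSeed.grad h₀).mem_spaceV (obstruction_grad_mem_spaceV h₀ ih₀))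

theorem obstruction_mem_spaceV (hT₀ : IsPropagator T₀) (hα : α ∈ spaceV s f)
    {v : Fin 4 → ι → WickField s.cone ι} (hv : v ∈ spaceV s f) :
    (fun μ a => obstruction T₀ α (v μ a)) ∈ spaceV s f := by
  rw [spaceV_eq_span] at hv
  refine ((((isLinearOn_obstruction T₀ α).pi ι).pi (Fin 4)).restrictScalars ℝ).map_mem_of_mem_span
    (fun v hv μ _ a _ => (vectorGenerators_realRegular hv μ a).1) ?_ hv
  rintro _ ⟨l, v₀, hl, hv₀, rfl⟩
  have hωS {X} (hX : X ∈ spaceS s f) := obstruction_mem_spaceS hT₀ hα hX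
  refine (obstruction_adList_mem (fun X hX => ⟨hl X hX, hωS (hl X hX)⟩) hv₀.mem_spaceV ?_).2
  cases hv₀ with
  | potential => exact obstruction_potential_mem_spaceV hT₀ hα
  | grad hX => exact obstruction_grad_mem_spaceV hX (hωS hX)

end Spaces

section FormalSums

open PowerSeries Finset

variable {R : Type*} [CommRing R] [Algebra ℂ R]

/-- The formal sum `∑ₖ uₖ` of power series `uₖ` of order at least `k`: only `k ≤ n` contributes at
order `n`, and the other terms are dropped so that the map is linear on all families. -/
def formalSum : (ℕ → R⟦X⟧) →ₗ[ℂ] R⟦X⟧ where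
  toFun u := .mk fun n => ∑ k ∈ range (n + 1), coeff n (u k)
  map_add' u v := by ext n; simp [sum_add_distrib]
  map_smul' z u := by ext n; simp [smul_sum, LinearMap.map_smul_of_tower]

theorem coeff_formalSum (u : ℕ → R⟦X⟧) (n : ℕ) :
    coeff n (formalSum u) = ∑ k ∈ range (n + 1), coeff n (u k) := by
  simp [formalSum]

theorem coeff_formalSum_of_le {u : ℕ → R⟦X⟧} (hu : ∀ k, X ^ k ∣ u k) {n N : ℕ} (h : n ≤ N) :
    coeff n (formalSum u) = coeff n (∑ k ∈ range (N + 1), u k) := by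
  rw [coeff_formalSum, map_sum]
  refine sum_subset (range_mono (by lia)) fun k _ hk => X_pow_dvd_iff.1 (hu k) n ?_
  simpa [Nat.lt_succ_iff] using hk

theorem trunc_formalSum {u : ℕ → R⟦X⟧} (hu : ∀ k, X ^ k ∣ u k) (n : ℕ) :
    trunc (n + 1) (formalSum u) = trunc (n + 1) (∑ k ∈ range (n + 1), u k) := by
  ext m
  simp only [coeff_trunc]
  split_ifs with h
  · exact coeff_formalSum_of_le hu (Nat.lt_succ_iff.1 h)
  · rfl

theorem sum_range_sum_range_eq_sum_antidiagonal {M : Type*} [AddCommMonoid M] (n : ℕ)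
    (g : ℕ → ℕ → M) (hg : ∀ p q, n < p + q → g p q = 0) :
    ∑ p ∈ range (n + 1), ∑ q ∈ range (n + 1), g p q
      = ∑ k ∈ range (n + 1), ∑ x ∈ antidiagonal k, g x.1 x.2 := by
  rw [← sum_product', sum_sigma']
  refine (sum_of_injOn (fun y : (_ : ℕ) × (ℕ × ℕ) => y.2) ?_ ?_ ?_ fun _ _ => rfl).symm
  · rintro ⟨k, x⟩ hx ⟨l, y⟩ hy rfl
    simp only [coe_sigma, Set.mem_sigma_iff, mem_coe, HasAntidiagonal.mem_antidiagonal] at hx hy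
    simp [← hx.2, ← hy.2]
  · rintro ⟨k, x⟩ hx
    simp only [coe_sigma, Set.mem_sigma_iff, mem_coe, HasAntidiagonal.mem_antidiagonal, mem_range,
      coe_product, Set.mem_prod] at hx ⊢
    lia
  · rintro ⟨p, q⟩ - hpq
    refine hg p q (lt_of_not_ge fun h => hpq ⟨⟨p + q, p, q⟩, ?_, rfl⟩)
    simp [h]

theorem formalSum_mul {u v : ℕ → R⟦X⟧} (hu : ∀ k, X ^ k ∣ u k) (hv : ∀ k, X ^ k ∣ v k) :
    formalSum u * formalSum v = formalSum fun n => ∑ x ∈ antidiagonal n, u x.1 * v x.2 := by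
  ext n
  rw [coeff_mul_eq_coeff_trunc_mul_trunc _ _ n.lt_succ_self, trunc_formalSum hu,
    trunc_formalSum hv, ← coeff_mul_eq_coeff_trunc_mul_trunc _ _ n.lt_succ_self, sum_mul_sum,
    coeff_formalSum]
  simp only [map_sum]
  refine sum_range_sum_range_eq_sum_antidiagonal n (fun p q => coeff n (u p * v q)) ?_
  exact fun p q h => X_pow_dvd_iff.1 (pow_add (X : R⟦X⟧) p q ▸ mul_dvd_mul (hu p) (hv q)) n h

theorem mul_formalSum (u : R⟦X⟧) {v : ℕ → R⟦X⟧} (hv : ∀ k, X ^ k ∣ v k) :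
    u * formalSum v = formalSum fun k => u * v k := by
  ext n
  rw [coeff_mul_eq_coeff_trunc_mul_trunc _ _ n.lt_succ_self, trunc_formalSum hv,
    ← coeff_mul_eq_coeff_trunc_mul_trunc _ _ n.lt_succ_self, mul_sum, coeff_formalSum, map_sum]

theorem formalSum_succ {u : ℕ → R⟦X⟧} (hu : ∀ k, X ^ k ∣ u k) :
    formalSum u = u 0 + formalSum fun k => u (k + 1) := by
  ext n
  rw [coeff_formalSum_of_le hu n.le_succ, sum_range_succ', add_comm, map_add, map_sum,
    map_add, coeff_formalSum]

end FormalSums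

section MatrixSums

open PowerSeries Finset

variable {R : Type*} [CommRing R] {d : Type*}

/-- The entries of `Zₖ` have order at least `k`, so that `∑ₖ Zₖ` makes sense. -/
def OrderGE (Z : ℕ → Matrix d d R⟦X⟧) : Prop := ∀ k i j, X ^ k ∣ Z k i j

theorem OrderGE.smul [Algebra ℂ R] {Z : ℕ → Matrix d d R⟦X⟧} (hZ : OrderGE Z) (c : ℕ → ℂ) :
    OrderGE fun k => c k • Z k :=
  fun k i j => dvd_smul_of_dvd (c k) (hZ k i j)

variable [Fintype d]

theorem OrderGE.mul_left {Z : ℕ → Matrix d d R⟦X⟧} (hZ : OrderGE Z) (M : Matrix d d R⟦X⟧) :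
    OrderGE fun k => M * Z k :=
  fun k _ j => dvd_sum fun l _ => (hZ k l j).mul_left _

theorem OrderGE.pow [DecidableEq d] {Y : Matrix d d R⟦X⟧} (hY : ∀ i j, X ∣ Y i j) :
    OrderGE fun k => Y ^ k := by
  intro k
  induction k with
  | zero => simp
  | succ k ih =>
    intro i j
    simp only [pow_succ _ k, Matrix.mul_apply]
    exact dvd_sum fun l _ => mul_dvd_mul (ih i l) (hY l j)

theorem OrderGE.sum_antidiagonal_mul {Z Z' : ℕ → Matrix d d R⟦X⟧} (hZ : OrderGE Z)
    (hZ' : OrderGE Z') : OrderGE fun n => ∑ x ∈ antidiagonal n, Z x.1 * Z' x.2 := by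
  intro n i j
  simp only [Matrix.sum_apply]
  refine dvd_sum fun x hx => dvd_sum fun l _ => ?_
  rw [← HasAntidiagonal.mem_antidiagonal.1 hx, pow_add]
  exact mul_dvd_mul (hZ x.1 i l) (hZ' x.2 l j)

variable [Algebra ℂ R]

/-- The formal sum `∑ₖ Zₖ` of a family of matrices satisfying `OrderGE`. -/
def matSum (Z : ℕ → Matrix d d R⟦X⟧) : Matrix d d R⟦X⟧ :=
  Matrix.of fun i j => formalSum fun k => Z k i j

omit [Fintype d] in
theorem matSum_succ {Z : ℕ → Matrix d d R⟦X⟧} (hZ : OrderGE Z) :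
    matSum Z = Z 0 + matSum fun n => Z (n + 1) :=
  Matrix.ext fun i j => formalSum_succ fun k => hZ k i j

theorem matSum_mul {Z Z' : ℕ → Matrix d d R⟦X⟧} (hZ : OrderGE Z) (hZ' : OrderGE Z') :
    matSum Z * matSum Z' = matSum fun n => ∑ x ∈ antidiagonal n, Z x.1 * Z' x.2 := by
  ext1 i j
  simp only [Matrix.mul_apply, matSum, Matrix.of_apply, Matrix.sum_apply]
  simp only [formalSum_mul (fun k => hZ k _ _) (fun k => hZ' k _ _), ← map_sum]
  congr 1
  ext1 n
  rw [Finset.sum_apply, sum_comm]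

theorem mul_matSum {Z : ℕ → Matrix d d R⟦X⟧} (hZ : OrderGE Z) (M : Matrix d d R⟦X⟧) :
    M * matSum Z = matSum fun n => M * Z n := by
  ext1 i j
  simp only [Matrix.mul_apply, matSum, Matrix.of_apply, mul_formalSum _ fun k => hZ k _ _,
    ← map_sum]
  congr 1
  ext1 n
  rw [Finset.sum_apply]

theorem matExp_eq_matSum [DecidableEq d] (Y : Matrix d d R⟦X⟧) :
    matExp Y = matSum fun k => ((k.factorial : ℂ)⁻¹) • Y ^ k := rfl

end MatrixSums

section BinomialIdentities

open Finset

theorem sum_antidiagonal_inv_factorial_smul {M : Type*} [AddCommGroup M] [Module ℂ M] (n : ℕ)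
    (g : ℕ × ℕ → M) :
    ∑ x ∈ antidiagonal n, ((x.1.factorial : ℂ)⁻¹ * (x.2.factorial : ℂ)⁻¹) • g x
      = ((n.factorial : ℂ)⁻¹) • ∑ x ∈ antidiagonal n, n.choose x.1 • g x := by
  rw [smul_sum]
  refine sum_congr rfl fun x hx => ?_
  obtain rfl := HasAntidiagonal.mem_antidiagonal.1 hx
  have h : ((x.1 + x.2).factorial : ℂ) ≠ 0 := by exact_mod_cast Nat.factorial_ne_zero _
  rw [← Nat.cast_smul_eq_nsmul ℂ, smul_smul, Nat.cast_add_choose]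
  congr 1
  field_simp

variable {A : Type*} [Ring A]

theorem sum_antidiagonal_choose_nsmul_mul_pow (k : Type*) [CommRing k] [Algebra k A] (a b m : A)
    (n : ℕ) : ∑ x ∈ antidiagonal n, n.choose x.1 • (a ^ x.1 * m * b ^ x.2)
      = ((LinearMap.mulLeft k a + LinearMap.mulRight k b) ^ n) m := by
  rw [(LinearMap.commute_mulLeft_right a b).add_pow', LinearMap.sum_apply]
  simp only [LinearMap.smul_apply, Module.End.mul_apply, LinearMap.pow_mulLeft,
    LinearMap.pow_mulRight, LinearMap.mulLeft_apply, LinearMap.mulRight_apply, mul_assoc]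

variable [Algebra ℂ A]

/-- The commutator `[Y, ·]` as a linear map. -/
def commutatorWith (Y : A) : A →ₗ[ℂ] A := LinearMap.mulLeft ℂ Y - LinearMap.mulRight ℂ Y

theorem commutatorWith_apply (Y M : A) : commutatorWith Y M = Y * M - M * Y := rfl

theorem sum_antidiagonal_choose_nsmul_conj (Y M : A) (n : ℕ) :
    ∑ x ∈ antidiagonal n, n.choose x.1 • (Y ^ x.1 * M * (-Y) ^ x.2)
      = (commutatorWith Y ^ n) M := by
  rw [sum_antidiagonal_choose_nsmul_mul_pow ℂ]
  congr 2
  ext1 Z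
  simp [commutatorWith_apply, sub_eq_add_neg]

/-- `D q` is the derivative of `(-Y) ^ q` if `Y` has the derivative `E`: it is the `ε`-part of
`(-Y - εE) ^ q` over the dual numbers. -/
theorem sum_antidiagonal_choose_nsmul_deriv (Y E : A) {D : ℕ → A} (h0 : D 0 = 0)
    (hD : ∀ q, D (q + 1) = D q * (-Y) + (-Y) ^ q * (-E)) (n : ℕ) :
    ∑ x ∈ antidiagonal (n + 1), (n + 1).choose x.1 • (Y ^ x.1 * D x.2)
      = -(commutatorWith Y ^ n) E := by
  let a : DualNumber A := TrivSqZeroExt.inl Y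
  let b : DualNumber A := TrivSqZeroExt.inl (-Y) + TrivSqZeroExt.inr (-E)
  have fst_pow (q : ℕ) : (b ^ q).fst = (-Y) ^ q := by simp [b]
  have snd_pow (q : ℕ) : (b ^ q).snd = D q := by
    induction q with
    | zero => simp [h0]
    | succ q ih =>
      rw [pow_succ, TrivSqZeroExt.snd_mul, ih, fst_pow, hD]
      simp [b, add_comm]
  let L := LinearMap.mulLeft ℤ a + LinearMap.mulRight ℤ b
  have iterate : (L ^ (n + 1)) 1 = TrivSqZeroExt.inr (-(commutatorWith Y ^ n) E) := by
    induction n with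
    | zero => ext <;> simp [L, a, b]
    | succ n ih =>
      rw [pow_succ' L, Module.End.mul_apply, ih, pow_succ', Module.End.mul_apply]
      ext <;> simp [L, a, b, commutatorWith_apply, neg_add_eq_sub]
  have key := congrArg TrivSqZeroExt.snd
    ((sum_antidiagonal_choose_nsmul_mul_pow ℤ a b 1 (n + 1)).trans iterate)
  simpa [TrivSqZeroExt.snd_sum, snd_pow, a] using key

end BinomialIdentities

section DerivationOn

open PowerSeries Finset

/-- `δ` is a derivation on the subalgebra `S`; outside `S` it may be arbitrary. -/
structure IsDerivOn {A : Type*} [Ring A] [Algebra ℂ A] (S : Subalgebra ℂ A) (δ : A → A) : Prop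
    extends IsLinearOn (Subalgebra.toSubmodule S) δ where
  leibniz : ∀ {x y}, x ∈ S → y ∈ S → δ (x * y) = δ x * y + x * δ y

section Ring

variable {A : Type*} [Ring A] [Algebra ℂ A] {S : Subalgebra ℂ A} {δ : A → A}

theorem IsDerivOn.map_one (h : IsDerivOn S δ) : δ 1 = 0 := by
  simpa using h.leibniz S.one_mem S.one_mem

theorem IsDerivOn.map_neg (h : IsDerivOn S δ) {x : A} (hx : x ∈ S) : δ (-x) = -δ x := by
  simpa using h.map_smul (-1) hx

theorem IsDerivOn.matrix {d : Type*} [Fintype d] [DecidableEq d] (h : IsDerivOn S δ) :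
    IsDerivOn (S.matrix (n := d)) fun M => M.map δ where
  map_add hM hN := by
    ext i j
    exact h.map_add (hM i j) (hN i j)
  map_smul z M hM := by
    ext i j
    exact h.map_smul z (hM i j)
  leibniz {M N} hM hN := by
    ext i j
    simp only [Matrix.map_apply, Matrix.add_apply, Matrix.mul_apply, ← sum_add_distrib]
    rw [h.map_sum _ fun l _ => S.mul_mem (hM i l) (hN l j)]
    exact sum_congr rfl fun l _ => h.leibniz (hM i l) (hN l j)

end Ring

variable {R : Type*} [CommRing R]

theorem coeff_mapCoeff (δ : R → R) (n : ℕ) (u : R⟦X⟧) :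
    coeff n (mapCoeff δ u) = δ (coeff n u) :=
  coeff_mk n _

theorem X_pow_dvd_mapCoeff {δ : R → R} (h0 : δ 0 = 0) {k : ℕ} {u : R⟦X⟧} (hu : X ^ k ∣ u) :
    X ^ k ∣ mapCoeff δ u :=
  X_pow_dvd_iff.2 fun m hm => by rw [coeff_mapCoeff, X_pow_dvd_iff.1 hu m hm, h0]

variable [Algebra ℂ R]

/-- The power series with coefficients in the subalgebra `S`. -/
def coeffSubalgebra (S : Subalgebra ℂ R) : Subalgebra ℂ R⟦X⟧ where
  carrier := {u | ∀ n, coeff n u ∈ S}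
  mul_mem' hu hv n := by
    rw [coeff_mul]
    exact S.sum_mem fun x _ => S.mul_mem (hu _) (hv _)
  add_mem' hu hv n := by
    rw [map_add]
    exact S.add_mem (hu n) (hv n)
  algebraMap_mem' z n := by
    rw [PowerSeries.algebraMap_apply, coeff_C]
    split_ifs
    exacts [S.algebraMap_mem z, S.zero_mem]

variable {S : Subalgebra ℂ R} {δ : R → R}

theorem IsDerivOn.mapCoeff (h : IsDerivOn S δ) :
    IsDerivOn (coeffSubalgebra S) (StringYM.mapCoeff δ) where
  map_add hu hv := by
    ext n
    simp only [coeff_mapCoeff, map_add, h.map_add (hu n) (hv n)]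
  map_smul z u hu := by
    ext n
    simp only [coeff_mapCoeff, LinearMap.map_smul_of_tower, h.map_smul z (hu n)]
  leibniz hu hv := by
    ext n
    simp only [coeff_mapCoeff, map_add, coeff_mul, ← sum_add_distrib]
    rw [h.map_sum _ fun x _ => S.mul_mem (hu _) (hv _)]
    exact sum_congr rfl fun x _ => h.leibniz (hu _) (hv _)

theorem IsDerivOn.mapCoeff_formalSum (h : IsDerivOn S δ) {u : ℕ → R⟦X⟧}
    (hu : ∀ k, u k ∈ coeffSubalgebra S) :
    StringYM.mapCoeff δ (formalSum u) = formalSum fun k => StringYM.mapCoeff δ (u k) := by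
  ext n
  simp only [coeff_mapCoeff, coeff_formalSum, h.map_sum _ fun k _ => hu k n]

end DerivationOn

section MatrixExponential

open PowerSeries Finset

variable {R : Type*} [CommRing R] [Algebra ℂ R] {d : Type*} [Fintype d] [DecidableEq d]

theorem matExp_mul_mul_matExp_neg {Y : Matrix d d R⟦X⟧} (hY : ∀ i j, X ∣ Y i j)
    (M : Matrix d d R⟦X⟧) : matExp Y * M * matExp (-Y)
      = matSum fun n => ((n.factorial : ℂ)⁻¹) • (commutatorWith Y ^ n) M := by
  have hY' : ∀ i j, X ∣ (-Y) i j := fun i j => (hY i j).neg_right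
  have hneg : OrderGE fun k => ((k.factorial : ℂ)⁻¹) • (-Y) ^ k := (OrderGE.pow hY').smul _
  rw [mul_assoc, matExp_eq_matSum, matExp_eq_matSum, mul_matSum hneg,
    matSum_mul ((OrderGE.pow hY).smul _) (hneg.mul_left M)]
  congr 1
  ext1 n
  simp only [← sum_antidiagonal_choose_nsmul_conj, ← sum_antidiagonal_inv_factorial_smul,
    mul_smul_comm _ M, smul_mul_smul_comm, mul_assoc]

theorem IsDerivOn.map_matSum {S : Subalgebra ℂ R} {δ : R → R} (h : IsDerivOn S δ)
    {Z : ℕ → Matrix d d R⟦X⟧} (hZ : ∀ k, Z k ∈ (coeffSubalgebra S).matrix) :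
    (matSum Z).map (StringYM.mapCoeff δ) = matSum fun k => (Z k).map (StringYM.mapCoeff δ) :=
  Matrix.ext fun i j => h.mapCoeff_formalSum fun k => hZ k i j

theorem IsDerivOn.map_matExp {S : Subalgebra ℂ R} {δ : R → R} (h : IsDerivOn S δ)
    {Y : Matrix d d R⟦X⟧} (hS : Y ∈ (coeffSubalgebra S).matrix) :
    (matExp Y).map (StringYM.mapCoeff δ)
      = matSum fun k => ((k.factorial : ℂ)⁻¹) • (Y ^ k).map (StringYM.mapCoeff δ) := by
  rw [matExp_eq_matSum,
    h.map_matSum fun k => Subalgebra.smul_mem _ (Subalgebra.pow_mem _ hS k) _]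
  exact congrArg matSum (funext fun k => h.mapCoeff.matrix.map_smul _ (Subalgebra.pow_mem _ hS k))

theorem IsDerivOn.matExp_mul_map_matExp_neg {S : Subalgebra ℂ R} {δ : R → R} (h : IsDerivOn S δ)
    {Y : Matrix d d R⟦X⟧} (hY : ∀ i j, X ∣ Y i j) (hS : Y ∈ (coeffSubalgebra S).matrix) :
    matExp Y * (matExp (-Y)).map (StringYM.mapCoeff δ) = matSum fun n =>
      -((((n + 1).factorial : ℂ)⁻¹) • (commutatorWith Y ^ n) (Y.map (StringYM.mapCoeff δ))) := by
  have hD := h.mapCoeff.matrix (d := d)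
  have hnegY := Subalgebra.neg_mem _ hS
  have hY' : ∀ i j, X ∣ (-Y) i j := fun i j => (hY i j).neg_right
  have hexp : OrderGE fun k => ((k.factorial : ℂ)⁻¹) • Y ^ k := (OrderGE.pow hY).smul _
  have hderiv : OrderGE fun k => ((k.factorial : ℂ)⁻¹) • ((-Y) ^ k).map (StringYM.mapCoeff δ) :=
    OrderGE.smul (fun k i j => X_pow_dvd_mapCoeff h.map_zero (OrderGE.pow hY' k i j)) _
  rw [matExp_eq_matSum, h.map_matExp hnegY, matSum_mul hexp hderiv,
    matSum_succ (hexp.sum_antidiagonal_mul hderiv)]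
  simp only [smul_mul_smul_comm, sum_antidiagonal_inv_factorial_smul]
  have hpow (q : ℕ) : ((-Y) ^ (q + 1)).map (StringYM.mapCoeff δ)
      = ((-Y) ^ q).map (StringYM.mapCoeff δ) * (-Y)
        + (-Y) ^ q * (-Y.map (StringYM.mapCoeff δ)) := by
    rw [pow_succ, hD.leibniz (Subalgebra.pow_mem _ hnegY q) hnegY, hD.map_neg hS]
  refine (congrArg₂ _ (by simp [hD.map_one]) (congrArg matSum (funext fun n => ?_))).trans
    (zero_add _)
  rw [sum_antidiagonal_choose_nsmul_deriv Y _ (D := fun q => ((-Y) ^ q).map (StringYM.mapCoeff δ))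
    (by simp [hD.map_one]) hpow, smul_neg]

end MatrixExponential

/-! ### The gauge transform in components -/

section ToMatrix

open PowerSeries Finset

variable {R : Type*} [CommRing R] [Algebra ℂ R] {ι d : Type*} [Fintype ι]

theorem toMatrix_apply (ξ : ι → Matrix d d ℂ) (X : ι → R) (i j : d) :
    toMatrix ξ X i j = ∑ a, ξ a i j • X a := rfl

theorem coeff_toMatrix (ξ : ι → Matrix d d ℂ) (u : ι → R⟦X⟧) (n : ℕ) (i j : d) :
    coeff n (toMatrix ξ u i j) = ∑ a, ξ a i j • coeff n (u a) := by
  simp only [toMatrix_apply, map_sum, LinearMap.map_smul_of_tower]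

theorem toMatrix_add (ξ : ι → Matrix d d ℂ) (X Y : ι → R) :
    toMatrix ξ (X + Y) = toMatrix ξ X + toMatrix ξ Y := by
  ext i j
  simp [toMatrix_apply, sum_add_distrib]

theorem toMatrix_smul {k : Type*} [Monoid k] [DistribMulAction k R] [SMulCommClass k ℂ R]
    (ξ : ι → Matrix d d ℂ) (c : k) (X : ι → R) : toMatrix ξ (c • X) = c • toMatrix ξ X := by
  ext i j
  simp [toMatrix_apply, smul_sum, smul_comm]

theorem toMatrix_eq_sum (ξ : ι → Matrix d d ℂ) (X : ι → R) :
    toMatrix ξ X = ∑ a, X a • (ξ a).map (algebraMap ℂ R) := by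
  ext i j
  simp [toMatrix_apply, Matrix.sum_apply, Algebra.smul_def, mul_comm]

theorem matSum_toMatrix (ξ : ι → Matrix d d ℂ) (v : ℕ → ι → R⟦X⟧) :
    (matSum fun n => toMatrix ξ (v n)) = toMatrix ξ fun a => formalSum fun n => v n a := by
  ext1 i j
  simp only [matSum, toMatrix_apply, Matrix.of_apply, ← map_smul, ← map_sum]
  congr 1
  ext1 n
  simp

theorem IsDerivOn.map_toMatrix {S : Subalgebra ℂ R} {δ : R → R} (h : IsDerivOn S δ)
    (ξ : ι → Matrix d d ℂ) {X : ι → R} (hX : ∀ a, X a ∈ S) :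
    (toMatrix ξ X).map δ = toMatrix ξ fun a => δ (X a) := by
  ext1 i j
  simp only [Matrix.map_apply, toMatrix_apply]
  rw [h.map_sum _ fun a _ => S.smul_mem (hX a) _]
  exact sum_congr rfl fun a _ => h.map_smul _ (hX a)

theorem X_dvd_smul_toMatrix (ξ : ι → Matrix d d ℂ) {u : ι → R⟦X⟧} (hu : ∀ a, X ∣ u a) (z : ℂ)
    (i j : d) : X ∣ (z • toMatrix ξ u) i j := by
  rw [Matrix.smul_apply, toMatrix_apply]
  exact dvd_smul_of_dvd _ (dvd_sum fun a _ => dvd_smul_of_dvd _ (hu a))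

variable [Fintype d]

theorem toMatrix_mul_toMatrix (ξ : ι → Matrix d d ℂ) (X Y : ι → R) :
    toMatrix ξ X * toMatrix ξ Y
      = ∑ a, ∑ b, (X a * Y b) • (ξ a * ξ b).map (algebraMap ℂ R) := by
  rw [toMatrix_eq_sum, toMatrix_eq_sum, sum_mul_sum]
  exact sum_congr rfl fun a _ => sum_congr rfl fun b _ => by
    rw [smul_mul_smul_comm, Matrix.map_mul]

theorem toMatrix_ad [DecidableEq d] (𝔤 : GaugeAlgebra ι d) (X Y : ι → R) :
    toMatrix 𝔤.ξ (ad 𝔤.f X Y) = commutatorWith (Complex.I • toMatrix 𝔤.ξ X) (toMatrix 𝔤.ξ Y) := by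
  have expand_ad : toMatrix 𝔤.ξ (ad 𝔤.f X Y)
      = ∑ a, ∑ b, (X a * Y b) • (∑ e, (𝔤.f a b e : ℂ) • 𝔤.ξ e).map (algebraMap ℂ R) := by
    ext i j
    simp only [toMatrix_apply, ad, smul_sum, Matrix.sum_apply, Matrix.smul_apply, Matrix.map_apply,
      map_sum, smul_eq_mul, map_mul, ← Algebra.smul_def, mul_sum, mul_smul_comm]
    rw [sum_comm]
    refine sum_congr rfl fun a _ => ?_
    rw [sum_comm]
    refine sum_congr rfl fun b _ => sum_congr rfl fun e _ => ?_
    rw [smul_comm, ← Algebra.commutes, ← Algebra.smul_def]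
  have map_commutator (a b : ι) : (∑ e, (𝔤.f a b e : ℂ) • 𝔤.ξ e).map (algebraMap ℂ R)
      = Complex.I • ((𝔤.ξ a * 𝔤.ξ b).map (algebraMap ℂ R)
        - (𝔤.ξ b * 𝔤.ξ a).map (algebraMap ℂ R)) := by
    rw [← 𝔤.commutator]
    ext i j
    simp only [Matrix.map_apply, Matrix.smul_apply, Matrix.sub_apply, smul_eq_mul, map_mul, map_sub,
      Algebra.smul_def (A := R)]
  rw [commutatorWith_apply, smul_mul_assoc, mul_smul_comm, ← smul_sub, toMatrix_mul_toMatrix,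
    toMatrix_mul_toMatrix, sum_comm (f := fun a b => (Y a * X b) • _), expand_ad, smul_sub,
    smul_sum, smul_sum, ← sum_sub_distrib]
  refine sum_congr rfl fun a _ => ?_
  rw [smul_sum, smul_sum, ← sum_sub_distrib]
  refine sum_congr rfl fun b _ => ?_
  rw [map_commutator, mul_comm (Y b), ← smul_sub, ← smul_sub, smul_comm]

theorem toMatrix_ad_iterate [DecidableEq d] (𝔤 : GaugeAlgebra ι d) (X Y : ι → R) (n : ℕ) :
    toMatrix 𝔤.ξ ((ad 𝔤.f X)^[n] Y)
      = (commutatorWith (Complex.I • toMatrix 𝔤.ξ X) ^ n) (toMatrix 𝔤.ξ Y) := by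
  induction n with
  | zero => rfl
  | succ n ih =>
    rw [Function.iterate_succ_apply', toMatrix_ad, ih, pow_succ', Module.End.mul_apply]

theorem X_pow_dvd_ad_iterate (f : ι → ι → ι → ℝ) {u : ι → R⟦X⟧} (hu : ∀ a, X ∣ u a)
    (v : ι → R⟦X⟧) (n : ℕ) (e : ι) : X ^ n ∣ (ad f u)^[n] v e := by
  induction n generalizing e with
  | zero => simp
  | succ n ih =>
    rw [Function.iterate_succ_apply', pow_succ']
    exact dvd_sum fun a _ => dvd_sum fun b _ => dvd_smul_of_dvd _ (mul_dvd_mul (hu a) (ih b))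

theorem GaugeAlgebra.linearIndependent_complex (𝔤 : GaugeAlgebra ι d) :
    LinearIndependent ℂ 𝔤.ξ := by
  have re_eq_zero {z : ι → ℂ} (h : ∑ a, z a • 𝔤.ξ a = 0) (a : ι) : (z a).re = 0 := by
    refine Fintype.linearIndependent_iff.1 𝔤.linearIndependent (fun a => (z a).re) ?_ a
    have hstar : ∑ a, star (z a) • 𝔤.ξ a = 0 := by
      simpa [Matrix.conjTranspose_sum, (𝔤.hermitian _).eq] using congrArg Matrix.conjTranspose h
    calc ∑ a, (z a).re • 𝔤.ξ a
        = (2⁻¹ : ℂ) • (∑ a, z a • 𝔤.ξ a + ∑ a, star (z a) • 𝔤.ξ a) := by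
          rw [← sum_add_distrib, smul_sum]
          refine sum_congr rfl fun a _ => ?_
          rw [← add_smul, Complex.star_def, Complex.add_conj, smul_smul, Complex.ofReal_mul,
            Complex.ofReal_ofNat, inv_mul_cancel_left₀ two_ne_zero, Complex.coe_smul]
      _ = 0 := by rw [h, hstar, add_zero, smul_zero]
  refine Fintype.linearIndependent_iff.2 fun z h a => Complex.ext (re_eq_zero h a) ?_
  have hI : ∑ a, (-Complex.I * z a) • 𝔤.ξ a = 0 := by
    simp only [mul_smul, ← smul_sum, h, smul_zero]
  simpa using re_eq_zero hI a

variable [DecidableEq d]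

theorem matExp_mul_toMatrix_mul_matExp_neg (𝔤 : GaugeAlgebra ι d) {γ : ι → R⟦X⟧}
    (hγ : ∀ a, X ∣ γ a) (Φ : ι → R⟦X⟧) :
    matExp (Complex.I • toMatrix 𝔤.ξ γ) * toMatrix 𝔤.ξ Φ * matExp (-(Complex.I • toMatrix 𝔤.ξ γ))
      = toMatrix 𝔤.ξ fun a =>
          formalSum fun n => ((n.factorial : ℂ)⁻¹) • (ad 𝔤.f γ)^[n] Φ a := by
  rw [matExp_mul_mul_matExp_neg (X_dvd_smul_toMatrix 𝔤.ξ hγ _)]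
  simp only [← toMatrix_ad_iterate, ← toMatrix_smul 𝔤.ξ (_⁻¹ : ℂ), matSum_toMatrix, Pi.smul_apply]

theorem matExp_mul_map_matExp_neg_toMatrix (𝔤 : GaugeAlgebra ι d) {S : Subalgebra ℂ R} {δ : R → R}
    (h : IsDerivOn S δ) {γ : ι → R⟦X⟧} (hγ : ∀ a, X ∣ γ a) (hS : ∀ a, γ a ∈ coeffSubalgebra S) :
    Complex.I • (matExp (Complex.I • toMatrix 𝔤.ξ γ)
        * (matExp (-(Complex.I • toMatrix 𝔤.ξ γ))).map (mapCoeff δ))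
      = toMatrix 𝔤.ξ fun a => formalSum fun n =>
          (((n + 1).factorial : ℂ)⁻¹) • (ad 𝔤.f γ)^[n] (fun b => mapCoeff δ (γ b)) a := by
  have hY : Complex.I • toMatrix 𝔤.ξ γ ∈ (coeffSubalgebra S).matrix := fun i j =>
    Subalgebra.smul_mem _ (Subalgebra.sum_mem _ fun a _ => Subalgebra.smul_mem _ (hS a) _) _
  have map_smul_toMatrix : (Complex.I • toMatrix 𝔤.ξ γ).map (mapCoeff δ)
      = Complex.I • toMatrix 𝔤.ξ fun b => mapCoeff δ (γ b) := by
    rw [← toMatrix_smul, ← toMatrix_smul,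
      h.mapCoeff.map_toMatrix _ (X := Complex.I • γ) fun a => Subalgebra.smul_mem _ (hS a) _]
    exact congrArg _ (funext fun a => h.mapCoeff.map_smul _ (hS a))
  rw [h.matExp_mul_map_matExp_neg (X_dvd_smul_toMatrix 𝔤.ξ hγ _) hY, map_smul_toMatrix]
  simp only [map_smul, ← toMatrix_ad_iterate]
  have I_smul_matSum (Z : ℕ → Matrix d d R⟦X⟧) :
      Complex.I • matSum Z = matSum fun n => Complex.I • Z n := by
    ext1 i j
    simp only [matSum, Matrix.smul_apply, Matrix.of_apply, ← map_smul]
    rfl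
  rw [I_smul_matSum]
  have cancel_I (c : ℂ) (v : ι → R⟦X⟧) :
      Complex.I • -(c • Complex.I • toMatrix 𝔤.ξ v) = toMatrix 𝔤.ξ (c • v) := by
    rw [smul_comm c, smul_neg, smul_smul, Complex.I_mul_I, neg_smul, one_smul, neg_neg,
      toMatrix_smul]
  simp only [cancel_I, matSum_toMatrix, Pi.smul_apply]

end ToMatrix

section GaugeTransform

open PowerSeries Finset

variable {ι d : Type*} {C : ProperCone ℝ Spacetime}

/-- The algebra of smooth fields. -/
def smoothFields (C : ProperCone ℝ Spacetime) (ι : Type*) : Subalgebra ℂ (WickField C ι) where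
  carrier := {X | ∀ A, ContDiff ℝ ∞ (X A)}
  mul_mem' hX hY A := (hX A).mul (hY A)
  add_mem' hX hY A := (hX A).add (hY A)
  algebraMap_mem' _ _ := contDiff_const

theorem isDerivOn_pd (μ : Fin 4) : IsDerivOn (smoothFields C ι) (pd μ) where
  map_add {X Y} hX hY := funext fun A => funext fun x => by
    simp [pd, fderiv_add ((hX A).differentiable (by simp) x)
      ((hY A).differentiable (by simp) x)]
  map_smul c X hX := funext fun A => funext fun x => by
    simp [pd, fderiv_const_smul ((hX A).differentiable (by simp) x)]
  leibniz {X Y} hX hY := funext fun A => partialDeriv_mul ((hX A).differentiable (by simp))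
    ((hY A).differentiable (by simp)) μ

/-- `g⁻¹ ∂_μ γ` for `γ` without term of order `g⁰`. -/
def gradShift (μ : Fin 4) (γ : ι → (WickField C ι)⟦X⟧) : ι → (WickField C ι)⟦X⟧ :=
  fun a => PowerSeries.mk fun k => pd μ (coeff (k + 1) (γ a))

theorem X_mul_gradShift (μ : Fin 4) {γ : ι → (WickField C ι)⟦X⟧} (hγ : ∀ a, X ∣ γ a) (a : ι) :
    X * gradShift μ γ a = mapCoeff (pd μ) (γ a) := by
  ext1 n
  cases n with
  | zero =>
    rw [coeff_mapCoeff, coeff_zero_X_mul, coeff_zero_eq_constantCoeff_apply, X_dvd_iff.1 (hγ a),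
      (isLinearOn_pd μ).map_zero]
  | succ n => rw [coeff_mapCoeff, coeff_succ_X_mul, gradShift, coeff_mk]

variable [Fintype ι]

theorem coeff_Sig (f : ι → ι → ι → ℝ) (γ : ι → (WickField C ι)⟦X⟧) (μ : Fin 4) (a : ι) (m : ℕ) :
    coeff m (Sig f γ μ a) = ∑ n ∈ Icc 1 m, ((n.factorial : ℂ)⁻¹) • coeff m
      ((ad f γ)^[n] ((fun b => PowerSeries.C (potential μ b))
        + (((n : ℂ) + 1)⁻¹) • gradShift μ γ) a) := by
  simp only [Sig, coeff_mk]
  rfl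

/-- The components of `W (A_μ + i g⁻¹ ∂_μ) W⁻¹` with respect to the basis `ξ_a` of the Lie
algebra, for `γ` without term of order `g⁰`. -/
def gaugedPotential (f : ι → ι → ι → ℝ) (γ : ι → (WickField C ι)⟦X⟧) (μ : Fin 4) :
    ι → (WickField C ι)⟦X⟧ :=
  fun a => PowerSeries.C (potential μ a) + gradShift μ γ a + Sig f γ μ a

theorem gaugedPotential_eq_formalSum (f : ι → ι → ι → ℝ) (γ : ι → (WickField C ι)⟦X⟧) (μ : Fin 4)
    (a : ι) : gaugedPotential f γ μ a = formalSum fun n => ((n.factorial : ℂ)⁻¹) • (ad f γ)^[n]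
      ((fun b => PowerSeries.C (potential μ b)) + (((n : ℂ) + 1)⁻¹) • gradShift μ γ) a := by
  ext1 m
  rw [gaugedPotential, coeff_formalSum, range_eq_Ico, sum_eq_sum_Ico_succ_bot (Nat.succ_pos m),
    map_add, coeff_Sig]
  simp [LinearMap.map_smul_of_tower, Ico_add_one_right_eq_Icc]

theorem gaugeTransform_eq [Fintype d] [DecidableEq d] (𝔤 : GaugeAlgebra ι d)
    {γ : ι → (WickField C ι)⟦X⟧} (h0 : ∀ a, X ∣ γ a)
    (hγ : ∀ a, γ a ∈ coeffSubalgebra (smoothFields C ι)) (μ : Fin 4) :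
    gaugeTransform 𝔤.ξ γ μ
      = (X : (WickField C ι)⟦X⟧) • toMatrix 𝔤.ξ (gaugedPotential 𝔤.f γ μ) := by
  rw [gaugeTransform, matExp_mul_toMatrix_mul_matExp_neg 𝔤 h0,
    matExp_mul_map_matExp_neg_toMatrix 𝔤 (isDerivOn_pd μ) h0 hγ, ← toMatrix_smul, ← toMatrix_smul,
    ← toMatrix_add]
  congr 1
  ext1 a
  have iterate_ad (n : ℕ) := (isLinearOn_ad 𝔤.f γ).iterate n
  have smul_gradShift :
      (fun b => mapCoeff (pd μ) (γ b)) = (X : (WickField C ι)⟦X⟧) • gradShift μ γ :=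
    funext fun b => (X_mul_gradShift μ h0 b).symm
  rw [Pi.add_apply, Pi.smul_apply, Pi.smul_apply, smul_eq_mul, smul_eq_mul,
    gaugedPotential_eq_formalSum,
    mul_formalSum _ fun n => dvd_smul_of_dvd _ (X_pow_dvd_ad_iterate _ h0 _ n a),
    mul_formalSum _ fun n => dvd_smul_of_dvd _ (X_pow_dvd_ad_iterate _ h0 _ n a), ← map_add]
  congr 1
  ext1 n
  rw [Pi.add_apply, smul_gradShift, (iterate_ad n).map_smul _ trivial,
    (iterate_ad n).map_add trivial trivial, ((iterate_ad n).restrictScalars ℂ).map_smul _ trivial]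
  simp only [Pi.add_apply, Pi.smul_apply, smul_eq_mul, smul_add, mul_add, smul_smul, mul_smul_comm,
    Nat.factorial_succ, Nat.cast_mul, Nat.cast_succ, mul_inv, mul_comm ((n : ℂ) + 1)⁻¹]

end GaugeTransform

/-! ### The recursion for `γ` -/

section Truncation

open PowerSeries

variable {R : Type*} [CommRing R]

theorem coeff_below (n k : ℕ) (u : R⟦X⟧) :
    coeff k (below n u) = if k < n then coeff k u else 0 := by
  rw [below, Polynomial.coeff_coe, coeff_trunc]

theorem coeff_below_of_lt {n k : ℕ} (h : k < n) (u : R⟦X⟧) : coeff k (below n u) = coeff k u := by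
  rw [coeff_below, if_pos h]

theorem X_dvd_below {u : R⟦X⟧} (h : X ∣ u) (n : ℕ) : X ∣ below n u := by
  rw [X_dvd_iff, ← coeff_zero_eq_constantCoeff_apply] at h ⊢
  rw [coeff_below, h, ite_self]

theorem exists_coeff_eq_coeff_below {κ : Type*} {S : Set (κ → R)} (h0 : 0 ∈ S)
    (Φ : (κ → R⟦X⟧) → κ → R⟦X⟧)
    (hΦ : ∀ u, (∀ n, (fun k => coeff n (u k)) ∈ S) → ∀ n, (fun k => coeff n (Φ u k)) ∈ S) :
    ∃ u : κ → R⟦X⟧, (∀ n, (fun k => coeff n (u k)) ∈ S) ∧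
      ∀ n k, coeff n (u k) = coeff n (Φ (fun l => below n (u l)) k) := by
  let c : ℕ → κ → R := fun n => Nat.strongRec (fun n ih k => coeff n
    (Φ (fun l => PowerSeries.mk fun m => if h : m < n then ih m h l else 0) k)) n
  let u : κ → R⟦X⟧ := fun k => PowerSeries.mk fun n => c n k
  have below_u (n : ℕ) (k : κ) :
      below n (u k) = PowerSeries.mk fun m => if m < n then c m k else 0 := by
    ext m
    simp only [coeff_below, u, coeff_mk]
  have hu (n : ℕ) (k : κ) : coeff n (u k) = coeff n (Φ (fun l => below n (u l)) k) := by
    simp only [below_u]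
    have hc : c n = fun k => coeff n
        (Φ (fun l => PowerSeries.mk fun m => if _ : m < n then c m l else 0) k) :=
      Nat.strongRec_eq _ _
    rw [coeff_mk, hc]
    simp only [dite_eq_ite]
  refine ⟨u, fun n => ?_, hu⟩
  induction n using Nat.strong_induction_on with
  | _ n ih =>
    simp only [hu n]
    refine hΦ _ (fun m => ?_) n
    simp only [coeff_below]
    split_ifs with hm
    exacts [ih m hm, h0]

end Truncation

section Series

open PowerSeries Finset

variable {ι : Type*} [Fintype ι] (s : StringFunction) (f : ι → ι → ι → ℝ)

/-- The space `𝒮^𝔤[[g]]`. -/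
def seriesS : Submodule ℝ (ι → (WickField s.cone ι)⟦X⟧) where
  carrier := {γ | ∀ n, (fun a => coeff n (γ a)) ∈ spaceS s f}
  zero_mem' _ := (spaceS s f).zero_mem
  add_mem' hX hY n := (spaceS s f).add_mem (hX n) (hY n)
  smul_mem' r _ hX n := (spaceS s f).smul_mem r (hX n)

/-- The space `𝒱^𝔤[[g]]`. -/
def seriesV : Submodule ℝ (Fin 4 → ι → (WickField s.cone ι)⟦X⟧) where
  carrier := {v | ∀ n, (fun μ a => coeff n (v μ a)) ∈ spaceV s f}
  zero_mem' _ := (spaceV s f).zero_mem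
  add_mem' hX hY n := (spaceV s f).add_mem (hX n) (hY n)
  smul_mem' r _ hX n := (spaceV s f).smul_mem r (hX n)

variable {s f} {γ : ι → (WickField s.cone ι)⟦X⟧} {v : Fin 4 → ι → (WickField s.cone ι)⟦X⟧}

theorem inGS_iff : InGS s f γ ↔ (∀ a, X ∣ γ a) ∧ γ ∈ seriesS s f := by
  simp only [X_dvd_iff, ← coeff_zero_eq_constantCoeff_apply]
  rfl

theorem inGV_iff : InGV s f v ↔ (∀ μ a, X ∣ v μ a) ∧ v ∈ seriesV s f := by
  simp only [X_dvd_iff, ← coeff_zero_eq_constantCoeff_apply]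
  rfl

theorem realRegular_coeff_of_mem_seriesS (hγ : γ ∈ seriesS s f) (n : ℕ) (a : ι) :
    RealRegular (coeff n (γ a)) :=
  spaceS_realRegular (hγ n) a

theorem realRegular_coeff_of_mem_seriesV (hv : v ∈ seriesV s f) (n : ℕ) (μ : Fin 4) (a : ι) :
    RealRegular (coeff n (v μ a)) :=
  spaceV_realRegular (hv n) μ a

theorem coe_smul_mem_seriesV (r : ℝ) (hv : v ∈ seriesV s f) :
    (fun μ a => (r : ℂ) • v μ a) ∈ seriesV s f :=
  (seriesV s f).smul_mem r hv

theorem C_mem_seriesV {v : Fin 4 → ι → WickField s.cone ι} (hv : v ∈ spaceV s f) :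
    (fun μ a => PowerSeries.C (v μ a)) ∈ seriesV s f := by
  intro n
  simp only [coeff_C]
  split_ifs
  exacts [hv, (spaceV s f).zero_mem]

theorem X_mul_mem_seriesV (hv : v ∈ seriesV s f) : (fun μ a => X * v μ a) ∈ seriesV s f := by
  rintro (_ | n)
  · simp only [coeff_zero_X_mul]
    exact (spaceV s f).zero_mem
  · simp only [coeff_succ_X_mul]
    exact hv n

theorem formalSum_mem_seriesV {v : ℕ → Fin 4 → ι → (WickField s.cone ι)⟦X⟧}
    (hv : ∀ k, v k ∈ seriesV s f) : (fun μ a => formalSum fun k => v k μ a) ∈ seriesV s f := by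
  intro n
  have := (spaceV s f).sum_mem (t := range (n + 1)) fun k _ => hv k n
  convert this using 1
  ext1 μ
  ext1 a
  simp only [coeff_formalSum, Finset.sum_apply]

theorem mapCoeff_pd_mem_seriesV (hγ : γ ∈ seriesS s f) :
    (fun μ a => mapCoeff (pd μ) (γ a)) ∈ seriesV s f := by
  intro n
  simp only [coeff_mapCoeff]
  exact (IsVectorSeed.grad (hγ n)).mem_spaceV

theorem gradShift_mem_seriesV (hγ : γ ∈ seriesS s f) :
    (fun μ => gradShift μ γ) ∈ seriesV s f := by
  intro n
  simp only [gradShift, coeff_mk]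
  exact (IsVectorSeed.grad (hγ (n + 1))).mem_spaceV

theorem coeff_ad {R : Type*} [CommRing R] [Algebra ℂ R] (f : ι → ι → ι → ℝ) (u v : ι → R⟦X⟧)
    (n : ℕ) (e : ι) : coeff n (ad f u v e) = ∑ p ∈ antidiagonal n,
      ad f (fun a => coeff p.1 (u a)) (fun a => coeff p.2 (v a)) e := by
  simp only [ad, map_sum, LinearMap.map_smul_of_tower, coeff_mul, smul_sum]
  rw [sum_comm (s := antidiagonal n)]
  refine sum_congr rfl fun a _ => ?_
  rw [sum_comm]

theorem ad_mem_seriesV (hγ : γ ∈ seriesS s f) (hv : v ∈ seriesV s f) :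
    (fun μ => ad f γ (v μ)) ∈ seriesV s f := by
  intro n
  have := (spaceV s f).sum_mem (t := antidiagonal n) fun p _ => ad_mem_spaceV (hγ p.1) (hv p.2)
  convert this using 1
  ext1 μ
  ext1 a
  simp only [coeff_ad, Finset.sum_apply]

theorem ad_iterate_mem_seriesV (hγ : γ ∈ seriesS s f) (hv : v ∈ seriesV s f) (n : ℕ) :
    (fun μ => (ad f γ)^[n] (v μ)) ∈ seriesV s f := by
  induction n with
  | zero => exact hv
  | succ n ih =>
    simp only [Function.iterate_succ_apply']
    exact ad_mem_seriesV hγ ih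

theorem gaugedPotential_mem_seriesV (hγ : γ ∈ seriesS s f) :
    gaugedPotential f γ ∈ seriesV s f := by
  have hterm (n : ℕ) := coe_smul_mem_seriesV (n.factorial : ℝ)⁻¹ <| ad_iterate_mem_seriesV hγ
    ((seriesV s f).add_mem (C_mem_seriesV IsVectorSeed.potential.mem_spaceV)
      (coe_smul_mem_seriesV ((n : ℝ) + 1)⁻¹ (gradShift_mem_seriesV hγ))) n
  convert formalSum_mem_seriesV hterm using 1
  ext1 μ
  ext1 a
  rw [gaugedPotential_eq_formalSum]
  push_cast
  rfl

theorem Sig_mem_seriesV (hγ : γ ∈ seriesS s f) : Sig f γ ∈ seriesV s f := by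
  have h := (seriesV s f).sub_mem (gaugedPotential_mem_seriesV hγ) <| (seriesV s f).add_mem
    (C_mem_seriesV IsVectorSeed.potential.mem_spaceV) (gradShift_mem_seriesV hγ)
  convert h using 1
  ext1 μ
  ext1 a
  exact (add_sub_cancel_left _ _).symm

theorem inGV_Sig (hγ : γ ∈ seriesS s f) : InGV s f (Sig f γ) :=
  ⟨fun μ a => by simp [coeff_Sig], Sig_mem_seriesV hγ⟩

end Series

section Agreement

open PowerSeries Finset

variable {ι : Type*} {C : ProperCone ℝ Spacetime} {A : Config C ι} {n : ℕ}
  {γ γ' v v' : ι → (WickField C ι)⟦X⟧}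

/-- The terms of order less than `n` of `u` and `v` agree at the configuration `A`. -/
def AgreeAt (A : Config C ι) (n : ℕ) (u v : ι → (WickField C ι)⟦X⟧) : Prop :=
  ∀ k < n, ∀ a, coeff k (u a) A = coeff k (v a) A

theorem agreeAt_below (A : Config C ι) (n : ℕ) (u : ι → (WickField C ι)⟦X⟧) :
    AgreeAt A n (fun a => below n (u a)) u := fun k hk a => by
  rw [coeff_below_of_lt hk]

theorem AgreeAt.gradShift (h : AgreeAt A (n + 1) γ γ') (μ : Fin 4) :
    AgreeAt A n (gradShift μ γ) (gradShift μ γ') := fun k hk a => by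
  simp only [StringYM.gradShift, coeff_mk]
  exact congrArg (partialDeriv μ) (h (k + 1) (by lia) a)

variable [Fintype ι]

theorem ad_apply (f : ι → ι → ι → ℝ) (X Y : ι → WickField C ι) (e : ι) (A : Config C ι) :
    ad f X Y e A = ∑ a, ∑ b, (f a b e : ℂ) • (X a A * Y b A) := by
  simp only [ad, Finset.sum_apply, Pi.smul_apply, Pi.mul_apply]

theorem AgreeAt.ad (f : ι → ι → ι → ℝ) (h0 : ∀ a, X ∣ γ a) (h0' : ∀ a, X ∣ γ' a)
    (hγ : AgreeAt A (n + 1) γ γ') (hv : AgreeAt A n v v') :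
    AgreeAt A (n + 1) (ad f γ v) (ad f γ' v') := by
  intro k hk e
  simp only [coeff_ad, Finset.sum_apply, ad_apply]
  refine sum_congr rfl fun p hp => sum_congr rfl fun a _ => sum_congr rfl fun b _ => ?_
  rw [HasAntidiagonal.mem_antidiagonal] at hp
  rcases p.1.eq_zero_or_pos with hp1 | hp1
  · simp only [hp1, coeff_zero_eq_constantCoeff_apply, X_dvd_iff.1 (h0 a), X_dvd_iff.1 (h0' a),
      Pi.zero_apply, zero_mul]
  · rw [hγ p.1 (by lia), hv p.2 (by lia)]

theorem AgreeAt.ad_iterate_succ (f : ι → ι → ι → ℝ) (h0 : ∀ a, X ∣ γ a) (h0' : ∀ a, X ∣ γ' a)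
    (hγ : AgreeAt A (n + 1) γ γ') (hv : AgreeAt A n v v') (j : ℕ) :
    AgreeAt A (n + 1) ((StringYM.ad f γ)^[j + 1] v) ((StringYM.ad f γ')^[j + 1] v') := by
  induction j with
  | zero => exact hγ.ad f h0 h0' hv
  | succ j ih =>
    rw [Function.iterate_succ_apply' _ (j + 1), Function.iterate_succ_apply' _ (j + 1)]
    exact hγ.ad f h0 h0' fun k hk => ih k (by lia)

theorem AgreeAt.sig (f : ι → ι → ι → ℝ) (h0 : ∀ a, X ∣ γ a) (h0' : ∀ a, X ∣ γ' a)
    (hγ : AgreeAt A (n + 1) γ γ') (μ : Fin 4) : AgreeAt A (n + 1) (Sig f γ μ) (Sig f γ' μ) := by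
  have hbase (c : ℂ) : AgreeAt A n
      ((fun b => PowerSeries.C (potential μ b)) + c • StringYM.gradShift μ γ)
      ((fun b => PowerSeries.C (potential μ b)) + c • StringYM.gradShift μ γ') := fun k hk a => by
    simp only [Pi.add_apply, Pi.smul_apply, map_add, LinearMap.map_smul_of_tower,
      hγ.gradShift μ k hk a]
  intro k hk a
  simp only [coeff_Sig, Finset.sum_apply, Pi.smul_apply]
  refine sum_congr rfl fun j hj => ?_
  obtain ⟨i, rfl⟩ := Nat.exists_eq_add_of_le' (mem_Icc.1 hj).1
  rw [hγ.ad_iterate_succ f h0 h0' (hbase _) i k hk a]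

end Agreement

section AxialMap

open PowerSeries Finset

variable {ι : Type*} {C : ProperCone ℝ Spacetime} {s : StringFunction}
  {f : ι → ι → ι → ℝ}
  {v w : Fin 4 → ι → (WickField s.cone ι)⟦X⟧} {γ γ' : ι → (WickField s.cone ι)⟦X⟧}
  {A : Config s.cone ι}

/-- The string integration `I_c^μ v_μ` of a power series of vector fields. -/
def stringIntSeries (s : StringFunction) (v : Fin 4 → ι → (WickField s.cone ι)⟦X⟧) :
    ι → (WickField s.cone ι)⟦X⟧ :=
  fun a => ∑ μ, mapCoeff (stringInt s μ) (v μ a)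

theorem coeff_stringIntSeries (v : Fin 4 → ι → (WickField s.cone ι)⟦X⟧) (n : ℕ) (a : ι) :
    coeff n (stringIntSeries s v a) = stringIntVec s (fun μ b => coeff n (v μ b)) a := by
  simp only [stringIntSeries, map_sum, coeff_mapCoeff, stringIntVec]

variable [Fintype ι]

/-- The vector field `g A_μ + g Σ_μ(γ)`. -/
def axialDensity (f : ι → ι → ι → ℝ) (γ : ι → (WickField C ι)⟦X⟧) :
    Fin 4 → ι → (WickField C ι)⟦X⟧ :=
  fun μ b => X * (PowerSeries.C (potential μ b) + Sig f γ μ b)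

/-- The map `γ ↦ I_c^μ (g A_μ + g Σ_μ(γ))`, whose fixed point is the solution of the axial
equation. -/
def axialMap (s : StringFunction) (f : ι → ι → ι → ℝ) (γ : ι → (WickField s.cone ι)⟦X⟧) :
    ι → (WickField s.cone ι)⟦X⟧ :=
  stringIntSeries s (axialDensity f γ)

theorem coeff_axialMap (γ : ι → (WickField s.cone ι)⟦X⟧) (n : ℕ) (a : ι) :
    coeff n (axialMap s f γ a) = ∑ μ, stringInt s μ
      (coeff n (X * (PowerSeries.C (potential μ a) + Sig f γ μ a))) :=
  coeff_stringIntSeries _ n a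

theorem stringIntSeries_mem_seriesS (hv : v ∈ seriesV s f) :
    stringIntSeries s v ∈ seriesS s f := by
  intro n
  simp only [coeff_stringIntSeries]
  exact stringIntVec_mem_spaceS (hv n)

theorem stringIntSeries_add (hv : v ∈ seriesV s f) (hw : w ∈ seriesV s f) :
    stringIntSeries s (v + w) = stringIntSeries s v + stringIntSeries s w := by
  ext a n : 2
  have hadd := isLinearOn_stringIntVec.map_add
    (fun μ _ b _ => (realRegular_coeff_of_mem_seriesV hv n μ b).1)
    (fun μ _ b _ => (realRegular_coeff_of_mem_seriesV hw n μ b).1)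
  simp only [Pi.add_apply, map_add, coeff_stringIntSeries]
  exact congrFun hadd a

theorem stringIntSeries_mapCoeff_pd (hγ : γ ∈ seriesS s f) :
    (stringIntSeries s fun μ a => mapCoeff (pd μ) (γ a)) = -γ := by
  ext a n : 2
  simp only [coeff_stringIntSeries, coeff_mapCoeff]
  exact congrFun (stringIntVec_grad fun b => (realRegular_coeff_of_mem_seriesS hγ n b).1) a

theorem axialDensity_mem_seriesV (hγ : γ ∈ seriesS s f) : axialDensity f γ ∈ seriesV s f :=
  X_mul_mem_seriesV <|
    (seriesV s f).add_mem (C_mem_seriesV IsVectorSeed.potential.mem_spaceV) (Sig_mem_seriesV hγ)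

theorem axialMap_mem_seriesS (hγ : γ ∈ seriesS s f) : axialMap s f γ ∈ seriesS s f :=
  stringIntSeries_mem_seriesS (axialDensity_mem_seriesV hγ)

theorem X_dvd_axialMap (γ : ι → (WickField s.cone ι)⟦X⟧) (a : ι) : X ∣ axialMap s f γ a := by
  simp only [X_dvd_iff, ← coeff_zero_eq_constantCoeff_apply, coeff_axialMap, coeff_zero_X_mul,
    (isLinearOn_stringInt _).map_zero, sum_const_zero]

theorem AgreeAt.coeff_axialMap {n : ℕ} (h0 : ∀ a, X ∣ γ a) (h0' : ∀ a, X ∣ γ' a)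
    (h : AgreeAt A n γ γ') (a : ι) :
    coeff n (axialMap s f γ a) A = coeff n (axialMap s f γ' a) A := by
  simp only [StringYM.coeff_axialMap, Finset.sum_apply]
  refine sum_congr rfl fun μ _ => congrArg (funInt s μ) ?_
  cases n with
  | zero => simp only [coeff_zero_X_mul]
  | succ n =>
    simp only [coeff_succ_X_mul, map_add, Pi.add_apply, h.sig f h0 h0' μ n n.lt_succ_self a]

theorem coeff_axialMap_below (h0 : ∀ a, X ∣ γ a) (n : ℕ) (a : ι) :
    coeff n (axialMap s f (fun b => below n (γ b)) a) = coeff n (axialMap s f γ a) :=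
  funext fun A => (agreeAt_below A n γ).coeff_axialMap (fun b => X_dvd_below (h0 b) n) h0 a

theorem axialMap_eq (hγ : InGS s f γ) :
    axialMap s f γ = γ + stringIntSeries s fun μ b => X * gaugedPotential f γ μ b := by
  obtain ⟨h0, hγ⟩ := inGS_iff.1 hγ
  have split_gauged : (fun μ b => X * gaugedPotential f γ μ b)
      = axialDensity f γ + fun μ b => mapCoeff (pd μ) (γ b) := by
    funext μ b
    rw [Pi.add_apply, Pi.add_apply, ← X_mul_gradShift μ h0, gaugedPotential, axialDensity]
    ring
  rw [split_gauged, stringIntSeries_add (axialDensity_mem_seriesV hγ) (mapCoeff_pd_mem_seriesV hγ),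
    stringIntSeries_mapCoeff_pd hγ, add_neg_cancel_comm_assoc, axialMap]

end AxialMap

section AxialEquation

open PowerSeries Finset

variable {ι d : Type*} {C : ProperCone ℝ Spacetime} {s : StringFunction} {f : ι → ι → ι → ℝ}
  {A : Config C ι} {u u' : (WickField C ι)⟦X⟧}

theorem eqAt_iff : EqAt A u u' ↔ ∀ n, coeff n u A = coeff n u' A :=
  forall_congr' fun _ => funext_iff.symm

theorem EqAt.sum {κ : Type*} (t : Finset κ) {u u' : κ → (WickField C ι)⟦X⟧}
    (h : ∀ k ∈ t, EqAt A (u k) (u' k)) : EqAt A (∑ k ∈ t, u k) (∑ k ∈ t, u' k) := fun n x => by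
  simp only [map_sum, Finset.sum_apply]
  exact sum_congr rfl fun k hk => h k hk n x

theorem EqAt.mapCoeff_stringInt {A : Config s.cone ι} {u u' : (WickField s.cone ι)⟦X⟧}
    (h : EqAt A u u') (μ : Fin 4) :
    EqAt A (mapCoeff (stringInt s μ) u) (mapCoeff (stringInt s μ) u') := by
  simp only [eqAt_iff, coeff_mapCoeff] at h ⊢
  exact fun n => congrArg (funInt s μ) (h n)

variable [Fintype ι]

theorem eqAt_toMatrix_iff {ξ : ι → Matrix d d ℂ} (hξ : LinearIndependent ℂ ξ)
    {u : ι → (WickField C ι)⟦X⟧} :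
    (∀ i j, EqAt A (toMatrix ξ u i j) 0) ↔ ∀ a, EqAt A (u a) 0 := by
  refine ⟨fun h a n x => ?_, fun h i j n x => ?_⟩
  · refine Fintype.linearIndependent_iff.1 hξ (fun a => coeff n (u a) A x) ?_ a
    ext i j
    simpa [coeff_toMatrix, Matrix.sum_apply, mul_comm] using h i j n x
  · simp only [coeff_toMatrix, Finset.sum_apply, Pi.smul_apply, h _ n x, map_zero, Pi.zero_apply,
      smul_zero, sum_const_zero]

theorem sum_mapCoeff_stringInt_toMatrix (ξ : ι → Matrix d d ℂ)
    {v : Fin 4 → ι → (WickField s.cone ι)⟦X⟧} (hv : v ∈ seriesV s f) (i j : d) :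
    ∑ μ, mapCoeff (stringInt s μ) (toMatrix ξ (v μ) i j)
      = toMatrix ξ (stringIntSeries s v) i j := by
  ext1 n
  simp only [map_sum, coeff_mapCoeff, coeff_toMatrix, coeff_stringIntSeries, stringIntVec,
    smul_sum]
  rw [sum_comm]
  refine sum_congr rfl fun μ _ => ?_
  have hreg (a : ι) := (realRegular_coeff_of_mem_seriesV hv n μ a).1
  rw [(isLinearOn_stringInt μ).map_sum _ fun a _ => (hreg a).const_smul _]
  exact sum_congr rfl fun a _ => (isLinearOn_stringInt μ).map_smul _ (hreg a)

theorem mem_coeffSubalgebra_smoothFields {γ : ι → (WickField s.cone ι)⟦X⟧} (hγ : γ ∈ seriesS s f)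
    (a : ι) : γ a ∈ coeffSubalgebra (smoothFields s.cone ι) :=
  fun n A => ((realRegular_coeff_of_mem_seriesS hγ n a).1.tame A).1

variable [Fintype d] [DecidableEq d]

theorem axialAt_iff (𝔤 : GaugeAlgebra ι d) {γ : ι → (WickField s.cone ι)⟦X⟧}
    (hγ : InGS s 𝔤.f γ) (A : Config s.cone ι) :
    AxialAt s 𝔤.ξ γ A ↔ ∀ a, EqAt A (γ a) (axialMap s 𝔤.f γ a) := by
  obtain ⟨h0, hγS⟩ := inGS_iff.1 hγ
  have string_integral (i j : d) :
      ∑ μ, mapCoeff (stringInt s μ) (gaugeTransform 𝔤.ξ γ μ i j)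
        = toMatrix 𝔤.ξ (axialMap s 𝔤.f γ - γ) i j := by
    simp only [gaugeTransform_eq 𝔤 h0 (mem_coeffSubalgebra_smoothFields hγS), ← toMatrix_smul]
    rw [axialMap_eq hγ, add_sub_cancel_left]
    exact sum_mapCoeff_stringInt_toMatrix 𝔤.ξ
      (X_mul_mem_seriesV (gaugedPotential_mem_seriesV hγS)) i j
  simp only [AxialAt, string_integral, eqAt_toMatrix_iff 𝔤.linearIndependent_complex]
  refine forall_congr' fun a => forall₂_congr fun n x => ?_
  simp [sub_eq_zero, eq_comm (a := coeff n (γ a) A x)]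

theorem eqAt_of_axialAt (𝔤 : GaugeAlgebra ι d) {γ γ' : ι → (WickField s.cone ι)⟦X⟧}
    (hγ : InGS s 𝔤.f γ) (hγ' : InGS s 𝔤.f γ') {A : Config s.cone ι} (h : AxialAt s 𝔤.ξ γ A)
    (h' : AxialAt s 𝔤.ξ γ' A) (a : ι) : EqAt A (γ a) (γ' a) := by
  simp only [axialAt_iff 𝔤 hγ, axialAt_iff 𝔤 hγ', eqAt_iff] at h h' ⊢
  intro n
  induction n using Nat.strong_induction_on generalizing a with
  | _ n ih =>
    have agree : AgreeAt A n γ γ' := fun k hk b => ih k hk b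
    rw [h, h', agree.coeff_axialMap (inGS_iff.1 hγ).1 (inGS_iff.1 hγ').1]

theorem axialAt_forall_iff (𝔤 : GaugeAlgebra ι d) {γ : ι → (WickField s.cone ι)⟦X⟧}
    (hγ : InGS s 𝔤.f γ) : (∀ A, AxialAt s 𝔤.ξ γ A) ↔ γ = axialMap s 𝔤.f γ := by
  simp only [axialAt_iff 𝔤 hγ, eqAt_iff, funext_iff (f := γ), PowerSeries.ext_iff]
  exact ⟨fun h a n => funext fun A => h A a n, fun h A a n => congrFun (h a n) A⟩

theorem existsUnique_axialAt (𝔤 : GaugeAlgebra ι d) (s : StringFunction) :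
    ∃! γ, InGS s 𝔤.f γ ∧ ∀ A, AxialAt s 𝔤.ξ γ A := by
  obtain ⟨γ, hγS, hγ⟩ := exists_coeff_eq_coeff_below (S := {X | X ∈ spaceS s 𝔤.f})
    (spaceS s 𝔤.f).zero_mem (axialMap s 𝔤.f) fun _ => axialMap_mem_seriesS (γ := _)
  have h0 (a : ι) : X ∣ γ a := by
    rw [X_dvd_iff, ← coeff_zero_eq_constantCoeff_apply, hγ, coeff_zero_eq_constantCoeff_apply,
      X_dvd_iff.1 (X_dvd_axialMap _ a)]
  have fixed : γ = axialMap s 𝔤.f γ := by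
    ext a n : 2
    rw [hγ, coeff_axialMap_below h0]
  have hInGS := inGS_iff.2 ⟨h0, hγS⟩
  have hax := (axialAt_forall_iff 𝔤 hInGS).2 fixed
  refine ⟨γ, ⟨hInGS, hax⟩, fun γ' ⟨hγ', hax'⟩ => ?_⟩
  ext a n A x
  exact eqAt_of_axialAt 𝔤 hγ' hInGS (hax' A) (hax A) a n x

end AxialEquation

/-! ### The recursion for `α` -/

section Omega

open PowerSeries Finset

variable {ι : Type*} [Fintype ι] [DecidableEq ι] {C : ProperCone ℝ Spacetime} {T₀ : CDist}
  {α α' : Fin 4 → ι → (WickField C ι)⟦X⟧} {u u' : (WickField C ι)⟦X⟧}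

theorem coeff_omega (T₀ : CDist) (α : Fin 4 → ι → (WickField C ι)⟦X⟧) (u : (WickField C ι)⟦X⟧)
    (n : ℕ) : coeff n (omega T₀ α u) = ∑ p ∈ antidiagonal n,
      obstruction T₀ (fun μ a => coeff p.1 (α μ a)) (coeff p.2 u) :=
  coeff_mk n _

theorem expOmega_eq_formalSum (T₀ : CDist) (α : Fin 4 → ι → (WickField C ι)⟦X⟧)
    (u : (WickField C ι)⟦X⟧) :
    expOmega T₀ α u = formalSum fun k => ((k.factorial : ℂ)⁻¹) • (omega T₀ α)^[k] u := rfl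

theorem FOmega_eq_formalSum (T₀ : CDist) (α : Fin 4 → ι → (WickField C ι)⟦X⟧)
    (u : (WickField C ι)⟦X⟧) :
    FOmega T₀ α u = formalSum fun k => (((k + 1).factorial : ℂ)⁻¹) • (omega T₀ α)^[k] u := rfl

theorem coeff_sub_FOmega (T₀ : CDist) (α : Fin 4 → ι → (WickField C ι)⟦X⟧)
    (u : (WickField C ι)⟦X⟧) (n : ℕ) : coeff n (u - FOmega T₀ α u)
      = -∑ k ∈ range n, (((k + 2).factorial : ℂ)⁻¹) • coeff n ((omega T₀ α)^[k + 1] u) := by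
  rw [FOmega_eq_formalSum, map_sub, coeff_formalSum, sum_range_succ']
  simp [LinearMap.map_smul_of_tower]

theorem obstruction_coeff_zero (hT₀ : IsPropagator T₀) (h0 : ∀ μ a, X ∣ α μ a)
    (Y : WickField C ι) : obstruction T₀ (fun μ a => coeff 0 (α μ a)) Y = 0 := by
  simp only [coeff_zero_eq_constantCoeff_apply, X_dvd_iff.1 (h0 _ _)]
  exact obstruction_zero_left hT₀ Y

theorem X_pow_succ_dvd_omega (hT₀ : IsPropagator T₀) (h0 : ∀ μ a, X ∣ α μ a) {m : ℕ}
    (hu : X ^ m ∣ u) : X ^ (m + 1) ∣ omega T₀ α u := by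
  refine X_pow_dvd_iff.2 fun n hn => (coeff_omega T₀ α u n).trans (sum_eq_zero fun p hp => ?_)
  rw [HasAntidiagonal.mem_antidiagonal] at hp
  rcases p.1.eq_zero_or_pos with hp1 | hp1
  · rw [hp1, obstruction_coeff_zero hT₀ h0]
  · rw [X_pow_dvd_iff.1 hu p.2 (by lia), (isLinearOn_obstruction T₀ _).map_zero]

theorem X_pow_dvd_omega_iterate (hT₀ : IsPropagator T₀) (h0 : ∀ μ a, X ∣ α μ a)
    (u : (WickField C ι)⟦X⟧) (k : ℕ) : X ^ k ∣ (omega T₀ α)^[k] u := by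
  induction k with
  | zero => simp
  | succ k ih =>
    rw [Function.iterate_succ_apply']
    exact X_pow_succ_dvd_omega hT₀ h0 ih

theorem expOmega_eq_add (hT₀ : IsPropagator T₀) (h0 : ∀ μ a, X ∣ α μ a)
    (u : (WickField C ι)⟦X⟧) : expOmega T₀ α u = u + FOmega T₀ α (omega T₀ α u) := by
  rw [expOmega_eq_formalSum,
    formalSum_succ fun k => dvd_smul_of_dvd _ (X_pow_dvd_omega_iterate hT₀ h0 u k)]
  simp only [Nat.factorial_zero, Nat.cast_one, inv_one, one_smul, Function.iterate_zero_apply,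
    Function.iterate_succ_apply, FOmega_eq_formalSum]

theorem omega_C_potential (hT₀ : IsPropagator T₀) (hα : ∀ n μ a, RealRegular (coeff n (α μ a)))
    (μ : Fin 4) (a : ι) : omega T₀ α (PowerSeries.C (potential μ a)) = α μ a := by
  ext1 n
  rw [coeff_omega, sum_eq_single_of_mem (n, 0) (by simp), coeff_zero_C,
    obstruction_potential hT₀ (hα n)]
  intro p hp hne
  have : p.2 ≠ 0 := fun h => hne (by simpa [h, Prod.ext_iff] using hp)
  rw [coeff_C, if_neg this, (isLinearOn_obstruction T₀ _).map_zero]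

/-- Since both `U` and `u` have order at least `1`, the coefficient of order `n` of `ω_U(u)`
involves only coefficients of order less than `n`. -/
theorem coeff_omega_congr (hT₀ : IsPropagator T₀) (h0 : ∀ μ a, X ∣ α μ a)
    (h0' : ∀ μ a, X ∣ α' μ a) (hu0 : X ∣ u) (hu0' : X ∣ u') {n : ℕ}
    (hα : ∀ k < n, ∀ μ a, coeff k (α μ a) = coeff k (α' μ a))
    (hu : ∀ k < n, coeff k u = coeff k u') {k : ℕ} (hk : k < n + 1) :
    coeff k (omega T₀ α u) = coeff k (omega T₀ α' u') := by
  rw [coeff_omega, coeff_omega]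
  refine sum_congr rfl fun p hp => ?_
  rw [HasAntidiagonal.mem_antidiagonal] at hp
  rcases p.1.eq_zero_or_pos with hp1 | hp1
  · rw [hp1, obstruction_coeff_zero hT₀ h0, obstruction_coeff_zero hT₀ h0']
  rcases p.2.eq_zero_or_pos with hp2 | hp2
  · simp only [hp2, coeff_zero_eq_constantCoeff_apply, X_dvd_iff.1 hu0, X_dvd_iff.1 hu0',
      (isLinearOn_obstruction T₀ _).map_zero]
  · simp only [hu p.2 (by lia), hα p.1 (by lia)]

theorem coeff_omega_iterate_congr (hT₀ : IsPropagator T₀) (h0 : ∀ μ a, X ∣ α μ a)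
    (h0' : ∀ μ a, X ∣ α' μ a) (hu0 : X ∣ u) (hu0' : X ∣ u') {n : ℕ}
    (hα : ∀ k < n, ∀ μ a, coeff k (α μ a) = coeff k (α' μ a))
    (hu : ∀ k < n, coeff k u = coeff k u') (j : ℕ) {k : ℕ} (hk : k < n + 1) :
    coeff k ((omega T₀ α)^[j + 1] u) = coeff k ((omega T₀ α')^[j + 1] u') := by
  induction j generalizing k with
  | zero => exact coeff_omega_congr hT₀ h0 h0' hu0 hu0' hα hu hk
  | succ j ih =>
    have X_dvd_iterate {β : Fin 4 → ι → (WickField C ι)⟦X⟧} (hβ : ∀ μ a, X ∣ β μ a)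
        (v : (WickField C ι)⟦X⟧) : X ∣ (omega T₀ β)^[j + 1] v :=
      (dvd_pow_self X j.succ_ne_zero).trans (X_pow_dvd_omega_iterate hT₀ hβ v (j + 1))
    rw [Function.iterate_succ_apply', Function.iterate_succ_apply' (omega T₀ α')]
    exact coeff_omega_congr hT₀ h0 h0' (X_dvd_iterate h0 u) (X_dvd_iterate h0' u') hα
      (fun l hl => ih (by lia)) hk

theorem coeff_sub_FOmega_congr (hT₀ : IsPropagator T₀) (h0 : ∀ μ a, X ∣ α μ a)
    (h0' : ∀ μ a, X ∣ α' μ a) {n : ℕ} (hα : ∀ k < n, ∀ μ a, coeff k (α μ a) = coeff k (α' μ a))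
    (μ : Fin 4) (a : ι) :
    coeff n (α μ a - FOmega T₀ α (α μ a)) = coeff n (α' μ a - FOmega T₀ α' (α' μ a)) := by
  rw [coeff_sub_FOmega, coeff_sub_FOmega]
  refine congrArg _ (sum_congr rfl fun j _ => congrArg _ ?_)
  exact coeff_omega_iterate_congr hT₀ h0 h0' (h0 μ a) (h0' μ a) hα (fun k hk => hα k hk μ a) j
    n.lt_succ_self

theorem coeff_sub_FOmega_below (hT₀ : IsPropagator T₀) (h0 : ∀ μ a, X ∣ α μ a) (n : ℕ)
    (μ : Fin 4) (a : ι) :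
    coeff n (below n (α μ a) - FOmega T₀ (fun ν b => below n (α ν b)) (below n (α μ a)))
      = coeff n (α μ a - FOmega T₀ α (α μ a)) :=
  coeff_sub_FOmega_congr hT₀ (fun ν b => X_dvd_below (h0 ν b) n) h0
    (fun _ hk _ _ => coeff_below_of_lt hk _) μ a

theorem eq_of_FOmega_eq (hT₀ : IsPropagator T₀) (h0 : ∀ μ a, X ∣ α μ a)
    (h0' : ∀ μ a, X ∣ α' μ a) (h : ∀ μ a, FOmega T₀ α (α μ a) = FOmega T₀ α' (α' μ a)) :
    α = α' := by
  ext μ a n : 3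
  induction n using Nat.strong_induction_on generalizing μ a with
  | _ n ih =>
    have hn := coeff_sub_FOmega_congr hT₀ h0 h0' (fun k hk ν b => ih k hk ν b) μ a
    rwa [map_sub, map_sub, h μ a, sub_left_inj] at hn

end Omega

section DressingRecursion

open PowerSeries Finset

variable {ι : Type*} [Fintype ι] [DecidableEq ι] {s : StringFunction} {f : ι → ι → ι → ℝ}
  {T₀ : CDist} {α v : Fin 4 → ι → (WickField s.cone ι)⟦X⟧}

theorem omega_mem_seriesV (hT₀ : IsPropagator T₀) (hα : α ∈ seriesV s f) (hv : v ∈ seriesV s f) :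
    (fun μ a => omega T₀ α (v μ a)) ∈ seriesV s f := by
  intro n
  have := (spaceV s f).sum_mem (t := antidiagonal n) fun p _ =>
    obstruction_mem_spaceV hT₀ (hα p.1) (hv p.2)
  convert this using 1
  ext1 μ
  ext1 a
  simp only [coeff_omega, Finset.sum_apply]

theorem omega_iterate_mem_seriesV (hT₀ : IsPropagator T₀) (hα : α ∈ seriesV s f)
    (hv : v ∈ seriesV s f) (k : ℕ) : (fun μ a => (omega T₀ α)^[k] (v μ a)) ∈ seriesV s f := by
  induction k with
  | zero => exact hv
  | succ k ih =>
    simp only [Function.iterate_succ_apply']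
    exact omega_mem_seriesV hT₀ hα ih

theorem FOmega_mem_seriesV (hT₀ : IsPropagator T₀) (hα : α ∈ seriesV s f) (hv : v ∈ seriesV s f) :
    (fun μ a => FOmega T₀ α (v μ a)) ∈ seriesV s f := by
  have := formalSum_mem_seriesV fun k => coe_smul_mem_seriesV ((k + 1).factorial : ℝ)⁻¹ <|
    omega_iterate_mem_seriesV hT₀ hα hv k
  push_cast at this
  exact this

theorem existsUnique_FOmega_eq (hT₀ : IsPropagator T₀)
    {σ : Fin 4 → ι → (WickField s.cone ι)⟦X⟧} (hσ : InGV s f σ) :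
    ∃! α, InGV s f α ∧ ∀ μ a, FOmega T₀ α (α μ a) = σ μ a := by
  obtain ⟨hσ0, hσV⟩ := inGV_iff.1 hσ
  let Φ (w : Fin 4 × ι → (WickField s.cone ι)⟦X⟧) (k : Fin 4 × ι) : (WickField s.cone ι)⟦X⟧ :=
    σ k.1 k.2 + (w k - FOmega T₀ w.curry (w k))
  obtain ⟨w, hwV, hw⟩ := exists_coeff_eq_coeff_below (S := {v | v.curry ∈ spaceV s f})
    (spaceV s f).zero_mem Φ fun w (hw : w.curry ∈ seriesV s f) =>
      (seriesV s f).add_mem hσV ((seriesV s f).sub_mem hw (FOmega_mem_seriesV hT₀ hw hw))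
  let α := w.curry
  have hα0 (μ : Fin 4) (a : ι) : X ∣ α μ a := by
    rw [X_dvd_iff, ← coeff_zero_eq_constantCoeff_apply]
    refine (hw 0 (μ, a)).trans ?_
    rw [map_add, coeff_sub_FOmega, coeff_zero_eq_constantCoeff_apply, X_dvd_iff.1 (hσ0 μ a),
      range_zero, sum_empty, neg_zero, add_zero]
  have hα : InGV s f α := inGV_iff.2 ⟨hα0, hwV⟩
  have hασ (μ : Fin 4) (a : ι) : FOmega T₀ α (α μ a) = σ μ a := by
    ext1 n
    have hn : coeff n (α μ a) = coeff n (σ μ a) + coeff n (below n (α μ a)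
        - FOmega T₀ (fun ν b => below n (α ν b)) (below n (α μ a))) := hw n (μ, a)
    rw [coeff_sub_FOmega_below hT₀ hα0, map_sub] at hn
    linear_combination hn
  exact ⟨α, ⟨hα, hασ⟩, fun α' h => eq_of_FOmega_eq hT₀ (inGV_iff.1 h.1).1 hα0 fun μ a =>
    (h.2 μ a).trans (hασ μ a).symm⟩

end DressingRecursion

/-! ### The axial projection -/

section AxialProjection

open PowerSeries Finset

variable {ι : Type*} {s : StringFunction} {v : Fin 4 → ι → WickField s.cone ι}

/-- The projection `v_μ ↦ v_μ + ∂_μ I_c^ν v_ν` onto the vector fields with `I_c^μ v_μ = 0`. -/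
def axialProj (s : StringFunction) (v : Fin 4 → ι → WickField s.cone ι) :
    Fin 4 → ι → WickField s.cone ι :=
  v + grad (stringIntVec s v)

theorem isLinearOn_axialProj :
    IsLinearOn (Submodule.pi Set.univ fun _ => Submodule.pi Set.univ fun _ =>
      regularFields s.cone ι) (axialProj s) where
  map_add {v w} hv hw := funext₂ fun μ a => by
    have hI := stringIntVec_regular (s := s) (fun μ a => hv μ trivial a trivial) a
    have hI' := stringIntVec_regular (s := s) (fun μ a => hw μ trivial a trivial) a
    simp only [axialProj, Pi.add_apply, grad, isLinearOn_stringIntVec.map_add hv hw,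
      (isLinearOn_pd μ).map_add hI hI', add_add_add_comm]
  map_smul z v hv := funext₂ fun μ a => by
    have hI := stringIntVec_regular (s := s) (fun μ a => hv μ trivial a trivial) a
    simp only [axialProj, Pi.add_apply, Pi.smul_apply, grad,
      isLinearOn_stringIntVec.map_smul z hv, (isLinearOn_pd μ).map_smul z hI, smul_add]

theorem stringPotential_eq_axialProj (s : StringFunction) :
    (stringPotential s : Fin 4 → ι → WickField s.cone ι) = axialProj s potential := by
  funext μ a
  have hpotential (ν : Fin 4) : Regular (potential ν a : WickField s.cone ι) :=
    Regular.potential ν a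
  have stringInt_fieldStrength (ν : Fin 4) : stringInt s ν (fieldStrength μ ν a)
      = pd μ (stringInt s ν (potential ν a)) - stringInt s ν (pd ν (potential μ a)) := by
    have hpd (κ l : Fin 4) : pd κ (potential l a) ∈ regularFields s.cone ι := (hpotential l).pd κ
    rw [pd_stringInt (hpotential ν), fieldStrength, (isLinearOn_stringInt ν).map_sub (hpd μ ν)
      (hpd ν μ)]
  rw [stringPotential, sum_congr rfl fun ν _ => stringInt_fieldStrength ν, sum_sub_distrib,
    sum_stringInt_pd (hpotential μ), sub_neg_eq_add, add_comm, axialProj, Pi.add_apply,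
    Pi.add_apply, grad, stringIntVec,
    (isLinearOn_pd μ).map_sum _ fun ν _ => (hpotential ν).stringInt ν]

theorem obstruction_axialProj [Fintype ι] [DecidableEq ι] (T₀ : CDist)
    (α : Fin 4 → ι → WickField s.cone ι) (hv : ∀ μ a, Regular (v μ a)) (μ : Fin 4) (a : ι) :
    obstruction T₀ α (axialProj s v μ a)
      = axialProj s (fun ν b => obstruction T₀ α (v ν b)) μ a := by
  have hI := stringIntVec_regular hv a
  have hadd := (isLinearOn_obstruction T₀ α).map_add (hv μ a) (hI.pd μ)
  simp only [axialProj, Pi.add_apply, grad, hadd, obstruction_pd hI,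
    congrFun (obstruction_stringIntVec hv) a]

end AxialProjection

section AxialProjectionSeries

open PowerSeries Finset

variable {ι : Type*} {s : StringFunction} {f : ι → ι → ι → ℝ}

/-- The axial projection of a power series of vector fields, `v_μ ↦ v_μ + ∂_μ I_c^ν v_ν`. -/
def axialProjSeries (s : StringFunction) (v : Fin 4 → ι → (WickField s.cone ι)⟦X⟧) :
    Fin 4 → ι → (WickField s.cone ι)⟦X⟧ :=
  v + fun μ a => mapCoeff (pd μ) (stringIntSeries s v a)

theorem coeff_axialProjSeries (v : Fin 4 → ι → (WickField s.cone ι)⟦X⟧) (n : ℕ) (μ : Fin 4)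
    (a : ι) : coeff n (axialProjSeries s v μ a)
      = axialProj s (fun ν b => coeff n (v ν b)) μ a := by
  simp only [axialProjSeries, Pi.add_apply, map_add, coeff_mapCoeff, coeff_stringIntSeries,
    axialProj, grad]

theorem axialProjSeries_C (v : Fin 4 → ι → WickField s.cone ι) (μ : Fin 4) (a : ι) :
    axialProjSeries s (fun ν b => PowerSeries.C (v ν b)) μ a
      = PowerSeries.C (axialProj s v μ a) := by
  ext1 n
  rw [coeff_axialProjSeries]
  simp only [coeff_C]
  split_ifs
  exacts [rfl, congrFun₂ isLinearOn_axialProj.map_zero μ a]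

theorem stringIntSeries_X_mul (v : Fin 4 → ι → (WickField s.cone ι)⟦X⟧) (a : ι) :
    stringIntSeries s (fun μ b => X * v μ b) a = X * stringIntSeries s v a := by
  ext1 n
  cases n with
  | zero =>
    simp only [coeff_stringIntSeries, coeff_zero_X_mul]
    exact congrFun isLinearOn_stringIntVec.map_zero a
  | succ n => simp only [coeff_stringIntSeries, coeff_succ_X_mul]

variable [Fintype ι] {v w : Fin 4 → ι → (WickField s.cone ι)⟦X⟧} {ψ : ι → (WickField s.cone ι)⟦X⟧}

theorem axialProjSeries_mem_seriesV (hv : v ∈ seriesV s f) : axialProjSeries s v ∈ seriesV s f :=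
  (seriesV s f).add_mem hv (mapCoeff_pd_mem_seriesV (stringIntSeries_mem_seriesS hv))

theorem axialProjSeries_add (hv : v ∈ seriesV s f) (hw : w ∈ seriesV s f) :
    axialProjSeries s (v + w) = axialProjSeries s v + axialProjSeries s w := by
  ext μ a n : 3
  have hadd := isLinearOn_axialProj.map_add
    (fun μ _ b _ => (realRegular_coeff_of_mem_seriesV hv n μ b).1)
    (fun μ _ b _ => (realRegular_coeff_of_mem_seriesV hw n μ b).1)
  simp only [Pi.add_apply, map_add, coeff_axialProjSeries]
  exact congrFun₂ hadd μ a

theorem axialProjSeries_mapCoeff_pd (hψ : ψ ∈ seriesS s f) :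
    (axialProjSeries s fun μ a => mapCoeff (pd μ) (ψ a)) = 0 := by
  ext μ a n : 3
  have hψn := (realRegular_coeff_of_mem_seriesS hψ n a).1
  rw [axialProjSeries, stringIntSeries_mapCoeff_pd hψ]
  simp only [Pi.add_apply, Pi.neg_apply, map_add, map_neg, coeff_mapCoeff]
  rw [← (isLinearOn_pd μ).map_add hψn ((regularFields s.cone ι).neg_mem hψn), add_neg_cancel,
    (isLinearOn_pd μ).map_zero, Pi.zero_apply, Pi.zero_apply, map_zero]

theorem stringIntSeries_axialProjSeries (hv : v ∈ seriesV s f) :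
    stringIntSeries s (axialProjSeries s v) = 0 := by
  have hI := stringIntSeries_mem_seriesS hv
  rw [axialProjSeries, stringIntSeries_add hv (mapCoeff_pd_mem_seriesV hI),
    stringIntSeries_mapCoeff_pd hI, add_neg_cancel]

theorem axialProjSeries_formalSum {u : ℕ → Fin 4 → ι → (WickField s.cone ι)⟦X⟧}
    (hu : ∀ k, u k ∈ seriesV s f) (z : ℕ → ℂ) (μ : Fin 4) (a : ι) :
    axialProjSeries s (fun ν b => formalSum fun k => z k • u k ν b) μ a
      = formalSum fun k => z k • axialProjSeries s (u k) μ a := by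
  ext1 n
  have hreg (k : ℕ) : (fun ν b => coeff n (u k ν b)) ∈ Submodule.pi Set.univ fun _ =>
      Submodule.pi Set.univ fun _ => regularFields s.cone ι :=
    fun ν _ b _ => (realRegular_coeff_of_mem_seriesV (hu k) n ν b).1
  have hsum := isLinearOn_axialProj.map_sum (range (n + 1)) fun k _ =>
    Submodule.smul_mem _ (z k) (hreg k)
  simp only [isLinearOn_axialProj.map_smul _ (hreg _)] at hsum
  simp only [coeff_axialProjSeries, coeff_formalSum, LinearMap.map_smul_of_tower]
  convert congrFun₂ hsum μ a using 1
  · congr 1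
    ext1 ν
    ext1 b
    simp only [Finset.sum_apply, Pi.smul_apply]
  · simp only [Finset.sum_apply, Pi.smul_apply]

variable [DecidableEq ι] {T₀ : CDist} {α : Fin 4 → ι → (WickField s.cone ι)⟦X⟧}

theorem omega_axialProjSeries (hT₀ : IsPropagator T₀) (hα : α ∈ seriesV s f)
    (hv : v ∈ seriesV s f) (μ : Fin 4) (a : ι) :
    omega T₀ α (axialProjSeries s v μ a)
      = axialProjSeries s (fun ν b => omega T₀ α (v ν b)) μ a := by
  ext1 n
  have hsum := isLinearOn_axialProj.map_sum (antidiagonal n) fun p _ ν _ b _ =>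
    (spaceV_realRegular (obstruction_mem_spaceV hT₀ (hα p.1) (hv p.2)) ν b).1
  simp only [coeff_axialProjSeries, coeff_omega, obstruction_axialProj T₀ _ fun ν b =>
    (realRegular_coeff_of_mem_seriesV hv _ ν b).1]
  convert congrFun₂ hsum.symm μ a using 1
  · simp only [Finset.sum_apply]
  · congr 1
    ext1 ν
    ext1 b
    simp only [Finset.sum_apply]

theorem omega_iterate_axialProjSeries (hT₀ : IsPropagator T₀) (hα : α ∈ seriesV s f)
    (hv : v ∈ seriesV s f) (k : ℕ) (μ : Fin 4) (a : ι) :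
    (omega T₀ α)^[k] (axialProjSeries s v μ a)
      = axialProjSeries s (fun ν b => (omega T₀ α)^[k] (v ν b)) μ a := by
  induction k with
  | zero => rfl
  | succ k ih =>
    simp only [Function.iterate_succ_apply']
    rw [ih, omega_axialProjSeries hT₀ hα (omega_iterate_mem_seriesV hT₀ hα hv k)]

theorem expOmega_axialProjSeries (hT₀ : IsPropagator T₀) (hα : α ∈ seriesV s f)
    (hv : v ∈ seriesV s f) (μ : Fin 4) (a : ι) :
    expOmega T₀ α (axialProjSeries s v μ a)
      = axialProjSeries s (fun ν b => expOmega T₀ α (v ν b)) μ a := by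
  simp only [expOmega_eq_formalSum, omega_iterate_axialProjSeries hT₀ hα hv]
  exact (axialProjSeries_formalSum (omega_iterate_mem_seriesV hT₀ hα hv) _ μ a).symm

theorem expOmega_stringPotential (hT₀ : IsPropagator T₀) (hα : InGV s f α) (μ : Fin 4) (a : ι) :
    expOmega T₀ α (PowerSeries.C (stringPotential s μ a))
      = axialProjSeries s (fun ν b => PowerSeries.C (potential ν b) + FOmega T₀ α (α ν b)) μ a := by
  obtain ⟨h0, hαV⟩ := inGV_iff.1 hα
  rw [stringPotential_eq_axialProj, ← axialProjSeries_C,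
    expOmega_axialProjSeries hT₀ hαV (C_mem_seriesV IsVectorSeed.potential.mem_spaceV)]
  simp only [expOmega_eq_add hT₀ h0,
    omega_C_potential hT₀ (realRegular_coeff_of_mem_seriesV hαV)]

end AxialProjectionSeries

section Dressing

open PowerSeries Finset

variable {ι d : Type*} [Fintype ι] {s : StringFunction} {f : ι → ι → ι → ℝ}
  {γ : ι → (WickField s.cone ι)⟦X⟧} {α : Fin 4 → ι → (WickField s.cone ι)⟦X⟧}

theorem axialProjSeries_potential_add_Sig (hγ : γ = axialMap s f γ) :
    axialProjSeries s (fun ν b => PowerSeries.C (potential ν b) + Sig f γ ν b)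
      = gaugedPotential f γ := by
  have X_mul_stringInt (a : ι) : X * stringIntSeries s
      (fun ν b => PowerSeries.C (potential ν b) + Sig f γ ν b) a = γ a := by
    rw [← stringIntSeries_X_mul]
    exact (congrFun hγ a).symm
  have grad_stringInt (μ : Fin 4) (a : ι) : mapCoeff (pd μ) (stringIntSeries s
      (fun ν b => PowerSeries.C (potential ν b) + Sig f γ ν b) a) = gradShift μ γ a := by
    ext1 n
    rw [coeff_mapCoeff, ← coeff_succ_X_mul, X_mul_stringInt, gradShift, coeff_mk]
  funext μ a
  rw [axialProjSeries, Pi.add_apply, Pi.add_apply, grad_stringInt, gaugedPotential, add_right_comm]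

variable [DecidableEq ι] [Fintype d] [DecidableEq d] {T₀ : CDist}

theorem axialAt_of_dressingAt (𝔤 : GaugeAlgebra ι d) (hT₀ : IsPropagator T₀)
    (hα : InGV s 𝔤.f α) {A : Config s.cone ι} (h : DressingAt s T₀ 𝔤.ξ γ α A) :
    AxialAt s 𝔤.ξ γ A := by
  intro i j
  have hαV := (inGV_iff.1 hα).2
  have hv : (fun ν b => PowerSeries.C (potential ν b) + FOmega T₀ α (α ν b)) ∈ seriesV s 𝔤.f :=
    (seriesV s 𝔤.f).add_mem (C_mem_seriesV IsVectorSeed.potential.mem_spaceV)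
      (FOmega_mem_seriesV hT₀ hαV hαV)
  have dressed_axial : ∑ μ, mapCoeff (stringInt s μ) ((X : (WickField s.cone ι)⟦X⟧) *
      toMatrix 𝔤.ξ (fun a => expOmega T₀ α (PowerSeries.C (stringPotential s μ a))) i j) = 0 := by
    simp only [← smul_eq_mul, ← Matrix.smul_apply, ← toMatrix_smul, expOmega_stringPotential hT₀ hα]
    refine (sum_mapCoeff_stringInt_toMatrix 𝔤.ξ
      (X_mul_mem_seriesV (axialProjSeries_mem_seriesV hv)) i j).trans ?_
    simp only [toMatrix_apply, stringIntSeries_X_mul, stringIntSeries_axialProjSeries hv,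
      Pi.zero_apply, mul_zero, smul_zero, sum_const_zero]
  rw [← dressed_axial]
  exact EqAt.sum univ fun μ _ => EqAt.mapCoeff_stringInt (fun n x => (h μ i j n x).symm) μ

theorem dressingAt_of_axialProjSeries_eq (𝔤 : GaugeAlgebra ι d) (hT₀ : IsPropagator T₀)
    (hγ : InGS s 𝔤.f γ) (hax : ∀ A, AxialAt s 𝔤.ξ γ A) (hα : InGV s 𝔤.f α)
    (h : axialProjSeries s (fun μ a => FOmega T₀ α (α μ a)) = axialProjSeries s (Sig 𝔤.f γ))
    (A : Config s.cone ι) : DressingAt s T₀ 𝔤.ξ γ α A := by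
  obtain ⟨h0, hγS⟩ := inGS_iff.1 hγ
  have hαV := (inGV_iff.1 hα).2
  have hA : (fun ν b => PowerSeries.C (potential ν b)) ∈ seriesV s 𝔤.f :=
    C_mem_seriesV IsVectorSeed.potential.mem_spaceV
  have dressed_eq_gauged :
      axialProjSeries s (fun ν b => PowerSeries.C (potential ν b) + FOmega T₀ α (α ν b))
        = gaugedPotential 𝔤.f γ := by
    rw [← axialProjSeries_potential_add_Sig ((axialAt_forall_iff 𝔤 hγ).1 hax)]
    refine (axialProjSeries_add hA (FOmega_mem_seriesV hT₀ hαV hαV)).trans ?_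
    rw [h]
    exact (axialProjSeries_add hA (Sig_mem_seriesV hγS)).symm
  intro μ i j
  simp only [expOmega_stringPotential hT₀ hα, dressed_eq_gauged,
    gaugeTransform_eq 𝔤 h0 (mem_coeffSubalgebra_smoothFields hγS), Matrix.smul_apply, smul_eq_mul]
  exact fun _ _ => rfl

end Dressing

/-! ### Non-uniqueness of the dressing density -/

section NonUniqueness

open PowerSeries Finset

variable {ι d : Type*} {s : StringFunction}

theorem stringIntVec_potential_ne_zero (s : StringFunction) (a : ι) :
    stringIntVec s (potential : Fin 4 → ι → WickField s.cone ι) a ≠ 0 := by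
  let χ : ContDiffBump (0 : Spacetime) := ⟨1, 2, one_pos, one_lt_two⟩
  have hχ : Tame s.cone (χ : Spacetime → ℝ) :=
    Tame.of_hasCompactSupport χ.contDiff χ.hasCompactSupport
  -- On the pure gauge configuration `A_ν = ∂_ν χ` the field `I_c^ν A_ν` equals `-χ`.
  let pureGauge : Config s.cone ι := ⟨fun ν _ => partialDeriv ν χ, fun ν _ => hχ.partialDeriv ν⟩
  have potential_pureGauge (ν : Fin 4) : (potential ν a : WickField s.cone ι) pureGauge
      = partialDeriv ν fun x => (χ x : ℂ) :=
    (partialDeriv_clm_comp hχ.differentiable Complex.ofRealCLM ν).symm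
  have value_eq : stringIntVec s (potential : Fin 4 → ι → WickField s.cone ι) a pureGauge
      = -fun x => (χ x : ℂ) := by
    rw [← sum_funInt_partialDeriv hχ.ofReal, stringIntVec, Finset.sum_apply]
    exact sum_congr rfl fun ν _ => congrArg (funInt s ν) (potential_pureGauge ν)
  have hχ0 : χ 0 = 1 := χ.one_of_mem_closedBall (by simp [χ])
  intro h
  rw [h] at value_eq
  simpa [hχ0] using congrFun value_eq 0

theorem grad_ne_zero {Y : ι → WickField s.cone ι} (hY : ∀ a, Regular (Y a)) {a : ι}
    (h : Y a ≠ 0) : grad Y ≠ 0 := fun hgrad => by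
  have hneg := congrFun (stringIntVec_grad (s := s) hY) a
  rw [hgrad, isLinearOn_stringIntVec.map_zero] at hneg
  exact h (neg_eq_zero.1 hneg.symm)

variable [Fintype ι] [DecidableEq ι] [Fintype d] [DecidableEq d] {T₀ : CDist}
  {γ : ι → (WickField s.cone ι)⟦X⟧}

theorem exists_ne_dressingAt [Nonempty ι] (𝔤 : GaugeAlgebra ι d) (hT₀ : IsPropagator T₀)
    (hγ : InGS s 𝔤.f γ) (hax : ∀ A, AxialAt s 𝔤.ξ γ A) :
    ∃ α₁ α₂, α₁ ≠ α₂ ∧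
      (InGV s 𝔤.f α₁ ∧ ∀ A, DressingAt s T₀ 𝔤.ξ γ α₁ A) ∧
      (InGV s 𝔤.f α₂ ∧ ∀ A, DressingAt s T₀ 𝔤.ξ γ α₂ A) := by
  have hSig := inGV_Sig (inGS_iff.1 hγ).2
  obtain ⟨h0, hSigV⟩ := inGV_iff.1 hSig
  let Y := stringIntVec s (potential : Fin 4 → ι → WickField s.cone ι)
  have hY : Y ∈ spaceS s 𝔤.f := stringIntVec_mem_spaceS IsVectorSeed.potential.mem_spaceV
  let ψ (a : ι) : (WickField s.cone ι)⟦X⟧ := monomial 1 (Y a)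
  have hψ : ψ ∈ seriesS s 𝔤.f := fun n => by
    simp only [ψ, coeff_monomial]
    split_ifs
    exacts [hY, (spaceS s 𝔤.f).zero_mem]
  have hψ0 (μ : Fin 4) (a : ι) : X ∣ mapCoeff (pd μ) (ψ a) := by
    rw [X_dvd_iff, ← coeff_zero_eq_constantCoeff_apply, coeff_mapCoeff, coeff_monomial,
      if_neg zero_ne_one, (isLinearOn_pd μ).map_zero]
  have hgrad := mapCoeff_pd_mem_seriesV hψ
  obtain ⟨α₁, ⟨hα₁, hF₁⟩, -⟩ := existsUnique_FOmega_eq hT₀ hSig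
  obtain ⟨α₂, ⟨hα₂, hF₂⟩, -⟩ := existsUnique_FOmega_eq hT₀ (inGV_iff.2
    ⟨fun μ a => dvd_add (h0 μ a) (hψ0 μ a), (seriesV s 𝔤.f).add_mem hSigV hgrad⟩)
  have dressing {α} (hα : InGV s 𝔤.f α) := dressingAt_of_axialProjSeries_eq 𝔤 hT₀ hγ hax hα
  refine ⟨α₁, α₂, ?_, ⟨hα₁, dressing hα₁ (congrArg _ (funext₂ hF₁))⟩,
    hα₂, dressing hα₂ ?_⟩
  · rintro rfl
    obtain ⟨a⟩ := ‹Nonempty ι›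
    refine grad_ne_zero (fun b => (spaceS_realRegular hY b).1)
      (stringIntVec_potential_ne_zero s a) (funext₂ fun μ b => ?_)
    have hzero : mapCoeff (pd μ) (ψ b) = 0 := left_eq_add.1 ((hF₁ μ b).symm.trans (hF₂ μ b))
    have hcoeff := congrArg (coeff 1) hzero
    rwa [coeff_mapCoeff, coeff_monomial, if_pos rfl, map_zero] at hcoeff
  · rw [funext₂ hF₂]
    refine (axialProjSeries_add hSigV hgrad).trans ?_
    rw [axialProjSeries_mapCoeff_pd hψ, add_zero]

end NonUniqueness

end StringYM

end

open StringYM PowerSeries in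
theorem propositionp {ι d : Type*} [Fintype ι] [DecidableEq ι] [Fintype d] [DecidableEq d]
    (𝔤 : GaugeAlgebra ι d) (s : StringFunction) (T₀ : CDist) (hT₀ : IsPropagator T₀) :
    (∀ γ α, InGS s 𝔤.f γ → InGV s 𝔤.f α →
      ∀ A, DressingAt s T₀ 𝔤.ξ γ α A → AxialAt s 𝔤.ξ γ A) ∧
    (∃! γ, InGS s 𝔤.f γ ∧ ∀ A, AxialAt s 𝔤.ξ γ A) ∧
    (∀ γ, InGS s 𝔤.f γ → (∀ A, AxialAt s 𝔤.ξ γ A) →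
      (∀ γ', InGS s 𝔤.f γ' → ∀ A, AxialAt s 𝔤.ξ γ' A → ∀ a, EqAt A (γ' a) (γ a)) ∧
      (∀ n a, coeff n (γ a) = ∑ μ, stringInt s μ (coeff n
        (X * (C (potential μ a) + Sig 𝔤.f (fun b => below n (γ b)) μ a)))) ∧
      (∃! α, InGV s 𝔤.f α ∧ ∀ μ a, FOmega T₀ α (α μ a) = Sig 𝔤.f γ μ a) ∧
      (∀ α, InGV s 𝔤.f α → (∀ μ a, FOmega T₀ α (α μ a) = Sig 𝔤.f γ μ a) →
        (∀ A, DressingAt s T₀ 𝔤.ξ γ α A) ∧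
        ∀ n μ a, coeff n (α μ a) = coeff n (Sig 𝔤.f γ μ a + (below n (α μ a)
          - FOmega T₀ (fun ν b => below n (α ν b)) (below n (α μ a))))) ∧
      (Nonempty ι → ∃ α₁ α₂, α₁ ≠ α₂ ∧
        (InGV s 𝔤.f α₁ ∧ ∀ A, DressingAt s T₀ 𝔤.ξ γ α₁ A) ∧
        (InGV s 𝔤.f α₂ ∧ ∀ A, DressingAt s T₀ 𝔤.ξ γ α₂ A))) := by
  refine ⟨fun γ α _ hα A => axialAt_of_dressingAt 𝔤 hT₀ hα, existsUnique_axialAt 𝔤 s,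
    fun γ hγ hax => ?_⟩
  obtain ⟨h0, hγS⟩ := inGS_iff.1 hγ
  refine ⟨fun γ' hγ' A h' a => eqAt_of_axialAt 𝔤 hγ' hγ h' (hax A) a, fun n a => ?_,
    existsUnique_FOmega_eq hT₀ (inGV_Sig hγS), fun α hα hF => ⟨?_, fun n μ a => ?_⟩,
    fun _ => exists_ne_dressingAt 𝔤 hT₀ hγ hax⟩
  · rw [← coeff_axialMap, coeff_axialMap_below h0, ← (axialAt_forall_iff 𝔤 hγ).1 hax]
  · exact dressingAt_of_axialProjSeries_eq 𝔤 hT₀ hγ hax hα (congrArg _ (funext₂ hF))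
  · rw [map_add, ← hF μ a, coeff_sub_FOmega_below hT₀ (inGV_iff.1 hα).1, map_sub, add_sub_cancel]
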